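/- **Setting.** Fix an extended term language: terms are built from variables, rational constants, $+$, $\cdot$ and fixed function symbols $h$ whose interpretations $h:\mathbb R^k\to\mathbb R$ are $C^\infty$ (condition S) and whose partial derivatives $\partial h/\partial y_i$ are represented by terms of the language (condition P). A *semianalytic formula* is a propositional combination of comparisons $e=d$, $e\ge d$, $e>d$ of such terms. For a system of ordinary differential equations $x'=f(x)$ with terms $f(x)$ and a term $e$, let $\dot e=\dot e^{(1)}$ be the (syntactic) Lie derivative of $e$ along $x'=f(x)$, variables without differential equation being constant, and $\dot e^{(i)}$ the $i$-th Lie derivative, $\dot e^{(0)}=e$. Differential dynamic logic has the programs $v:=e$ and $x'=f(x)\,\&\,Q$ with a semianalytic domain constraint $Q$ ($x'=f(x)$ abbreviates $x'=f(x)\,\&\,\mathit{true}$) and the modalities $[\alpha]\phi$, $\langle\alpha\rangle\phi$. Its base proof calculus consists of first-order logic with equality, real arithmetic (all substitution instances of valid formulas of first-order real arithmetic), the modal rules and axioms (duality, K, G, V, assignment), and for differential equations the Barcan, domain (weakening, skip, modus ponens), differential effect, differential (for $(e)'$), differential invariant, differential cut and differential ghost axioms. It is extended by the following axioms, in which $y$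 are fresh variables, and in Cont, RI, RI& the formula $f(x)\ne 0$ is provable (e.g. because the system has a clock $t'=1$): * Uniq: $\langle x'=f(x)\& Q\wedge R\rangle\phi\leftrightarrow\langle x'=f(x)\& Q\rangle\phi\wedge\langle x'=f(x)\& R\rangle\phi$. * Cont: $x=y\to(\langle x'=f(x)\& e>0\rangle\,x\ne y\leftrightarrow e>0)$. * Dadj: $\langle x'=f(x)\& Q(x)\rangle\,x=y\leftrightarrow\langle y'=-f(y)\& Q(y)\rangle\,y=x$. * RI: $[x'=f(x)]P\leftrightarrow\forall y\,[x'=f(x)\& P\vee x=y]\,(x=y\to P\wedge\langle x'=f(x)\& P\vee x=y\rangle\,x\ne y)$. * RI&: $[x'=f(x)\& Q]P\leftrightarrow\forall y\,[x'=f(x)\& Q\wedge(P\vee x=y)]\,\big(x=y\to P\wedge(\langle x'=f(x)\& Q\vee x=y\rangle\,x\ne y\to\langle x'=f(x)\& P\vee x=y\rangle\,x\ne y)\big)$. Assume further (condition R) that each term $e$ and system $x'=f(x)$ comes with a rank $N\ge 1$ for which there are terms $g_i$ such that the identity $\dot e^{(N)}=\sum_{i=0}^{N-1}g_i\,\dot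 e^{(i)}$ is provable in the base calculus. **Progress formulas.** For a term $e$ of rank $N$ along $x'=f(x)$, let $$\dot e^{(*)}>0\;\equiv\;\bigwedge_{i=0}^{N-2}\Big(\bigwedge_{j<i}\dot e^{(j)}=0\to\dot e^{(i)}\ge 0\Big)\wedge\Big(\bigwedge_{j<N-1}\dot e^{(j)}=0\to\dot e^{(N-1)}>0\Big),$$ $$\dot e^{(*)}\ge 0\;\equiv\;\dot e^{(*)}>0\;\vee\;\bigwedge_{j<N}\dot e^{(j)}=0 .$$ A *progress formula* $\dot P^{(*)}$ of a semianalytic formula $P$ along $x'=f(x)$ is obtained from a normal form $\bigvee_i\big(\bigwedge_j e_{ij}\ge 0\wedge\bigwedge_j\tilde e_{ij}>0\big)$ that is provably equivalent to $P$ in the base calculus by replacing each $e_{ij}\ge0$ by $\dot e_{ij}^{(*)}\ge 0$ and each $\tilde e_{ij}>0$ by $\dot{\tilde e}_{ij}^{(*)}>0$. A *backward progress formula* $\dot P^{(-*)}$ is a progress formula of $P$ along $x'=-f(x)$. **Theorem (Semianalytic invariant completeness).** Let $x'=f(x)$ be a system and $P$ a semianalytic formula. Then: 1. Progress formulas $\dot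 P^{(*)}$ and backward progress formulas $(\dot{\neg P})^{(-*)}$ exist. 2. For all of them, the axiom $$\text{(SAI)}\qquad \forall x\,(P\to[x'=f(x)]P)\;\leftrightarrow\;\forall x\,(P\to\dot P^{(*)})\wedge\forall x\,\big(\neg P\to(\dot{\neg P})^{(-*)}\big)$$ is derivable from RI, Dadj, Cont and Uniq (added to the base calculus). 3. For every semianalytic formula $Q$ and all progress formulas $\dot P^{(*)},\dot Q^{(*)}$ and backward progress formulas $(\dot{\neg P})^{(-*)},\dot Q^{(-*)}$, the axiom $$\text{(SAI\&)}\qquad \forall x\,(P\to[x'=f(x)\& Q]P)\;\leftrightarrow\;\forall x\,\big(P\wedge Q\wedge\dot Q^{(*)}\to\dot P^{(*)}\big)\wedge\forall x\,\big(\neg P\wedge Q\wedge\dot Q^{(-*)}\to(\dot{\neg P})^{(-*)}\big)$$ is derivable from RI&, Dadj, Cont and Uniq (added to the base calculus). -/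

import Mathlib

namespace DL

/-! ## Terms -/

/-- A signature of fixed function symbols with their arities. -/
structure Sig where
  Sym : Type
  arity : Sym → ℕ

/-- Differential-free terms over variables `V`: variables, rational constants, sums, products and
applications of the fixed function symbols. -/
inductive Tm (S : Sig) (V : Type) : Type
  | var (x : V) : Tm S V
  | const (c : ℚ) : Tm S V
  | add (s t : Tm S V) : Tm S V
  | mul (s t : Tm S V) : Tm S V
  | app (h : S.Sym) (args : Fin (S.arity h) → Tm S V) : Tm S V

namespace Tm
variable {S : Sig} {V W : Type}

def neg (t : Tm S V) : Tm S V := mul (const (-1)) t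

def sum (l : List (Tm S V)) : Tm S V := l.foldr add (const 0)

/-- Simultaneous substitution. -/
def bind (σ : V → Tm S W) : Tm S V → Tm S W
  | var x => σ x
  | const c => const c
  | add s t => add (s.bind σ) (t.bind σ)
  | mul s t => mul (s.bind σ) (t.bind σ)
  | app h args => app h fun i => (args i).bind σ

def map (ρ : V → W) (t : Tm S V) : Tm S W := t.bind fun x => var (ρ x)

/-- The union of the sets `g x` over all variables `x` that occur in the term. -/
def collect [DecidableEq W] (g : V → Finset W) : Tm S V → Finset W
  | var x => g x
  | const _ => ∅
  | add s t => s.collect g ∪ t.collect g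
  | mul s t => s.collect g ∪ t.collect g
  | app _ args => Finset.univ.biUnion fun i => (args i).collect g

/-- The value of a term, the function symbols being interpreted by `I`. -/
def eval (I : ∀ h : S.Sym, (Fin (S.arity h) → ℝ) → ℝ) (ω : V → ℝ) : Tm S V → ℝ
  | var x => ω x
  | const c => c
  | add s t => s.eval I ω + t.eval I ω
  | mul s t => s.eval I ω * t.eval I ω
  | app h args => I h fun i => (args i).eval I ω

/-- Free variables of a differential-free term over the variables `x₀, x₁, …`. -/
def fv (t : Tm S ℕ) : Finset ℕ := t.collect fun x => {x}

end Tm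

/-- An extended term language: fixed function symbols with their fixed interpretations, which are
smooth, and with terms that represent their partial derivatives. `pd h i` is the term `∂h/∂yᵢ` in
the argument variables `yᵢ` of `h`. -/
structure TermLang extends Sig where
  interp : ∀ h : Sym, (Fin (arity h) → ℝ) → ℝ
  smooth : ∀ h : Sym, ContDiff ℝ ((⊤ : ℕ∞) : WithTop ℕ∞) (interp h)
  pd : ∀ h : Sym, Fin (arity h) → Tm toSig (Fin (arity h))
  pd_spec : ∀ (h : Sym) (i : Fin (arity h)) (y : Fin (arity h) → ℝ),
    HasDerivAt (fun s : ℝ => interp h (Function.update y i s)) ((pd h i).eval interp y) (y i)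

/-- `val n` is the ordinary variable `xₙ`, and `der n` is its differential variable `xₙ'`. -/
inductive Var : Type
  | val (n : ℕ) : Var
  | der (n : ℕ) : Var
  deriving DecidableEq

/-- The atoms from which terms with differentials are built: variables (ordinary and differential)
and differentials `(e)'` of differential-free terms `e`. -/
inductive DVar (S : Sig) : Type
  | var (v : Var) : DVar S
  | diff (e : Tm S ℕ) : DVar S

/-- Terms that may contain differential variables and differentials. -/
abbrev DTm (S : Sig) := Tm S (DVar S)

/-- A differential-free term as a term. -/
abbrev Tm.lift {S : Sig} (e : Tm S ℕ) : DTm S := e.map fun x => DVar.var (Var.val x)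

/-- The differential `(e)'`. -/
abbrev Tm.diff {S : Sig} (e : Tm S ℕ) : DTm S := Tm.var (DVar.diff e)

def DVar.fv {S : Sig} : DVar S → Finset Var
  | .var v => {v}
  | .diff e => e.fv.image Var.val ∪ e.fv.image Var.der

def DVar.diffFv {S : Sig} : DVar S → Finset Var
  | .var _ => ∅
  | .diff e => e.fv.image Var.val ∪ e.fv.image Var.der

def DVar.subst {S : Sig} (v : Var) (e : Tm S ℕ) : DVar S → DTm S
  | .var w => if w = v then e.lift else .var (.var w)
  | .diff e₀ => .var (.diff e₀)

def DVar.rename {S : Sig} (π : ℕ → ℕ) : DVar S → DVar S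
  | .var (.val x) => .var (.val (π x))
  | .var (.der x) => .var (.der (π x))
  | .diff e => .diff (e.map π)

namespace DTm
variable {S : Sig}

def fv (t : DTm S) : Finset Var := t.collect DVar.fv

/-- Variables occurring in the differentials `(e)'` of the term. -/
def diffFv (t : DTm S) : Finset Var := t.collect DVar.diffFv

/-- Variables occurring in the maximal subterms that are not polynomial, i.e. in applications of
function symbols and in differentials. -/
def opaqueFv : DTm S → Finset Var
  | .var a => a.diffFv
  | .const _ => ∅
  | .add s t => opaqueFv s ∪ opaqueFv t
  | .mul s t => opaqueFv s ∪ opaqueFv t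
  | .app _ args => Finset.univ.biUnion fun i => fv (args i)

/-- Value of a term as a polynomial: ordinary variables have the values `ω`, and every other
maximal subterm `t` that is not polynomial counts as a separate unknown with the value `a t`. -/
def polyEval (ω : ℕ → ℝ) (a : DTm S → ℝ) : DTm S → ℝ
  | .var (.var (.val x)) => ω x
  | .var b => a (.var b)
  | .const c => c
  | .add s t => polyEval ω a s + polyEval ω a t
  | .mul s t => polyEval ω a s * polyEval ω a t
  | .app h args => a (.app h args)

end DTm

/-! ## Formulas -/

/-- Comparison operators `=`, `≥`, `>`. -/
inductive Cmp : Type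
  | eq : Cmp
  | ge : Cmp
  | gt : Cmp

def Cmp.Holds : Cmp → ℝ → ℝ → Prop
  | .eq, a, b => a = b
  | .ge, a, b => a ≥ b
  | .gt, a, b => a > b

/-- Semianalytic formulas: no quantifiers, no modalities, no differentials. -/
inductive SA (S : Sig) : Type
  | cmp (c : Cmp) (s t : Tm S ℕ) : SA S
  | and (P Q : SA S) : SA S
  | or (P Q : SA S) : SA S
  | not (P : SA S) : SA S

namespace SA
variable {S : Sig}

def tt : SA S := cmp .eq (.const 0) (.const 0)
def ff : SA S := not tt
def imp (P Q : SA S) : SA S := or (not P) Q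
def conj (l : List (SA S)) : SA S := l.foldr and tt
def disj (l : List (SA S)) : SA S := l.foldr or ff

/-- `e = 0`, `e ≥ 0` and `e > 0`. -/
def eqz (e : Tm S ℕ) : SA S := cmp .eq e (.const 0)
def gez (e : Tm S ℕ) : SA S := cmp .ge e (.const 0)
def gtz (e : Tm S ℕ) : SA S := cmp .gt e (.const 0)

/-- The vectorial equation `x = y`. -/
def eqVec (xs ys : List ℕ) : SA S :=
  conj (List.zipWith (fun x y => cmp .eq (.var x) (.var y)) xs ys)

def bind (σ : ℕ → Tm S ℕ) : SA S → SA S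
  | cmp c s t => cmp c (s.bind σ) (t.bind σ)
  | and P Q => and (P.bind σ) (Q.bind σ)
  | or P Q => or (P.bind σ) (Q.bind σ)
  | not P => not (P.bind σ)

def map (ρ : ℕ → ℕ) (P : SA S) : SA S := P.bind fun x => .var (ρ x)

def fv : SA S → Finset ℕ
  | cmp _ s t => s.fv ∪ t.fv
  | and P Q => P.fv ∪ Q.fv
  | or P Q => P.fv ∪ Q.fv
  | not P => P.fv

end SA

/-- A system `x' = f(x)` of ordinary differential equations in explicit form, as the list of its
equations `(x, f)`, with pairwise distinct left-hand sides. -/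
structure ODE (S : Sig) where
  eqs : List (ℕ × Tm S ℕ)
  nodup : (eqs.map Prod.fst).Nodup

namespace ODE
variable {S : Sig}

/-- The vector `x` of variables evolved by the system. -/
def vars (o : ODE S) : List ℕ := o.eqs.map Prod.fst

/-- The right-hand side for `x`, and `0` for variables without a differential equation, because
these stay constant. -/
def rhs (o : ODE S) (x : ℕ) : Tm S ℕ := (o.eqs.lookup x).getD (.const 0)

/-- All variables of the system, left and right. -/
def fv (o : ODE S) : Finset ℕ := o.eqs.foldr (fun p s => insert p.1 (p.2.fv ∪ s)) ∅

/-- Substitution in the right-hand sides. -/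
def bind (o : ODE S) (σ : ℕ → Tm S ℕ) : ODE S where
  eqs := o.eqs.map fun p => (p.1, p.2.bind σ)
  nodup := by simpa [Function.comp_def] using o.nodup

/-- The backward system `x' = -f(x)`. -/
def neg (o : ODE S) : ODE S where
  eqs := o.eqs.map fun p => (p.1, p.2.neg)
  nodup := by simpa [Function.comp_def] using o.nodup

/-- Renaming of all variables, left and right. -/
def rename (o : ODE S) (π : Equiv.Perm ℕ) : ODE S where
  eqs := o.eqs.map fun p => (π p.1, p.2.map π)
  nodup := by
    have h := o.nodup.map π.injective
    simpa [Function.comp_def] using h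

/-- The system extended by the equation `y' = g`. -/
def ghost (o : ODE S) (y : ℕ) (g : Tm S ℕ) (hy : y ∉ o.vars) : ODE S where
  eqs := (y, g) :: o.eqs
  nodup := List.nodup_cons.2 ⟨hy, o.nodup⟩

/-- `f(x) = 0` -/
def fixpoint (o : ODE S) : SA S := SA.conj (o.eqs.map fun p => SA.eqz p.2)

end ODE

/-- Programs: assignments `v := e` and differential equations `x' = f(x) & Q`. -/
inductive Prog (S : Sig) : Type
  | assign (v : Var) (e : Tm S ℕ) : Prog S
  | ode (o : ODE S) (Q : SA S) : Prog S

/-- The substitution of `e` for `v` in differential-free terms. -/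
def Var.toSubst {S : Sig} (v : Var) (e : Tm S ℕ) : ℕ → Tm S ℕ :=
  fun y => if v = Var.val y then e else .var y

namespace Prog
variable {S : Sig}

/-- Bound variables: for a differential equation, the `x` and the `x'`. -/
def bv : Prog S → Finset Var
  | assign v _ => {v}
  | ode o _ => o.vars.toFinset.image Var.val ∪ o.vars.toFinset.image Var.der

def fv : Prog S → Finset Var
  | assign _ e => e.fv.image Var.val
  | ode o Q => (o.fv ∪ Q.fv).image Var.val

def subst (v : Var) (e : Tm S ℕ) : Prog S → Prog S
  | assign w d => assign w (d.bind (v.toSubst e))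
  | ode o Q =>
    if v ∈ (ode o Q).bv then ode o Q else ode (o.bind (v.toSubst e)) (Q.bind (v.toSubst e))

def rename (π : Equiv.Perm ℕ) : Prog S → Prog S
  | assign (.val x) e => assign (.val (π x)) (e.map π)
  | assign (.der x) e => assign (.der (π x)) (e.map π)
  | ode o Q => ode (o.rename π) (Q.map π)

/-- The substitution of `e` for `v` in the program is admissible. -/
def Adm (v : Var) (e : Tm S ℕ) : Prog S → Prop
  | assign _ _ => True
  | ode o Q => v ∉ (ode o Q).fv ∨ (v ∉ (ode o Q).bv ∧ ∀ x ∈ e.fv, x ∉ o.vars)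

end Prog

/-- Formulas of differential dynamic logic. -/
inductive Fml (S : Sig) : Type
  | cmp (c : Cmp) (s t : DTm S) : Fml S
  | and (φ ψ : Fml S) : Fml S
  | or (φ ψ : Fml S) : Fml S
  | not (φ : Fml S) : Fml S
  | all (x : ℕ) (φ : Fml S) : Fml S
  | ex (x : ℕ) (φ : Fml S) : Fml S
  | box (α : Prog S) (φ : Fml S) : Fml S
  | dia (α : Prog S) (φ : Fml S) : Fml S

/-- A semianalytic formula as a formula. -/
def SA.toFml {S : Sig} : SA S → Fml S
  | .cmp c s t => .cmp c s.lift t.lift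
  | .and P Q => .and P.toFml Q.toFml
  | .or P Q => .or P.toFml Q.toFml
  | .not P => .not P.toFml

instance {S : Sig} : Coe (SA S) (Fml S) := ⟨SA.toFml⟩

namespace Fml
variable {S : Sig}

def imp (φ ψ : Fml S) : Fml S := or (not φ) ψ
def iff (φ ψ : Fml S) : Fml S := and (imp φ ψ) (imp ψ φ)

/-- `∀ x₁ … ∀ xₙ φ` -/
def allVec (xs : List ℕ) (φ : Fml S) : Fml S := xs.foldr all φ

/-- `[v₁ := e₁] … [vₙ := eₙ] φ` -/
def assigns (l : List (Var × Tm S ℕ)) (φ : Fml S) : Fml S :=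
  l.foldr (fun p ψ => box (.assign p.1 p.2) ψ) φ

def fv : Fml S → Finset Var
  | cmp _ s t => DTm.fv s ∪ DTm.fv t
  | and φ ψ => φ.fv ∪ ψ.fv
  | or φ ψ => φ.fv ∪ ψ.fv
  | not φ => φ.fv
  | all x φ => φ.fv.erase (.val x)
  | ex x φ => φ.fv.erase (.val x)
  | box α φ => α.fv ∪ (φ.fv \ α.bv)
  | dia α φ => α.fv ∪ (φ.fv \ α.bv)

/-- The substitution of `e` for the free occurrences of `v`. -/
def subst (v : Var) (e : Tm S ℕ) : Fml S → Fml S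
  | cmp c s t => cmp c (s.bind (DVar.subst v e)) (t.bind (DVar.subst v e))
  | and φ ψ => and (φ.subst v e) (ψ.subst v e)
  | or φ ψ => or (φ.subst v e) (ψ.subst v e)
  | not φ => not (φ.subst v e)
  | all x φ => all x (if v = .val x then φ else φ.subst v e)
  | ex x φ => ex x (if v = .val x then φ else φ.subst v e)
  | box α φ => box (α.subst v e) (if v ∈ α.bv then φ else φ.subst v e)
  | dia α φ => dia (α.subst v e) (if v ∈ α.bv then φ else φ.subst v e)

/-- The substitution of `e` for `v` is admissible: it captures no variable of `e`, and it affects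
neither differentials `(d)'` nor variables with a differential equation. -/
def Adm (v : Var) (e : Tm S ℕ) : Fml S → Prop
  | cmp _ s t => v ∉ DTm.diffFv s ∪ DTm.diffFv t
  | and φ ψ => φ.Adm v e ∧ ψ.Adm v e
  | or φ ψ => φ.Adm v e ∧ ψ.Adm v e
  | not φ => φ.Adm v e
  | all x φ => v = .val x ∨ v ∉ φ.fv ∨ (x ∉ e.fv ∧ φ.Adm v e)
  | ex x φ => v = .val x ∨ v ∉ φ.fv ∨ (x ∉ e.fv ∧ φ.Adm v e)
  | box α φ => α.Adm v e ∧
      (v ∈ α.bv ∨ v ∉ φ.fv ∨ ((∀ x ∈ e.fv, Var.val x ∉ α.bv) ∧ φ.Adm v e))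
  | dia α φ => α.Adm v e ∧
      (v ∈ α.bv ∨ v ∉ φ.fv ∨ ((∀ x ∈ e.fv, Var.val x ∉ α.bv) ∧ φ.Adm v e))

/-- `e` is free for `v` in `φ`; every variable is free for itself. -/
def FreeFor (v : Var) (e : Tm S ℕ) (φ : Fml S) : Prop :=
  (∃ x, v = .val x ∧ e = .var x) ∨ φ.Adm v e

/-- Uniform renaming of all variables (with their differential variables), free and bound. -/
def rename (π : Equiv.Perm ℕ) : Fml S → Fml S
  | cmp c s t => cmp c (s.map (DVar.rename π)) (t.map (DVar.rename π))
  | and φ ψ => and (φ.rename π) (ψ.rename π)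
  | or φ ψ => or (φ.rename π) (ψ.rename π)
  | not φ => not (φ.rename π)
  | all x φ => all (π x) (φ.rename π)
  | ex x φ => ex (π x) (φ.rename π)
  | box α φ => box (α.rename π) (φ.rename π)
  | dia α φ => dia (α.rename π) (φ.rename π)

/-- `φ` is a first-order formula, and no quantified variable (from `B`, or quantified in `φ`) occurs
in a subterm that is not polynomial. -/
def IsArith (B : Finset ℕ) : Fml S → Prop
  | cmp _ s t => ∀ x ∈ B, Var.val x ∉ DTm.opaqueFv s ∪ DTm.opaqueFv t
  | and φ ψ => φ.IsArith B ∧ ψ.IsArith B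
  | or φ ψ => φ.IsArith B ∧ ψ.IsArith B
  | not φ => φ.IsArith B
  | all x φ => φ.IsArith (insert x B)
  | ex x φ => φ.IsArith (insert x B)
  | box _ _ => False
  | dia _ _ => False

/-- Truth over the reals of a formula of first-order real arithmetic. -/
def ArithHolds (a : DTm S → ℝ) : (ℕ → ℝ) → Fml S → Prop
  | ω, cmp c s t => c.Holds (DTm.polyEval ω a s) (DTm.polyEval ω a t)
  | ω, and φ ψ => φ.ArithHolds a ω ∧ ψ.ArithHolds a ω
  | ω, or φ ψ => φ.ArithHolds a ω ∨ ψ.ArithHolds a ω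
  | ω, not φ => ¬ φ.ArithHolds a ω
  | ω, all x φ => ∀ r : ℝ, φ.ArithHolds a (Function.update ω x r)
  | ω, ex x φ => ∃ r : ℝ, φ.ArithHolds a (Function.update ω x r)
  | _, box _ _ => False
  | _, dia _ _ => False

/-- Truth assignments that respect the propositional connectives. -/
structure IsPropVal (v : Fml S → Prop) : Prop where
  and : ∀ φ ψ, v (.and φ ψ) ↔ (v φ ∧ v ψ)
  or : ∀ φ ψ, v (.or φ ψ) ↔ (v φ ∨ v ψ)
  not : ∀ φ, v (.not φ) ↔ ¬ v φ

end Fml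

/-! ## The proof calculus -/

/-- `ys` is a vector of fresh variables for the vector `xs`: pairwise distinct and not in `used`. -/
structure Fresh (ys xs : List ℕ) (used : Finset ℕ) : Prop where
  length_eq : ys.length = xs.length
  nodup : ys.Nodup
  fresh : ∀ y ∈ ys, y ∉ used

/-- The renaming of the variables `xs` to `ys`. -/
def renVec : List ℕ → List ℕ → ℕ → ℕ
  | x :: xs, y :: ys, z => if z = x then y else renVec xs ys z
  | _, _, z => z

/-- The names of the axioms that extend the base calculus: differential adjoints, continuous
existence, uniqueness, real induction, and real induction with domain constraints. -/
inductive ExtAx : Type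
  | Dadj : ExtAx
  | Cont : ExtAx
  | Uniq : ExtAx
  | RI : ExtAx
  | RIdom : ExtAx

open Fml Prog in
/-- `Deriv L A Γ φ`: the sequent `Γ ⊢ φ` is derivable in the sequent calculus of differential dynamic
logic over the term language `L` from the base axioms and the extended axioms in `A`. -/
inductive Deriv (L : TermLang) (A : Set ExtAx) :
    List (Fml L.toSig) → Fml L.toSig → Prop
  -- Propositional logic: all propositional consequences, cut, weakening, implication.
  | prop {Γ φ} (h : ∀ v, IsPropVal v → (∀ χ ∈ Γ, v χ) → v φ) : Deriv L A Γ φ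
  | cut {Γ φ ψ} : Deriv L A Γ ψ → Deriv L A (ψ :: Γ) φ → Deriv L A Γ φ
  | weaken {Γ Δ φ} : Γ ⊆ Δ → Deriv L A Γ φ → Deriv L A Δ φ
  | impR {Γ φ ψ} : Deriv L A (φ :: Γ) ψ → Deriv L A Γ (imp φ ψ)
  -- First-order logic with equality, and bound renaming.
  | allL {Γ x φ ψ} (e) : FreeFor (.val x) e φ →
      Deriv L A (φ.subst (.val x) e :: Γ) ψ → Deriv L A (all x φ :: Γ) ψ
  | allR {Γ x φ} : (∀ χ ∈ Γ, Var.val x ∉ χ.fv) → Deriv L A Γ φ → Deriv L A Γ (all x φ)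
  | exL {Γ x φ ψ} : (∀ χ ∈ Γ, Var.val x ∉ χ.fv) → Var.val x ∉ ψ.fv →
      Deriv L A (φ :: Γ) ψ → Deriv L A (ex x φ :: Γ) ψ
  | exR {Γ x φ} (e) : FreeFor (.val x) e φ →
      Deriv L A Γ (φ.subst (.val x) e) → Deriv L A Γ (ex x φ)
  | eqSubst {Γ} (v e d) {φ} : FreeFor v e φ → FreeFor v d φ →
      Deriv L A Γ (imp (cmp .eq e.lift d.lift) (imp (φ.subst v e) (φ.subst v d)))
  | boundRename {Γ} (x y φ) :
      Var.val y ∉ φ.fv → Var.der x ∉ φ.fv → Var.der y ∉ φ.fv →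
      Deriv L A Γ (iff (all x φ) (all y (φ.rename (Equiv.swap x y))))
  -- Real arithmetic: substitution instances of valid formulas of first-order real arithmetic.
  | real {Γ φ} : (∀ χ ∈ φ :: Γ, χ.IsArith ∅) →
      (∀ a ω, (∀ χ ∈ Γ, χ.ArithHolds a ω) → φ.ArithHolds a ω) → Deriv L A Γ φ
  -- Modalities.
  | diamond {Γ} (α φ) : Deriv L A Γ (iff (dia α φ) (not (box α (not φ))))
  | K {Γ} (α φ ψ) : Deriv L A Γ (imp (box α (imp φ ψ)) (imp (box α φ) (box α ψ)))
  | G {Γ} (α) {φ} : Deriv L A [] φ → Deriv L A Γ (box α φ)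
  | V {Γ} (α) {φ} : (∀ v ∈ φ.fv, v ∉ α.bv) → Deriv L A Γ (imp φ (box α φ))
  | assignb {Γ} (v e) {φ} : FreeFor v e φ →
      Deriv L A Γ (iff (box (assign v e) φ) (φ.subst v e))
  -- Differential equations: domain constraints, and provably equal right-hand sides.
  | barcan {Γ} (o Q y φ) : y ∉ o.fv → y ∉ Q.fv →
      Deriv L A Γ (iff (dia (ode o Q) (ex y φ)) (ex y (dia (ode o Q) φ)))
  | DW {Γ} (o Q) : Deriv L A Γ (box (ode o Q) Q)
  | DX {Γ} (o Q) {φ} : (∀ x ∈ o.vars, Var.der x ∉ φ.fv) →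
      Deriv L A Γ (iff (box (ode o Q) φ) (imp Q (and φ (box (ode o Q) φ))))
  | DMP {Γ} (o) (Q R : SA L.toSig) (φ) :
      Deriv L A Γ (imp (box (ode o Q) (imp Q R)) (imp (box (ode o R) φ) (box (ode o Q) φ)))
  | odeCongr {Γ} (o o' Q φ) : o.vars = o'.vars →
      (∀ x ∈ o.vars, Deriv L A [] (cmp .eq (o.rhs x).lift (o'.rhs x).lift)) →
      Deriv L A Γ (iff (box (ode o Q) φ) (box (ode o' Q) φ))
  -- Differential axioms.
  | DE {Γ} (o Q φ) :
      Deriv L A Γ (iff (box (ode o Q) φ)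
        (box (ode o Q) (assigns (o.eqs.map fun p => (Var.der p.1, p.2)) φ)))
  | diffConst {Γ} (c) : Deriv L A Γ (cmp .eq (Tm.diff (.const c)) (.const 0))
  | diffVar {Γ} (x) : Deriv L A Γ (cmp .eq (Tm.diff (.var x)) (.var (.var (.der x))))
  | diffAdd {Γ} (e d) :
      Deriv L A Γ (cmp .eq (Tm.diff (.add e d)) (.add (Tm.diff e) (Tm.diff d)))
  | diffMul {Γ} (e d) :
      Deriv L A Γ (cmp .eq (Tm.diff (.mul e d))
        (.add (.mul (Tm.diff e) d.lift) (.mul e.lift (Tm.diff d))))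
  | diffApp {Γ} (h args) :
      Deriv L A Γ (cmp .eq (Tm.diff (.app h args))
        (Tm.sum (List.ofFn fun i => .mul ((L.pd h i).bind args).lift (Tm.diff (args i)))))
  -- Differential invariants. The assignments set the differential variables of the parameters `zs`
  -- of `e`, i.e. of variables that the system holds constant, to zero; without parameters, `zs = []`.
  | DIeq {Γ} (o Q e) (zs : List ℕ) : (∀ x ∈ e.fv, x ∈ o.vars ∨ x ∈ zs) →
      Deriv L A Γ (imp
        (assigns (zs.map fun z => (Var.der z, Tm.const 0))
          (box (ode o Q) (cmp .eq (Tm.diff e) (.const 0))))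
        (iff (box (ode o Q) (SA.eqz e)) (imp Q (SA.eqz e))))
  | DIge {Γ} (o Q e) (zs : List ℕ) : (∀ x ∈ e.fv, x ∈ o.vars ∨ x ∈ zs) →
      Deriv L A Γ (imp
        (assigns (zs.map fun z => (Var.der z, Tm.const 0))
          (box (ode o Q) (cmp .ge (Tm.diff e) (.const 0))))
        (iff (box (ode o Q) (SA.gez e)) (imp Q (SA.gez e))))
  | DIgt {Γ} (o Q e) (zs : List ℕ) : (∀ x ∈ e.fv, x ∈ o.vars ∨ x ∈ zs) →
      Deriv L A Γ (imp
        (assigns (zs.map fun z => (Var.der z, Tm.const 0))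
          (box (ode o Q) (cmp .ge (Tm.diff e) (.const 0))))
        (iff (box (ode o Q) (SA.gtz e)) (imp Q (SA.gtz e))))
  -- Differential cut, and differential ghosts `y' = a(x) y + b(x)`.
  | DC {Γ} (o) (Q R : SA L.toSig) (φ) :
      Deriv L A Γ (imp (box (ode o Q) R)
        (iff (box (ode o Q) φ) (box (ode o (.and Q R)) φ)))
  | DG {Γ} (o Q y a b φ) (hy : y ∉ o.vars) : y ∉ o.fv → y ∉ Q.fv → y ∉ a.fv → y ∉ b.fv →
      Var.val y ∉ φ.fv → Var.der y ∉ φ.fv →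
      Deriv L A Γ (iff (box (ode o Q) φ)
        (ex y (box (ode (o.ghost y (.add (.mul a (.var y)) b) hy) Q) φ)))
  | DGall {Γ} (o Q y a b φ) (hy : y ∉ o.vars) : y ∉ o.fv → y ∉ Q.fv → y ∉ a.fv → y ∉ b.fv →
      Var.val y ∉ φ.fv → Var.der y ∉ φ.fv →
      Deriv L A Γ (iff (box (ode o Q) φ)
        (all y (box (ode (o.ghost y (.add (.mul a (.var y)) b) hy) Q) φ)))
  -- Extended axioms. `Cont`, `RI` and `RIdom` require that the system provably has no fixpoint,
  -- as is the case for a system with a clock `t' = 1`.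
  | Uniq {Γ} (o) (Q R : SA L.toSig) (φ) : ExtAx.Uniq ∈ A →
      Deriv L A Γ (iff (dia (ode o (.and Q R)) φ) (and (dia (ode o Q) φ) (dia (ode o R) φ)))
  | Cont {Γ} (o e) (ys : List ℕ) : ExtAx.Cont ∈ A → Fresh ys o.vars (o.fv ∪ e.fv) →
      Deriv L A [] (not o.fixpoint) →
      Deriv L A Γ (imp (SA.eqVec o.vars ys).toFml
        (iff (dia (ode o (SA.gtz e)) (not (SA.eqVec o.vars ys).toFml)) (SA.gtz e)))
  | Dadj {Γ} (o o' : ODE L.toSig) (Q) (ys : List ℕ) : ExtAx.Dadj ∈ A →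
      Fresh ys o.vars (o.fv ∪ Q.fv) →
      o'.eqs = o.eqs.map (fun p => (renVec o.vars ys p.1, (p.2.map (renVec o.vars ys)).neg)) →
      Deriv L A Γ (iff (dia (ode o Q) (SA.eqVec o.vars ys).toFml)
        (dia (ode o' (Q.map (renVec o.vars ys))) (SA.eqVec ys o.vars).toFml))
  | RI {Γ} (o) (P : SA L.toSig) (ys : List ℕ) : ExtAx.RI ∈ A →
      Fresh ys o.vars (o.fv ∪ P.fv) → Deriv L A [] (not o.fixpoint) →
      Deriv L A Γ (iff (box (ode o .tt) P)
        (allVec ys (box (ode o (.or P (SA.eqVec o.vars ys)))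
          (imp (SA.eqVec o.vars ys).toFml
            (and P (dia (ode o (.or P (SA.eqVec o.vars ys))) (not (SA.eqVec o.vars ys).toFml)))))))
  | RIdom {Γ} (o) (P Q : SA L.toSig) (ys : List ℕ) : ExtAx.RIdom ∈ A →
      Fresh ys o.vars (o.fv ∪ P.fv ∪ Q.fv) → Deriv L A [] (not o.fixpoint) →
      Deriv L A Γ (iff (box (ode o Q) P)
        (allVec ys (box (ode o (.and Q (.or P (SA.eqVec o.vars ys))))
          (imp (SA.eqVec o.vars ys).toFml
            (and P
              (imp (dia (ode o (.or Q (SA.eqVec o.vars ys))) (not (SA.eqVec o.vars ys).toFml))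
                (dia (ode o (.or P (SA.eqVec o.vars ys))) (not (SA.eqVec o.vars ys).toFml))))))))

/-! ## Lie derivatives and progress formulas -/

namespace TermLang
variable (L : TermLang)

/-- The Lie derivative along `x' = f(x)`: the term that results from `(e)'` by the differential axioms
when every `x'` is replaced by `f(x)`; variables without differential equation are constant. -/
def lie (o : ODE L.toSig) : Tm L.toSig ℕ → Tm L.toSig ℕ
  | .var x => o.rhs x
  | .const _ => .const 0
  | .add s t => .add (lie o s) (lie o t)
  | .mul s t => .add (.mul (lie o s) t) (.mul s (lie o t))
  | .app h args =>
      Tm.sum (List.ofFn fun i => .mul ((L.pd h i).bind args) (lie o (args i)))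

/-- The higher Lie derivatives. -/
def lieIter (o : ODE L.toSig) (k : ℕ) (e : Tm L.toSig ℕ) : Tm L.toSig ℕ := (L.lie o)^[k] e

/-- `N ≥ 1` is a rank of `e` along `x' = f(x)`: for some cofactors `gᵢ`, the differential radical
identity, which expresses the `N`-th Lie derivative of `e` as the sum over `i < N` of `gᵢ` times the
`i`-th, is provable in the base calculus. -/
def IsRank (o : ODE L.toSig) (e : Tm L.toSig ℕ) (N : ℕ) : Prop :=
  1 ≤ N ∧ ∃ g : ℕ → Tm L.toSig ℕ,
    Deriv L ∅ [] (SA.cmp .eq (L.lieIter o N e)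
      (Tm.sum ((List.range N).map fun i => .mul (g i) (L.lieIter o i e))))

/-- The first `k` Lie derivatives (from the `0`-th) are all zero. -/
def lieZero (o : ODE L.toSig) (k : ℕ) (e : Tm L.toSig ℕ) : SA L.toSig :=
  SA.conj ((List.range k).map fun i => SA.eqz (L.lieIter o i e))

/-- The progress formula for `e > 0`, for a term `e` of rank `N`. -/
def progGt (o : ODE L.toSig) (N : ℕ) (e : Tm L.toSig ℕ) : SA L.toSig :=
  .and
    (SA.conj ((List.range (N - 1)).map fun i =>
      SA.imp (L.lieZero o i e) (SA.gez (L.lieIter o i e))))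
    (SA.imp (L.lieZero o (N - 1) e) (SA.gtz (L.lieIter o (N - 1) e)))

/-- The progress formula for `e ≥ 0`, for a term `e` of rank `N`. -/
def progGe (o : ODE L.toSig) (N : ℕ) (e : Tm L.toSig ℕ) : SA L.toSig :=
  .or (L.progGt o N e) (L.lieZero o N e)

end TermLang

/-- Disjunctive normal forms: every disjunct is given by the terms `e` of its conjuncts `e ≥ 0` and
by the terms `e` of its conjuncts `e > 0`. -/
abbrev NormalForm (S : Sig) := List (List (Tm S ℕ) × List (Tm S ℕ))

def NormalForm.toSA {S : Sig} (D : NormalForm S) : SA S :=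
  SA.disj (D.map fun c => .and (SA.conj (c.1.map SA.gez)) (SA.conj (c.2.map SA.gtz)))

/-- The progress formula of a normal form; `rk` gives the rank of each term along each system. -/
def NormalForm.progress (L : TermLang) (rk : ODE L.toSig → Tm L.toSig ℕ → ℕ)
    (o : ODE L.toSig) (D : NormalForm L.toSig) : SA L.toSig :=
  SA.disj (D.map fun c =>
    .and (SA.conj (c.1.map fun e => L.progGe o (rk o e) e))
      (SA.conj (c.2.map fun e => L.progGt o (rk o e) e)))

/-- `F` is a progress formula of `P` along the system `o`, i.e. the progress formula of some normal
form that is provably equivalent to `P` in the base calculus. -/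
def IsProgress (L : TermLang) (rk : ODE L.toSig → Tm L.toSig ℕ → ℕ)
    (o : ODE L.toSig) (P F : SA L.toSig) : Prop :=
  ∃ D : NormalForm L.toSig, Deriv L ∅ [] (Fml.iff P D.toSA) ∧ F = D.progress L rk o

/-- The semianalytic invariant axiom:
`∀x (P → [x' = f(x)] P) ↔ ∀x (P → F) ∧ ∀x (¬P → B)`. -/
def SAI {S : Sig} (o : ODE S) (P F B : SA S) : Fml S :=
  .iff (.allVec o.vars (.imp P (.box (.ode o .tt) P)))
    (.and (.allVec o.vars (.imp P F)) (.allVec o.vars (.imp P.not B)))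

/-- The semianalytic invariant axiom with domain constraint:
`∀x (P → [x' = f(x) & Q] P) ↔ ∀x (P ∧ Q ∧ FQ → FP) ∧ ∀x (¬P ∧ Q ∧ BQ → BP)`. -/
def SAIdom {S : Sig} (o : ODE S) (P Q FP FQ BP BQ : SA S) : Fml S :=
  .iff (.allVec o.vars (.imp P (.box (.ode o Q) P)))
    (.and (.allVec o.vars (.imp (P.and (Q.and FQ)) FP))
      (.allVec o.vars (.imp (P.not.and (Q.and BQ)) BP)))

end DL

/-! Everything rests on local progress: from `x = y`, a state `x ≠ y` is reachable inside a given
domain (`lp`). The heart of the proof is that a progress formula decides it in both directions: at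
`x = y`, the formula `F` yields progress in `R ∨ x = y`, and `¬F` yields progress in `¬R ∨ x = y`
(`Decides`). In this form the property is closed under negation by symmetry, and under conjunction
because Uniq merges two such runs into one. Only `e ≥ 0` and `e > 0` need analysis.

For these, consider the first nonzero Lie derivative. If it is the `k`-th and has sign `s`, then
continuity followed by `k` differential invariants gives `s e ≥ c τ^(m+1)` near `y`, for a clock `τ`
that starts at `0`. In the same way `τ ≥ |x - y|²` near `y`, so that `s e > 0` away from `y`
(`lp_ge_pow`, `lp_sqDist`, `lp_of_first_nonzero`). If all Lie derivatives below the rank vanish, the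
sum `p` of their squares satisfies `p' ≤ q p` by the rank identity. The weight `w = 1 - τ (q + 1)`
is a local substitute for the integrating factor: near `y` it is positive and `(p w)' ≤ 0`, hence `p
= 0` and `e = 0` persists (`lp_eqz`).

Necessity: if `P` is invariant within `Q`, but its progress formula fails at a state of `P ∧ Q` with
progress in `Q`, then the system runs into `¬P` inside `Q`, a contradiction (`lp_not_of_box`). The
backward condition is the same argument for `x' = -f(x)` and `¬P`, which is a backward invariant by
the adjoint axiom (`backward_invariant`).

Sufficiency: real induction leaves two claims about a state `y` at the end of a run through `Q` that
satisfies `P` except possibly where `x = y`. Progress in `Q` must give progress in `P`, which the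
forward condition provides (`forward_progress`), and `P` must hold at `y` (`no_exit`). Otherwise the
reversed run would leave `y` inside `Q ∧ P`, whereas the backward condition gives backward progress
into `¬P` or into `¬Q`, and Uniq leaves no common state other than `y` (`backward_blocked`).

Cont and real induction require a system without fixpoints. A clock `t' = 1` is therefore added as a
differential ghost; it does not change the Lie derivatives of terms without `t`, and it is
eliminated at the end (`SAIdom_of_clock`). SAI is the case `Q = true`, with RI in place of RI&. -/

namespace DL
open Fml Prog

/-! ## Substitution, variables and renaming -/

section Renaming
variable {S : Sig} {V W X : Type}

namespace Tm

theorem bind_var (t : Tm S V) : t.bind var = t := by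
  induction t <;> simp_all [bind]

theorem bind_bind (σ : V → Tm S W) (τ : W → Tm S X) (t : Tm S V) :
    (t.bind σ).bind τ = t.bind fun x => (σ x).bind τ := by
  induction t <;> simp_all [bind]

theorem collect_bind [DecidableEq X] (σ : V → Tm S W) (g : W → Finset X) (t : Tm S V) :
    (t.bind σ).collect g = t.collect fun x => (σ x).collect g := by
  induction t <;> simp_all [bind, collect]

theorem mem_collect [DecidableEq X] {g : ℕ → Finset X} {y : X} {t : Tm S ℕ} :
    y ∈ t.collect g ↔ ∃ x ∈ t.fv, y ∈ g x := by
  induction t with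
  | var x => simp [collect, fv]
  | const c => simp [collect, fv]
  | add s t hs ht => simp only [collect, fv, Finset.mem_union] at *; grind
  | mul s t hs ht => simp only [collect, fv, Finset.mem_union] at *; grind
  | app h args ih =>
    simp only [collect, fv, Finset.mem_biUnion, Finset.mem_univ, true_and] at *
    simp only [ih]
    grind

/-- The weak form of `mem_collect` for an arbitrary variable type; it is needed for the terms `L.pd
h i`, whose variables are argument positions. -/
theorem exists_mem_of_mem_collect [DecidableEq X] {g : V → Finset X} {y : X} {t : Tm S V}
    (h : y ∈ t.collect g) : ∃ x, y ∈ g x := by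
  induction t with
  | var x => exact ⟨x, h⟩
  | const c => simp [collect] at h
  | add s t hs ht => simp only [collect, Finset.mem_union] at h; grind
  | mul s t hs ht => simp only [collect, Finset.mem_union] at h; grind
  | app k args ih =>
    simp only [collect, Finset.mem_biUnion, Finset.mem_univ, true_and] at h
    obtain ⟨i, hi⟩ := h
    exact ih i hi

theorem collect_subset_image [DecidableEq X] [DecidableEq W] {g : V → Finset W}
    {g' : V → Finset X} {k : X → W} (h : ∀ x, g x ⊆ (g' x).image k) (t : Tm S V) :
    t.collect g ⊆ (t.collect g').image k := by
  induction t with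
  | var x => exact h x
  | const c => simp [collect]
  | add s t hs ht => simpa [collect, Finset.image_union] using Finset.union_subset_union hs ht
  | mul s t hs ht => simpa [collect, Finset.image_union] using Finset.union_subset_union hs ht
  | app k args ih =>
    simp only [collect, Finset.biUnion_image]
    exact Finset.biUnion_mono fun i _ => ih i

theorem mem_fv_bind {σ : ℕ → Tm S ℕ} {t : Tm S ℕ} {y : ℕ} :
    y ∈ (t.bind σ).fv ↔ ∃ x ∈ t.fv, y ∈ (σ x).fv := by
  unfold fv
  rw [collect_bind, mem_collect]
  rfl

theorem mem_fv_map {ρ : ℕ → ℕ} {t : Tm S ℕ} {y : ℕ} :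
    y ∈ (t.map ρ).fv ↔ ∃ x ∈ t.fv, y = ρ x := by
  rw [map, mem_fv_bind]
  simp [fv, collect]

theorem bind_congr {σ τ : ℕ → Tm S W} {t : Tm S ℕ} (h : ∀ x ∈ t.fv, σ x = τ x) :
    t.bind σ = t.bind τ := by
  induction t with
  | var x => exact h x (by simp [fv, collect])
  | const c => rfl
  | add s t hs ht =>
    simp only [fv, collect, Finset.mem_union] at h hs ht
    simp only [bind]
    rw [hs fun x hx => h x (.inl hx), ht fun x hx => h x (.inr hx)]
  | mul s t hs ht =>
    simp only [fv, collect, Finset.mem_union] at h hs ht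
    simp only [bind]
    rw [hs fun x hx => h x (.inl hx), ht fun x hx => h x (.inr hx)]
  | app k args ih =>
    simp only [fv, collect, Finset.mem_biUnion, Finset.mem_univ, true_and] at h ih
    simp only [bind]
    congr 1
    funext i
    exact ih i fun x hx => h x ⟨i, hx⟩

theorem map_congr {ρ ρ' : ℕ → ℕ} {t : Tm S ℕ} (h : ∀ x ∈ t.fv, ρ x = ρ' x) :
    t.map ρ = t.map ρ' := bind_congr fun x hx => by rw [h x hx]

theorem map_map (ρ : V → W) (ρ' : W → X) (t : Tm S V) :
    (t.map ρ).map ρ' = t.map (ρ' ∘ ρ) := by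
  simp [map, bind_bind, bind]

theorem map_id_of_fv {ρ : ℕ → ℕ} {t : Tm S ℕ} (h : ∀ x ∈ t.fv, ρ x = x) : t.map ρ = t := by
  rw [map_congr (ρ' := id) h]
  exact bind_var t

theorem lift_subst (x : ℕ) (e t : Tm S ℕ) :
    t.lift.bind (DVar.subst (.val x) e) = (t.bind ((Var.val x).toSubst e)).lift := by
  unfold lift map
  rw [bind_bind, bind_bind]
  congr 1
  funext y
  by_cases h : y = x
  · subst h; simp [bind, DVar.subst, Var.toSubst, lift, map]
  · have h' : ¬ x = y := fun h' => h h'.symm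
    simp [bind, DVar.subst, Var.toSubst, h, h']

theorem lift_subst_der (x : ℕ) (e t : Tm S ℕ) :
    t.lift.bind (DVar.subst (.der x) e) = t.lift := by
  unfold lift map
  rw [bind_bind]
  congr 1

theorem lift_rename (π : ℕ → ℕ) (t : Tm S ℕ) :
    t.lift.map (DVar.rename π) = (t.map π).lift := by
  unfold lift
  rw [map_map, map_map]
  rfl

theorem fv_lift (t : Tm S ℕ) : DTm.fv t.lift = t.fv.image Var.val := by
  ext v
  rw [DTm.fv, lift, map, collect_bind, mem_collect]
  simp [collect, DVar.fv, eq_comm]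

theorem diffFv_lift (t : Tm S ℕ) : DTm.diffFv t.lift = ∅ := by
  ext v
  rw [DTm.diffFv, lift, map, collect_bind, mem_collect]
  simp [collect, DVar.diffFv]

end Tm

theorem Var.toSubst_self (x : ℕ) : (Var.val x).toSubst (S := S) (.var x) = Tm.var := by
  funext y
  simp only [toSubst, Var.val.injEq]
  split_ifs with h
  · rw [h]
  · rfl

theorem DVar.subst_self (x : ℕ) : DVar.subst (S := S) (.val x) (.var x) = Tm.var := by
  funext a
  cases a with
  | var w =>
    simp only [DVar.subst]
    split_ifs with h
    · rw [h]; rfl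
    · rfl
  | diff e => rfl

namespace SA

theorem bind_var (P : SA S) : P.bind Tm.var = P := by
  induction P <;> simp_all [bind, Tm.bind_var]

theorem bind_bind (σ τ : ℕ → Tm S ℕ) (P : SA S) :
    (P.bind σ).bind τ = P.bind fun x => (σ x).bind τ := by
  induction P <;> simp_all [bind, Tm.bind_bind]

theorem map_map (ρ ρ' : ℕ → ℕ) (P : SA S) : (P.map ρ).map ρ' = P.map (ρ' ∘ ρ) := by
  simp [map, bind_bind, Tm.bind]

theorem map_congr {ρ ρ' : ℕ → ℕ} {P : SA S} (h : ∀ x ∈ P.fv, ρ x = ρ' x) :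
    P.map ρ = P.map ρ' := by
  unfold map
  induction P with
  | cmp c s t =>
    simp only [fv, Finset.mem_union] at h
    simp only [bind]
    rw [Tm.bind_congr fun x hx => by rw [h x (.inl hx)],
      Tm.bind_congr (t := t) fun x hx => by rw [h x (.inr hx)]]
  | and P Q hP hQ | or P Q hP hQ =>
    simp only [fv, Finset.mem_union] at h
    simp only [bind]
    rw [hP fun x hx => h x (.inl hx), hQ fun x hx => h x (.inr hx)]
  | not P hP => simp only [bind]; rw [hP h]

theorem map_id_of_fv {ρ : ℕ → ℕ} {P : SA S} (h : ∀ x ∈ P.fv, ρ x = x) : P.map ρ = P := by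
  rw [map_congr (ρ' := id) h]
  exact bind_var P

theorem mem_fv_map {ρ : ℕ → ℕ} {P : SA S} {y : ℕ} :
    y ∈ (P.map ρ).fv ↔ ∃ x ∈ P.fv, y = ρ x := by
  unfold map
  induction P with
  | cmp c s t =>
    have hs := @Tm.mem_fv_map S ρ s y
    have ht := @Tm.mem_fv_map S ρ t y
    simp only [Tm.map] at hs ht
    simp only [bind, fv, Finset.mem_union, hs, ht]; grind
  | and P Q hP hQ | or P Q hP hQ => simp only [bind, fv, Finset.mem_union, hP, hQ]; grind
  | not P hP => exact hP

theorem fv_toFml (P : SA S) : P.toFml.fv = P.fv.image Var.val := by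
  induction P <;> simp_all [SA.toFml, Fml.fv, fv, Tm.fv_lift, Finset.image_union]

theorem der_notMem_fv (P : SA S) (x : ℕ) : Var.der x ∉ P.toFml.fv := by
  simp [fv_toFml]

theorem val_mem_fv (P : SA S) (x : ℕ) : Var.val x ∈ P.toFml.fv ↔ x ∈ P.fv := by
  simp [fv_toFml]

theorem toFml_subst (x : ℕ) (e : Tm S ℕ) (P : SA S) :
    P.toFml.subst (.val x) e = (P.bind ((Var.val x).toSubst e)).toFml := by
  induction P <;> simp_all [SA.toFml, Fml.subst, bind, Tm.lift_subst]

theorem toFml_adm (v : Var) (e : Tm S ℕ) (P : SA S) : P.toFml.Adm v e := by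
  induction P <;> simp_all [SA.toFml, Fml.Adm, Tm.diffFv_lift]

theorem toFml_rename (π : Equiv.Perm ℕ) (P : SA S) :
    P.toFml.rename π = (P.map π).toFml := by
  unfold map
  induction P with
  | cmp c s t =>
    simp only [SA.toFml, Fml.rename, bind, Tm.lift_rename]
    rfl
  | _ => simp_all [SA.toFml, Fml.rename, bind]

theorem eqVec_cons (x y : ℕ) (xs ys : List ℕ) :
    eqVec (S := S) (x :: xs) (y :: ys) = .and (cmp .eq (.var x) (.var y)) (eqVec xs ys) := rfl

theorem mem_fv_eqVec {xs ys : List ℕ} {z : ℕ} (h : z ∈ (eqVec (S := S) xs ys).fv) :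
    z ∈ xs ∨ z ∈ ys := by
  induction xs generalizing ys with
  | nil => simp [eqVec, conj, tt, fv, Tm.fv, Tm.collect] at h
  | cons x xs ih =>
    cases ys with
    | nil => simp [eqVec, conj, tt, fv, Tm.fv, Tm.collect] at h
    | cons y ys =>
      rw [eqVec_cons] at h
      simp only [fv, Tm.fv, Tm.collect, Finset.mem_union, Finset.mem_singleton] at h
      rcases h with (h | h) | h
      · simp [h]
      · simp [h]
      · rcases ih h with h | h <;> simp [h]

theorem map_eqVec (ρ : ℕ → ℕ) (xs ys : List ℕ) :
    (eqVec (S := S) xs ys).map ρ = eqVec (xs.map ρ) (ys.map ρ) := by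
  induction xs generalizing ys with
  | nil => rfl
  | cons x xs ih =>
    cases ys with
    | nil => rfl
    | cons y ys =>
      rw [List.map_cons, List.map_cons, eqVec_cons, eqVec_cons, ← ih]
      rfl

end SA

namespace ODE

theorem ext {o o' : ODE S} (h : o.eqs = o'.eqs) : o = o' := by
  cases o; cases o'; simp_all

theorem mem_fv {o : ODE S} {x : ℕ} : x ∈ o.fv ↔ ∃ p ∈ o.eqs, x = p.1 ∨ x ∈ p.2.fv := by
  unfold fv
  induction o.eqs with
  | nil => simp
  | cons p l ih => rw [List.foldr_cons, Finset.mem_insert, Finset.mem_union, ih]; grind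

theorem mem_vars {o : ODE S} {x : ℕ} : x ∈ o.vars ↔ ∃ p ∈ o.eqs, p.1 = x := by
  simp [vars]

theorem mem_fv_of_mem_vars {o : ODE S} {x : ℕ} (h : x ∈ o.vars) : x ∈ o.fv := by
  obtain ⟨p, hp, rfl⟩ := mem_vars.1 h
  exact mem_fv.2 ⟨p, hp, .inl rfl⟩

theorem vars_neg (o : ODE S) : o.neg.vars = o.vars := by
  simp [vars, neg]

theorem fv_neg (o : ODE S) : o.neg.fv = o.fv := by
  ext x
  simp [mem_fv, neg, Tm.neg, Tm.fv, Tm.collect]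

theorem vars_rename (o : ODE S) (π : Equiv.Perm ℕ) : (o.rename π).vars = o.vars.map π := by
  simp [vars, rename]

theorem bind_self (o : ODE S) : o.bind Tm.var = o := by
  apply ext
  simp [bind, Tm.bind_var]

theorem mem_fv_rename {o : ODE S} {π : Equiv.Perm ℕ} {y : ℕ} :
    y ∈ (o.rename π).fv ↔ ∃ x ∈ o.fv, y = π x := by
  simp only [mem_fv, rename, List.mem_map, exists_exists_and_eq_and, Tm.mem_fv_map]
  constructor
  · rintro ⟨p, hp, rfl | ⟨x, hx, rfl⟩⟩
    · exact ⟨p.1, ⟨p, hp, .inl rfl⟩, rfl⟩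
    · exact ⟨x, ⟨p, hp, .inr hx⟩, rfl⟩
  · rintro ⟨x, ⟨p, hp, rfl | hx⟩, rfl⟩
    · exact ⟨p, hp, .inl rfl⟩
    · exact ⟨p, hp, .inr ⟨x, hx, rfl⟩⟩

end ODE

namespace Fml

/-- Instantiating a quantifier by its own variable is the one instantiation that is always
admissible, even below a differential equation that binds the variable. -/
theorem subst_self (x : ℕ) (φ : Fml S) : φ.subst (.val x) (.var x) = φ := by
  induction φ with
  | cmp c s t => simp [subst, DVar.subst_self, Tm.bind_var]
  | and φ ψ h h' => simp [subst, h, h']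
  | or φ ψ h h' => simp [subst, h, h']
  | not φ h => simp [subst, h]
  | all y φ h => simp [subst, h]
  | ex y φ h => simp [subst, h]
  | box α φ h | dia α φ h =>
    have : α.subst (.val x) (.var x) = α := by
      cases α <;>
      simp [Prog.subst, Var.toSubst_self, Tm.bind_var, ODE.bind_self, SA.bind_var]
    simp [subst, h, this]

theorem freeFor_self (x : ℕ) (φ : Fml S) : FreeFor (.val x) (.var x) φ := .inl ⟨x, rfl, rfl⟩

end Fml

/-- The renaming of a variable or differential variable. -/
def Var.map (π : ℕ → ℕ) : Var → Var
  | val x => val (π x)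
  | der x => der (π x)

theorem Var.exists {p : Var → Prop} :
    (∃ v, p v) ↔ (∃ x, p (val x)) ∨ ∃ x, p (der x) := by
  constructor
  · rintro ⟨x | x, h⟩
    · exact .inl ⟨x, h⟩
    · exact .inr ⟨x, h⟩
  · rintro (⟨x, h⟩ | ⟨x, h⟩) <;> exact ⟨_, h⟩

theorem Var.map_injective (π : Equiv.Perm ℕ) : Function.Injective (Var.map π) := by
  intro u v h
  cases u <;> cases v <;> simp_all [Var.map]

theorem Prog.bv_rename (π : Equiv.Perm ℕ) (α : Prog S) :
    (α.rename π).bv = α.bv.image (Var.map π) := by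
  cases α with
  | assign v e => cases v <;> rfl
  | ode o Q =>
    ext v
    simp only [Prog.rename, bv, ODE.vars_rename]
    cases v <;> simp [Var.map, Var.exists]

theorem Prog.fv_rename (π : Equiv.Perm ℕ) (α : Prog S) :
    (α.rename π).fv = α.fv.image (Var.map π) := by
  cases α with
  | assign v e =>
    ext w
    cases v <;> cases w <;> simp [Prog.rename, fv, Tm.mem_fv_map, Var.map, eq_comm]
  | ode o Q =>
    ext v
    cases v <;> simp [Prog.rename, fv, ODE.mem_fv_rename, SA.mem_fv_map, Var.map]
    grind

theorem DTm.fv_rename (π : ℕ → ℕ) (t : DTm S) :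
    DTm.fv (t.map (DVar.rename π)) ⊆ (DTm.fv t).image (Var.map π) := by
  rw [DTm.fv, Tm.map, Tm.collect_bind]
  refine Tm.collect_subset_image (fun a => ?_) t
  rcases a with (x | x) | e
  · simp [Tm.collect, DVar.rename, DVar.fv, Var.map]
  · simp [Tm.collect, DVar.rename, DVar.fv, Var.map]
  · intro v
    cases v <;> simp [Tm.collect, DVar.rename, DVar.fv, Var.map, Tm.mem_fv_map, Var.exists, eq_comm]

/-- The inclusion suffices, because it serves only to carry freshness of variables through a
renaming. -/
theorem Fml.fv_rename (π : Equiv.Perm ℕ) (φ : Fml S) :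
    (φ.rename π).fv ⊆ φ.fv.image (Var.map π) := by
  induction φ with
  | cmp c s t =>
    simpa [rename, fv, Finset.image_union] using
      Finset.union_subset_union (DTm.fv_rename π s) (DTm.fv_rename π t)
  | and φ ψ h h' | or φ ψ h h' =>
    simpa [rename, fv, Finset.image_union] using Finset.union_subset_union h h'
  | not φ h => exact h
  | all x φ h | ex x φ h =>
    intro v hv
    simp only [rename, fv, Finset.mem_erase] at hv
    obtain ⟨u, hu, rfl⟩ := Finset.mem_image.1 (h hv.2)
    refine Finset.mem_image_of_mem _ (Finset.mem_erase.2 ⟨?_, hu⟩)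
    rintro rfl
    exact hv.1 rfl
  | box α φ h | dia α φ h =>
    intro v hv
    simp only [rename, fv, Finset.mem_union, Finset.mem_sdiff, Prog.fv_rename,
      Prog.bv_rename] at hv
    rcases hv with hv | ⟨hv, hv'⟩
    · obtain ⟨u, hu, rfl⟩ := Finset.mem_image.1 hv
      exact Finset.mem_image_of_mem _ (Finset.mem_union_left _ hu)
    · obtain ⟨u, hu, rfl⟩ := Finset.mem_image.1 (h hv)
      refine Finset.mem_image_of_mem _ (Finset.mem_union_right _ (Finset.mem_sdiff.2 ⟨hu, ?_⟩))
      exact fun hb => hv' (Finset.mem_image_of_mem _ hb)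

theorem DVar.rename_rename (π π' : ℕ → ℕ) (a : DVar S) :
    (a.rename π).rename π' = a.rename (π' ∘ π) := by
  rcases a with (x | x) | e <;> simp [DVar.rename, Tm.map_map]

theorem ODE.rename_rename (π π' : Equiv.Perm ℕ) (o : ODE S) :
    (o.rename π).rename π' = o.rename (π.trans π') := by
  apply ODE.ext
  simp [ODE.rename, Tm.map_map]

theorem Prog.rename_rename (π π' : Equiv.Perm ℕ) (α : Prog S) :
    (α.rename π).rename π' = α.rename (π.trans π') := by
  rcases α with ⟨x | x, e⟩ | ⟨o, Q⟩ <;>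
    simp [Prog.rename, Tm.map_map, ODE.rename_rename, SA.map_map]

theorem Fml.rename_rename (π π' : Equiv.Perm ℕ) (φ : Fml S) :
    (φ.rename π).rename π' = φ.rename (π.trans π') := by
  induction φ with
  | cmp c s t =>
    have h : DVar.rename (S := S) π' ∘ DVar.rename π = DVar.rename (π.trans π') := by
      funext a
      simp [DVar.rename_rename]
    simp [Fml.rename, Tm.map_map, h]
  | _ => simp_all [Fml.rename, Prog.rename_rename]

/-- The permutation that exchanges `x` and `y` for all entries of two disjoint vectors. -/
def swapVec : List ℕ → List ℕ → Equiv.Perm ℕ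
  | x :: xs, y :: ys => (Equiv.swap x y).trans (swapVec xs ys)
  | _, _ => Equiv.refl ℕ

theorem swapVec_of_notMem {xs ys : List ℕ} {z : ℕ} (hx : z ∉ xs) (hy : z ∉ ys) :
    swapVec xs ys z = z := by
  induction xs generalizing ys with
  | nil => simp [swapVec]
  | cons x xs ih =>
    cases ys with
    | nil => simp [swapVec]
    | cons y ys =>
      simp only [List.mem_cons, not_or] at hx hy
      simp [swapVec, Equiv.swap_apply_of_ne_of_ne hx.1 hy.1, ih hx.2 hy.2]

/-- The adjoint axiom uses the one-sided `renVec`, whereas uniform renaming needs a permutation. The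
two differ only on the fresh variables; distinctness and disjointness keep a later swap from moving
a variable again. -/
theorem swapVec_eq_renVec {xs ys : List ℕ} (hys : ys.Nodup) (hd : ∀ y ∈ ys, y ∉ xs) {z : ℕ}
    (hz : z ∉ ys) : swapVec xs ys z = renVec xs ys z := by
  induction xs generalizing ys with
  | nil => simp [swapVec, renVec]
  | cons x xs ih =>
    cases ys with
    | nil => simp [swapVec, renVec]
    | cons y ys =>
      simp only [List.mem_cons, not_or, List.nodup_cons] at hz hys
      have hd' : ∀ y ∈ ys, y ∉ xs := fun w hw h => hd w (by simp [hw]) (by simp [h])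
      simp only [swapVec, renVec, Equiv.trans_apply]
      split_ifs with h
      · subst h
        rw [Equiv.swap_apply_left]
        exact swapVec_of_notMem (fun h => hd y (by simp) (by simp [h])) hys.1
      · rw [Equiv.swap_apply_of_ne_of_ne h hz.1, ih hys.2 hd' hz.2]

theorem map_swapVec {xs ys : List ℕ} (hxs : xs.Nodup) (hl : ys.length = xs.length)
    (hys : ys.Nodup) (hd : ∀ y ∈ ys, y ∉ xs) : xs.map (swapVec xs ys) = ys := by
  induction xs generalizing ys with
  | nil => simpa [eq_comm] using hl
  | cons x xs ih =>
    cases ys with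
    | nil => simp at hl
    | cons y ys =>
      simp only [List.nodup_cons] at hxs hys
      have hd' : ∀ y ∈ ys, y ∉ xs := fun w hw h => hd w (by simp [hw]) (by simp [h])
      have hy : y ∉ xs := fun h => hd y (by simp) (by simp [h])
      have h1 : swapVec (x :: xs) (y :: ys) x = y := by
        simp only [swapVec, Equiv.trans_apply, Equiv.swap_apply_left]
        exact swapVec_of_notMem hy hys.1
      have h2 : xs.map (swapVec (x :: xs) (y :: ys)) = xs.map (swapVec xs ys) := by
        refine List.map_congr_left fun z hz => ?_
        have hzx : z ≠ x := fun h => hxs.1 (h ▸ hz)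
        have hzy : z ≠ y := fun h => hy (h ▸ hz)
        simp [swapVec, Equiv.swap_apply_of_ne_of_ne hzx hzy]
      rw [List.map_cons, h1, h2, ih hxs.2 (by simpa using hl) hys.2 hd']

end Renaming
end DL

namespace DL
open Fml
open Prog (ode assign)

/-! ## Derived rules of the calculus -/

section Calculus
variable {L : TermLang} {A : Set ExtAx} {Γ Δ : List (Fml L.toSig)}
  {φ ψ χ θ : Fml L.toSig}

theorem Fml.IsPropVal.imp {v : Fml L.toSig → Prop} (hv : IsPropVal v) (φ ψ : Fml L.toSig) :
    v (Fml.imp φ ψ) ↔ (v φ → v ψ) := by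
  rw [Fml.imp, hv.or, hv.not, imp_iff_not_or]

theorem Fml.IsPropVal.iff {v : Fml L.toSig → Prop} (hv : IsPropVal v) (φ ψ : Fml L.toSig) :
    v (Fml.iff φ ψ) ↔ (v φ ↔ v ψ) := by
  rw [Fml.iff, hv.and, hv.imp, hv.imp]
  exact iff_iff_implies_and_implies.symm

namespace Deriv

/-- Rank identities and normal forms are proved in the base calculus, but used together with the
extended axioms. -/
theorem mono_ax {B : Set ExtAx} (hAB : A ⊆ B) (h : Deriv L A Γ φ) : Deriv L B Γ φ := by
  induction h with
  | prop h => exact .prop h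
  | cut _ _ h h' => exact .cut h h'
  | weaken hs _ h => exact .weaken hs h
  | impR _ h => exact .impR h
  | allL e hf _ h => exact .allL e hf h
  | allR hf _ h => exact .allR hf h
  | exL hf hf' _ h => exact .exL hf hf' h
  | exR e hf _ h => exact .exR e hf h
  | eqSubst v e d h h' => exact .eqSubst v e d h h'
  | boundRename x y φ h h' h'' => exact .boundRename x y φ h h' h''
  | real h h' => exact .real h h'
  | diamond α φ => exact .diamond α φ
  | K α φ ψ => exact .K α φ ψ
  | G α _ h => exact .G α h
  | V α h => exact .V α h
  | assignb v e h => exact .assignb v e h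
  | barcan o Q y φ h h' => exact .barcan o Q y φ h h'
  | DW o Q => exact .DW o Q
  | DX o Q h => exact .DX o Q h
  | DMP o Q R φ => exact .DMP o Q R φ
  | odeCongr o o' Q φ h _ ih => exact .odeCongr o o' Q φ h ih
  | DE o Q φ => exact .DE o Q φ
  | diffConst c => exact .diffConst c
  | diffVar x => exact .diffVar x
  | diffAdd e d => exact .diffAdd e d
  | diffMul e d => exact .diffMul e d
  | diffApp k args => exact .diffApp k args
  | DIeq o Q e zs h => exact .DIeq o Q e zs h
  | DIge o Q e zs h => exact .DIge o Q e zs h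
  | DIgt o Q e zs h => exact .DIgt o Q e zs h
  | DC o Q R φ => exact .DC o Q R φ
  | DG o Q y a b φ hy h₁ h₂ h₃ h₄ h₅ h₆ => exact .DG o Q y a b φ hy h₁ h₂ h₃ h₄ h₅ h₆
  | DGall o Q y a b φ hy h₁ h₂ h₃ h₄ h₅ h₆ => exact .DGall o Q y a b φ hy h₁ h₂ h₃ h₄ h₅ h₆
  | Uniq o Q R φ h => exact .Uniq o Q R φ (hAB h)
  | Cont o e ys h hf _ ih => exact .Cont o e ys (hAB h) hf ih
  | Dadj o o' Q ys h hf he => exact .Dadj o o' Q ys (hAB h) hf he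
  | RI o P ys h hf _ ih => exact .RI o P ys (hAB h) hf ih
  | RIdom o P Q ys h hf _ ih => exact .RIdom o P Q ys (hAB h) hf ih

theorem of_nil (h : Deriv L A [] φ) : Deriv L A Γ φ := .weaken (List.nil_subset _) h

theorem hyp (h : φ ∈ Γ) : Deriv L A Γ φ := .prop fun _ _ hΓ => hΓ φ h

theorem head : Deriv L A (φ :: Γ) φ := .hyp (by simp)

theorem wk (h : Deriv L A Γ φ) : Deriv L A (ψ :: Γ) φ := .weaken (List.subset_cons_self _ _) h

theorem taut (h : ∀ v, IsPropVal v → v φ) : Deriv L A Γ φ := .prop fun v hv _ => h v hv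

theorem taut₁ (h₁ : Deriv L A Γ φ) (h : ∀ v, IsPropVal v → v φ → v ψ) : Deriv L A Γ ψ :=
  .cut h₁ (.prop fun v hv hΓ => h v hv (hΓ φ (by simp)))

theorem taut₂ (h₁ : Deriv L A Γ φ) (h₂ : Deriv L A Γ ψ)
    (h : ∀ v, IsPropVal v → v φ → v ψ → v χ) : Deriv L A Γ χ :=
  .cut h₁ (.cut h₂.wk (.prop fun v hv hΓ => h v hv (hΓ φ (by simp)) (hΓ ψ (by simp))))

theorem taut₃ (h₁ : Deriv L A Γ φ) (h₂ : Deriv L A Γ ψ) (h₃ : Deriv L A Γ χ)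
    (h : ∀ v, IsPropVal v → v φ → v ψ → v χ → v θ) : Deriv L A Γ θ :=
  taut₁ (taut₂ (taut₂ h₁ h₂ (χ := .and φ ψ) fun _ hv a b => (hv.and _ _).2 ⟨a, b⟩) h₃
    (χ := .and (.and φ ψ) χ) fun _ hv a b => (hv.and _ _).2 ⟨a, b⟩) fun v hv a => by
      rw [hv.and, hv.and] at a
      exact h v hv a.1.1 a.1.2 a.2

theorem mp (h : Deriv L A Γ (imp φ ψ)) (h' : Deriv L A Γ φ) : Deriv L A Γ ψ :=
  taut₂ h h' fun _ hv a b => (hv.imp _ _).1 a b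

theorem mp_iff (h : Deriv L A Γ (iff φ ψ)) (h' : Deriv L A Γ φ) : Deriv L A Γ ψ :=
  taut₂ h h' fun _ hv a b => ((hv.iff _ _).1 a).1 b

theorem mpr_iff (h : Deriv L A Γ (iff φ ψ)) (h' : Deriv L A Γ ψ) : Deriv L A Γ φ :=
  taut₂ h h' fun _ hv a b => ((hv.iff _ _).1 a).2 b

theorem andI (h : Deriv L A Γ φ) (h' : Deriv L A Γ ψ) : Deriv L A Γ (.and φ ψ) :=
  taut₂ h h' fun _ hv a b => (hv.and _ _).2 ⟨a, b⟩

theorem andL (h : Deriv L A Γ (.and φ ψ)) : Deriv L A Γ φ :=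
  taut₁ h fun _ hv a => ((hv.and _ _).1 a).1

theorem andR (h : Deriv L A Γ (.and φ ψ)) : Deriv L A Γ ψ :=
  taut₁ h fun _ hv a => ((hv.and _ _).1 a).2

theorem iffI (h : Deriv L A Γ (imp φ ψ)) (h' : Deriv L A Γ (imp ψ φ)) :
    Deriv L A Γ (iff φ ψ) := andI h h'

theorem orE (h : Deriv L A Γ (.or φ ψ)) (h₁ : Deriv L A (φ :: Γ) χ) (h₂ : Deriv L A (ψ :: Γ) χ) :
    Deriv L A Γ χ :=
  taut₃ h (impR h₁) (impR h₂) fun v hv a b c => by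
    rw [hv.or] at a; rw [hv.imp] at b c; exact a.elim b c

/-- Classical case distinction. -/
theorem cases (φ : Fml L.toSig) (h₁ : Deriv L A (φ :: Γ) χ) (h₂ : Deriv L A (.not φ :: Γ) χ) :
    Deriv L A Γ χ :=
  orE (taut fun v hv => by rw [hv.or, hv.not]; exact em _) h₁ h₂

theorem absurd (h : Deriv L A Γ φ) (h' : Deriv L A Γ (.not φ)) : Deriv L A Γ ψ :=
  taut₂ h h' fun _ hv a b => (((hv.not _).1 b) a).elim

/-! ### Modalities -/

theorem box_mono {α : Prog L.toSig} (h : Deriv L A [] (imp φ ψ)) (h' : Deriv L A Γ (box α φ)) :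
    Deriv L A Γ (box α ψ) := mp (mp (.K α φ ψ) (.G α h)) h'

theorem box_mono₂ {α : Prog L.toSig} (h : Deriv L A [] (imp φ (imp ψ χ)))
    (h₁ : Deriv L A Γ (box α φ)) (h₂ : Deriv L A Γ (box α ψ)) : Deriv L A Γ (box α χ) :=
  mp (mp (.K α ψ χ) (box_mono h h₁)) h₂

theorem box_const {α : Prog L.toSig} (hφ : ∀ v ∈ φ.fv, v ∉ α.bv) (h : Deriv L A Γ φ) :
    Deriv L A Γ (box α φ) := mp (.V α hφ) h

theorem dia_mono {α : Prog L.toSig} (h : Deriv L A [] (imp φ ψ)) (h' : Deriv L A Γ (dia α φ)) :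
    Deriv L A Γ (dia α ψ) :=
  taut₃ (mp_iff (.diamond α φ) h') (.diamond α ψ)
    (impR (box_mono (φ := .not ψ) (ψ := .not φ)
      (taut₁ h fun v hv a => by rw [hv.imp] at *; rw [hv.not, hv.not]; exact mt a) head))
    fun v hv a b c => by
      rw [hv.not] at a; rw [hv.iff, hv.not] at b; rw [hv.imp] at c; exact b.2 (mt c a)

/-- What holds after all runs holds in particular at the state witnessing the diamond. -/
theorem dia_box {α : Prog L.toSig} (h : Deriv L A [] (imp φ (imp ψ χ)))
    (h₁ : Deriv L A Γ (dia α φ)) (h₂ : Deriv L A Γ (box α ψ)) : Deriv L A Γ (dia α χ) :=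
  taut₃ (mp_iff (.diamond α φ) h₁) (.diamond α χ)
    (impR (box_mono₂ (φ := .not χ) (ψ := ψ) (χ := .not φ)
      (taut₁ h fun v hv a => by simp only [hv.imp, hv.not] at *; tauto) head h₂.wk))
    fun v hv a b c => by
      rw [hv.not] at a; rw [hv.iff, hv.not] at b; rw [hv.imp] at c; exact b.2 (mt c a)

/-- A diamond and a box with contradictory postconditions. -/
theorem dia_absurd {α : Prog L.toSig} (h₁ : Deriv L A Γ (dia α φ))
    (h₂ : Deriv L A Γ (box α (.not φ))) : Deriv L A Γ χ :=
  absurd h₂ (mp_iff (.diamond α φ) h₁)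

theorem box_of_not_dia {α : Prog L.toSig} (h : Deriv L A Γ (.not (dia α (.not φ)))) :
    Deriv L A Γ (box α φ) :=
  box_mono (φ := .not (.not φ)) (taut fun v hv => by simp only [hv.imp, hv.not]; tauto)
    (taut₂ h (.diamond α (.not φ)) fun v hv a b => by
      rw [hv.not] at a; rw [hv.iff, hv.not] at b; tauto)

theorem box_dom {o : ODE L.toSig} {Q R : SA L.toSig}
    (h : Deriv L A Γ (box (ode o Q) (imp Q.toFml R.toFml)))
    (h' : Deriv L A Γ (box (ode o R) φ)) : Deriv L A Γ (box (ode o Q) φ) :=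
  mp (mp (.DMP o Q R φ) h) h'

theorem dia_dom {o : ODE L.toSig} {Q R : SA L.toSig}
    (h : Deriv L A Γ (box (ode o Q) (imp Q.toFml R.toFml)))
    (h' : Deriv L A Γ (dia (ode o Q) φ)) : Deriv L A Γ (dia (ode o R) φ) :=
  taut₃ (mp_iff (.diamond _ φ) h') (.diamond (ode o R) φ) (mp (.DMP o Q R (.not φ)) h)
    fun v hv a b c => by
      rw [hv.not] at a; rw [hv.iff, hv.not] at b; rw [hv.imp] at c; exact b.2 (mt c a)

/-! ### Quantifiers -/

theorem allE {x : ℕ} (h : Deriv L A Γ (all x φ)) : Deriv L A Γ φ :=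
  .cut h (.allL (.var x) (freeFor_self x φ) (by rw [subst_self]; exact head))

theorem allVecE {xs : List ℕ} (h : Deriv L A Γ (allVec xs φ)) : Deriv L A Γ φ := by
  induction xs with
  | nil => exact h
  | cons x xs ih => exact ih (allE h)

theorem allVecI {xs : List ℕ} (hΓ : ∀ χ ∈ Γ, ∀ x ∈ xs, Var.val x ∉ χ.fv) (h : Deriv L A Γ φ) :
    Deriv L A Γ (allVec xs φ) := by
  induction xs with
  | nil => exact h
  | cons x xs ih =>
    exact .allR (fun χ hχ => hΓ χ hχ x (by simp))
      (ih fun χ hχ y hy => hΓ χ hχ y (by simp [hy]))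

end Deriv

/-! ### Free variables and renaming of vectors of quantifiers -/

theorem Fml.fv_allVec (xs : List ℕ) (φ : Fml L.toSig) :
    (allVec xs φ).fv = φ.fv \ (xs.map Var.val).toFinset := by
  induction xs with
  | nil => simp [allVec]
  | cons x xs ih =>
    have : allVec (x :: xs) φ = all x (allVec xs φ) := rfl
    rw [this, fv, ih]
    ext v
    simp
    tauto

theorem Fml.val_notMem_fv_allVec {xs : List ℕ} {φ : Fml L.toSig} {x : ℕ} (h : x ∈ xs) :
    Var.val x ∉ (allVec xs φ).fv := by
  simp [fv_allVec, h]

theorem Fml.fv_allVec_subset (xs : List ℕ) (φ : Fml L.toSig) : (allVec xs φ).fv ⊆ φ.fv := by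
  rw [fv_allVec]; exact Finset.sdiff_subset

theorem Fml.rename_allVec (π : Equiv.Perm ℕ) (xs : List ℕ) (φ : Fml L.toSig) :
    (allVec xs φ).rename π = allVec (xs.map π) (φ.rename π) := by
  induction xs with
  | nil => rfl
  | cons x xs ih =>
    have h : allVec (x :: xs) φ = all x (allVec xs φ) := rfl
    rw [h, rename, ih]
    rfl

theorem Fml.rename_refl (φ : Fml L.toSig) : φ.rename (Equiv.refl ℕ) = φ := by
  have hD : DVar.rename (S := L.toSig) (Equiv.refl ℕ) = id := by
    funext a
    rcases a with (x | x) | e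
    · rfl
    · rfl
    · exact congrArg DVar.diff (Tm.map_id_of_fv fun _ _ => rfl)
  have hT : ∀ t : DTm L.toSig, t.map (DVar.rename (Equiv.refl ℕ)) = t := fun t => by
    rw [hD]; exact Tm.bind_var t
  have hO : ∀ o : ODE L.toSig, o.rename (Equiv.refl ℕ) = o := fun o => by
    apply ODE.ext
    simp only [ODE.rename]
    conv_rhs => rw [← List.map_id o.eqs]
    refine List.map_congr_left fun p _ => ?_
    exact Prod.ext rfl (Tm.map_id_of_fv fun _ _ => rfl)
  have hP : ∀ α : Prog L.toSig, α.rename (Equiv.refl ℕ) = α := by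
    rintro (⟨x | x, e⟩ | ⟨o, Q⟩)
    · exact congrArg _ (Tm.map_id_of_fv fun _ _ => rfl)
    · exact congrArg _ (Tm.map_id_of_fv fun _ _ => rfl)
    · exact congrArg₂ _ (hO o) (SA.map_id_of_fv fun _ _ => rfl)
  induction φ with
  | cmp c s t => rw [rename, hT, hT]
  | and φ ψ h h' | or φ ψ h h' => rw [rename, h, h']
  | not φ h => rw [rename, h]
  | all x φ h | ex x φ h => rw [rename, h]; rfl
  | box α φ h | dia α φ h => rw [rename, h, hP]

/-! ### Real arithmetic -/

/-- The value of a differential-free term as a polynomial. -/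
def tval (a : DTm L.toSig → ℝ) (ω : ℕ → ℝ) (t : Tm L.toSig ℕ) : ℝ := DTm.polyEval ω a t.lift

/-- Truth of a semianalytic formula over the reals. -/
def SA.Sat (a : DTm L.toSig → ℝ) (ω : ℕ → ℝ) (P : SA L.toSig) : Prop := P.toFml.ArithHolds a ω

section Sat
variable (a : DTm L.toSig → ℝ) (ω : ℕ → ℝ)

theorem tval_var (x : ℕ) : tval (L := L) a ω (.var x) = ω x := rfl
theorem tval_const (c : ℚ) : tval (L := L) a ω (.const c) = c := rfl
theorem tval_add (s t : Tm L.toSig ℕ) : tval a ω (.add s t) = tval a ω s + tval a ω t := rfl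
theorem tval_mul (s t : Tm L.toSig ℕ) : tval a ω (.mul s t) = tval a ω s * tval a ω t := rfl
theorem tval_neg (t : Tm L.toSig ℕ) : tval a ω t.neg = -tval a ω t := by
  simp [Tm.neg, tval_mul, tval_const]
theorem tval_sum (l : List (Tm L.toSig ℕ)) : tval a ω (Tm.sum l) = (l.map (tval a ω)).sum := by
  induction l with
  | nil => simp [Tm.sum, tval_const]
  | cons t l ih => rw [List.map_cons, List.sum_cons, ← ih]; rfl

theorem sat_cmp (c : Cmp) (s t : Tm L.toSig ℕ) :
    (SA.cmp c s t).Sat a ω ↔ c.Holds (tval a ω s) (tval a ω t) := Iff.rfl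
theorem sat_and (P Q : SA L.toSig) : (P.and Q).Sat a ω ↔ P.Sat a ω ∧ Q.Sat a ω := Iff.rfl
theorem sat_or (P Q : SA L.toSig) : (P.or Q).Sat a ω ↔ P.Sat a ω ∨ Q.Sat a ω := Iff.rfl
theorem sat_not (P : SA L.toSig) : P.not.Sat a ω ↔ ¬ P.Sat a ω := Iff.rfl
theorem sat_imp (P Q : SA L.toSig) : (P.imp Q).Sat a ω ↔ (P.Sat a ω → Q.Sat a ω) := by
  rw [SA.imp, sat_or, sat_not, imp_iff_not_or]
theorem sat_eqz (t : Tm L.toSig ℕ) : (SA.eqz t).Sat a ω ↔ tval a ω t = 0 := by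
  simp [SA.eqz, sat_cmp, Cmp.Holds, tval_const]
theorem sat_gez (t : Tm L.toSig ℕ) : (SA.gez t).Sat a ω ↔ 0 ≤ tval a ω t := by
  simp [SA.gez, sat_cmp, Cmp.Holds, tval_const]
theorem sat_gtz (t : Tm L.toSig ℕ) : (SA.gtz t).Sat a ω ↔ 0 < tval a ω t := by
  simp [SA.gtz, sat_cmp, Cmp.Holds, tval_const]
theorem sat_tt : (SA.tt : SA L.toSig).Sat a ω ↔ True := by
  simp [SA.tt, sat_cmp, Cmp.Holds]
theorem sat_ff : (SA.ff : SA L.toSig).Sat a ω ↔ False := by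
  simp [SA.ff, sat_not, sat_tt]
theorem sat_conj (l : List (SA L.toSig)) : (SA.conj l).Sat a ω ↔ ∀ P ∈ l, P.Sat a ω := by
  induction l with
  | nil => simp [SA.conj, sat_tt]
  | cons P l ih => simp only [List.forall_mem_cons, ← ih]; exact sat_and a ω P _
theorem sat_disj (l : List (SA L.toSig)) : (SA.disj l).Sat a ω ↔ ∃ P ∈ l, P.Sat a ω := by
  induction l with
  | nil => simp [SA.disj, sat_ff]
  | cons P l ih => simp only [List.exists_mem_cons_iff, ← ih]; exact sat_or a ω P _
theorem sat_eqVec (xs ys : List ℕ) :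
    (SA.eqVec xs ys : SA L.toSig).Sat a ω ↔ ∀ p ∈ xs.zip ys, ω p.1 = ω p.2 := by
  rw [SA.eqVec, sat_conj, ← List.map_uncurry_zip_eq_zipWith, List.forall_mem_map]
  simp [Function.uncurry, sat_cmp, Cmp.Holds, tval_var]

end Sat

theorem SA.isArith (P : SA L.toSig) : P.toFml.IsArith ∅ := by
  induction P <;> simp_all [SA.toFml, Fml.IsArith]

namespace Deriv

/-- Since `a` is arbitrary, nonpolynomial subterms are independent unknowns; without quantifiers no
capture condition remains. Pointwise reasoning over ℝ thereby becomes a derivation. -/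
theorem real_of_sat {P : SA L.toSig} (h : ∀ a ω, P.Sat a ω) : Deriv L A Γ P.toFml :=
  of_nil (.real (by simpa using P.isArith) fun a ω _ => h a ω)

theorem real₁ {P Q : SA L.toSig} (h₁ : Deriv L A Γ P.toFml)
    (h : ∀ a ω, P.Sat a ω → Q.Sat a ω) : Deriv L A Γ Q.toFml :=
  mp (real_of_sat (P := P.imp Q) fun a ω => (sat_imp a ω P Q).2 (h a ω)) h₁

theorem real₂ {P Q R : SA L.toSig} (h₁ : Deriv L A Γ P.toFml) (h₂ : Deriv L A Γ Q.toFml)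
    (h : ∀ a ω, P.Sat a ω → Q.Sat a ω → R.Sat a ω) : Deriv L A Γ R.toFml :=
  real₁ (P := P.and Q) (andI h₁ h₂) fun a ω ⟨x, y⟩ => h a ω x y

theorem real₃ {P Q R T : SA L.toSig} (h₁ : Deriv L A Γ P.toFml) (h₂ : Deriv L A Γ Q.toFml)
    (h₃ : Deriv L A Γ R.toFml) (h : ∀ a ω, P.Sat a ω → Q.Sat a ω → R.Sat a ω → T.Sat a ω) :
    Deriv L A Γ T.toFml :=
  real₂ (P := P.and Q) (andI h₁ h₂) h₃ fun a ω ⟨x, y⟩ => h a ω x y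

theorem real_imp {P Q : SA L.toSig} (h : ∀ a ω, P.Sat a ω → Q.Sat a ω) :
    Deriv L A Γ (imp P.toFml Q.toFml) :=
  impR (real₁ head h)

theorem real_imp₂ {P Q R : SA L.toSig} (h : ∀ a ω, P.Sat a ω → Q.Sat a ω → R.Sat a ω) :
    Deriv L A Γ (imp P.toFml (imp Q.toFml R.toFml)) :=
  impR (impR (real₂ head.wk head h))

theorem disjE {l : List (SA L.toSig)} (h : Deriv L A Γ (SA.disj l).toFml)
    (h' : ∀ P ∈ l, Deriv L A (P.toFml :: Γ) φ) : Deriv L A Γ φ := by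
  induction l generalizing Γ with
  | nil =>
    exact absurd (φ := SA.tt.toFml) (real_of_sat fun a ω => (sat_tt a ω).2 trivial) h
  | cons P l ih =>
    refine orE (φ := P.toFml) (ψ := (SA.disj l).toFml) h (h' P (by simp)) ?_
    exact ih head fun R hR =>
      .weaken (List.cons_subset_cons _ (List.subset_cons_self _ _)) (h' R (by simp [hR]))

theorem box_dom_mono {o : ODE L.toSig} {Q R : SA L.toSig} (h : ∀ a ω, Q.Sat a ω → R.Sat a ω)
    (h' : Deriv L A Γ (box (ode o R) φ)) : Deriv L A Γ (box (ode o Q) φ) :=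
  box_dom (.G _ (real_imp h)) h'

theorem dia_dom_mono {o : ODE L.toSig} {Q R : SA L.toSig} (h : ∀ a ω, Q.Sat a ω → R.Sat a ω)
    (h' : Deriv L A Γ (dia (ode o Q) φ)) : Deriv L A Γ (dia (ode o R) φ) :=
  dia_dom (.G _ (real_imp h)) h'

/-! ### Vectors of variables -/

/-- Equal variables may be replaced in semianalytic formulas. -/
theorem eqVec_congr {xs ys : List ℕ} (hd : ∀ y ∈ ys, y ∉ xs)
    (P : SA L.toSig) : Deriv L A Γ (imp (SA.eqVec xs ys).toFml
      (imp P.toFml (P.map (renVec xs ys)).toFml)) := by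
  induction xs generalizing ys P with
  | nil =>
    have h : P.map (renVec [] ys) = P := SA.map_id_of_fv fun x _ => by simp [renVec]
    rw [h]
    exact taut fun v hv => by simp only [hv.imp]; tauto
  | cons x xs ih =>
    cases ys with
    | nil =>
      have h : P.map (renVec (x :: xs) []) = P := SA.map_id_of_fv fun x _ => by simp [renVec]
      rw [h]
      exact taut fun v hv => by simp only [hv.imp]; tauto
    | cons y ys =>
      have hy : y ∉ xs := fun h => hd y (by simp) (by simp [h])
      -- Equality substitution replaces one variable at a time. As `y` is not in `xs`, the
      -- successive replacements compose to the simultaneous one.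
      have h := SA.map_map (fun z => if z = x then y else z) (renVec xs ys) P
      have h' : renVec xs ys ∘ (fun z => if z = x then y else z) = renVec (x :: xs) (y :: ys) := by
        funext z
        simp only [Function.comp, renVec]
        split_ifs
        · have : ∀ (us ws : List ℕ), y ∉ us → renVec us ws y = y := by
            intro us
            induction us with
            | nil => intro ws _; cases ws <;> rfl
            | cons u us ih =>
              intro ws hu
              simp only [List.mem_cons, not_or] at hu
              cases ws with
              | nil => rfl
              | cons w ws => simp [renVec, hu.1, ih ws hu.2]
          exact this xs ys hy
        · rfl
      rw [h'] at h
      rw [← h]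
      have h₁ := eqSubst (A := A) (Γ := Γ) (.val x) (.var x) (.var y) (φ := P.toFml)
        (freeFor_self x _) (.inr (P.toFml_adm _ _))
      rw [subst_self, SA.toFml_subst] at h₁
      have h₂ : P.bind ((Var.val x).toSubst (.var y)) = P.map fun z => if z = x then y else z := by
        unfold SA.map
        congr 1
        funext z
        simp only [Var.toSubst, Var.val.injEq, eq_comm (a := x)]
        split_ifs <;> rfl
      rw [h₂] at h₁
      refine taut₂ h₁ (ih (ys := ys) (fun w hw h => hd w (by simp [hw]) (by simp [h]))
        (P.map fun z => if z = x then y else z)) fun v hv a b => ?_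
      rw [SA.eqVec_cons]
      simp only [hv.imp, SA.toFml, hv.and] at *
      tauto

/-- Renaming of universally quantified variables, followed by instantiation. -/
theorem allVec_rename {xs ys : List ℕ} (hxs : xs.Nodup) (hl : ys.length = xs.length)
    (hys : ys.Nodup) (hd : ∀ y ∈ ys, y ∉ xs) (hφ : ∀ y ∈ ys, Var.val y ∉ φ.fv)
    (hφ' : ∀ y ∈ ys, Var.der y ∉ φ.fv) (hφ'' : ∀ x ∈ xs, Var.der x ∉ φ.fv)
    (h : Deriv L A Γ (allVec xs φ)) : Deriv L A Γ (φ.rename (swapVec xs ys)) := by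
  induction xs generalizing ys φ with
  | nil =>
    change Deriv L A Γ (φ.rename (Equiv.refl ℕ))
    rw [rename_refl]
    exact h
  | cons x xs ih =>
    cases ys with
    | nil => simp at hl
    | cons y ys =>
      simp only [List.nodup_cons] at hxs hys
      have hy : y ∉ x :: xs := hd y (by simp)
      simp only [List.mem_cons, not_or] at hy
      -- Instantiating `x` by `y` directly need not be admissible, since a differential equation in
      -- `φ` may bind `x`. Renaming the quantifier and then instantiating `y` by itself avoids
      -- substitution.
      have h₁ : Deriv L A Γ (all y ((allVec xs φ).rename (Equiv.swap x y))) :=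
        mp_iff (boundRename x y (allVec xs φ)
          (fun h => hφ y (by simp) (fv_allVec_subset _ _ h))
          (fun h => hφ'' x (by simp) (fv_allVec_subset _ _ h))
          (fun h => hφ' y (by simp) (fv_allVec_subset _ _ h))) h
      have h₂ := allE h₁
      have h₃ : xs.map (Equiv.swap x y) = xs := by
        conv_rhs => rw [← List.map_id xs]
        refine List.map_congr_left fun z hz => ?_
        exact Equiv.swap_apply_of_ne_of_ne (fun h => hxs.1 (h ▸ hz)) (fun h => hy.2 (h ▸ hz))
      rw [rename_allVec, h₃] at h₂
      have key : ∀ z, z ≠ x → z ≠ y → ∀ c : ℕ → Var, (c = Var.val ∨ c = Var.der) →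
          c z ∈ (φ.rename (Equiv.swap x y)).fv → c z ∈ φ.fv := by
        intro z hzx hzy c hc h
        obtain ⟨u, hu, hu'⟩ := Finset.mem_image.1 (fv_rename _ _ h)
        have : c z = Var.map (Equiv.swap x y) (c z) := by
          rcases hc with rfl | rfl <;>
          simp [Var.map, Equiv.swap_apply_of_ne_of_ne hzx hzy]
        rw [this] at hu'
        rwa [← Var.map_injective _ hu']
      have hne : ∀ w ∈ ys, w ≠ x ∧ w ≠ y := fun w hw =>
        ⟨fun h => hd w (by simp [hw]) (by simp [h]), fun h => hys.1 (h ▸ hw)⟩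
      have := ih hxs.2 (by simpa using hl) hys.2
        (fun w hw h => hd w (by simp [hw]) (by simp [h]))
        (fun w hw h => hφ w (by simp [hw]) (key w (hne w hw).1 (hne w hw).2 _ (.inl rfl) h))
        (fun w hw h => hφ' w (by simp [hw]) (key w (hne w hw).1 (hne w hw).2 _ (.inr rfl) h))
        (fun w hw h => hφ'' w (by simp [hw]) (key w (fun h => hxs.1 (h ▸ hw))
          (fun h => hy.2 (h ▸ hw)) _ (.inr rfl) h)) h₂
      rwa [rename_rename] at this

theorem exists_eq {x y : ℕ} (h : x ≠ y) :
    Deriv L A Γ (.ex y (SA.cmp .eq (.var x) (.var y)).toFml) := by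
  refine of_nil (.real ?_ fun a ω _ => ⟨ω x, ?_⟩)
  · simp [SA.toFml, IsArith, Tm.lift, Tm.map, Tm.bind, DTm.opaqueFv, DVar.diffFv]
  · simp [SA.toFml, ArithHolds, Tm.lift, Tm.map, Tm.bind, DTm.polyEval, Cmp.Holds,
      Function.update_of_ne h]

/-- Introduction of fresh copies `ys` of the variables `xs`. -/
theorem fresh_copy {xs ys : List ℕ} (hl : ys.length = xs.length) (hys : ys.Nodup)
    (hd : ∀ y ∈ ys, y ∉ xs) (hΓ : ∀ χ ∈ Γ, ∀ y ∈ ys, Var.val y ∉ χ.fv)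
    (hφ : ∀ y ∈ ys, Var.val y ∉ φ.fv) (h : Deriv L A Γ (imp (SA.eqVec xs ys).toFml φ)) :
    Deriv L A Γ φ := by
  induction xs generalizing ys Γ with
  | nil => exact mp h (real_of_sat fun a ω => by simp [sat_eqVec])
  | cons x xs ih =>
    cases ys with
    | nil => simp at hl
    | cons y ys =>
      simp only [List.nodup_cons] at hys
      have hy : y ∉ x :: xs := hd y (by simp)
      simp only [List.mem_cons, not_or] at hy
      refine .cut (exists_eq (x := x) (y := y) (Ne.symm hy.1)) (.exL
        (fun χ hχ => hΓ χ hχ y (by simp)) (hφ y (by simp)) (ih (by simpa using hl) hys.2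
          (fun w hw h => hd w (by simp [hw]) (by simp [h])) ?_ (fun w hw => hφ w (by simp [hw])) ?_))
      · intro χ hχ w hw
        rcases List.mem_cons.1 hχ with rfl | hχ
        · rw [SA.val_mem_fv]
          have h1 : w ≠ x := fun h => hd w (by simp [hw]) (by simp [h])
          have h2 : w ≠ y := fun h => hys.1 (h ▸ hw)
          simp [SA.fv, Tm.fv, Tm.collect, h1, h2]
        · exact hΓ χ hχ w (by simp [hw])
      · refine taut₂ h.wk head fun v hv a b => ?_
        rw [SA.eqVec_cons] at a
        simp only [hv.imp, SA.toFml, hv.and] at *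
        tauto

/-- If `φ` could fail after a run, some `w` would equal the value of `x` there. Barcan moves this
existential in front of the run, so that the final value has a name before the run starts. -/
theorem box_fresh_copy_single {o : ODE L.toSig} {Q : SA L.toSig} {x w : ℕ} (hx : x ≠ w)
    (ho : w ∉ o.fv) (hQ : w ∉ Q.fv) (hΓ : ∀ χ ∈ Γ, Var.val w ∉ χ.fv) (hφ : Var.val w ∉ φ.fv)
    (h : Deriv L A Γ (box (ode o Q) (imp (SA.cmp .eq (.var x) (.var w)).toFml φ))) :
    Deriv L A Γ (box (ode o Q) φ) := by
  set e : Fml L.toSig := (SA.cmp .eq (.var x) (.var w)).toFml with he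
  have h₁ : Deriv L A [] (imp (.not φ) (.ex w (.and e (.not φ)))) := by
    refine .impR (.cut (exists_eq hx) (.exL ?_ ?_ (.exR (.var w) (freeFor_self _ _) ?_)))
    · simpa [fv] using hφ
    · simp [fv]
    · rw [subst_self]
      exact andI head head.wk
  have h₂ : Deriv L A Γ (imp (.ex w (dia (ode o Q) (.and e (.not φ)))) (box (ode o Q) φ)) := by
    refine .impR (.exL hΓ ?_ (dia_absurd head (box_mono ?_ h.wk)))
    · simp [fv, Prog.fv, ho, hQ, hφ]
    · exact taut fun v hv => by simp only [hv.imp, hv.and, hv.not]; tauto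
  refine cases (box (ode o Q) φ) head ?_
  refine mp h₂.wk (mp_iff (.barcan o Q w _ ho hQ) (dia_mono h₁ ?_))
  refine taut₂ (φ := imp (box (ode o Q) (.not (.not φ))) (box (ode o Q) φ)) (impR (box_mono ?_ head))
    (.andI (.diamond (ode o Q) (.not φ)) head) fun v hv a b => ?_
  · exact taut fun v hv => by simp only [hv.imp, hv.not]; tauto
  · simp only [hv.imp, hv.and, hv.iff, hv.not] at *
    tauto

/-- Introduction of fresh names `ws` for the final values of the variables `xs`. -/
theorem box_fresh_copy {o : ODE L.toSig} {Q : SA L.toSig} {xs ws : List ℕ}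
    (hl : ws.length = xs.length) (hws : ws.Nodup) (hd : ∀ w ∈ ws, w ∉ xs)
    (ho : ∀ w ∈ ws, w ∉ o.fv) (hQ : ∀ w ∈ ws, w ∉ Q.fv)
    (hΓ : ∀ χ ∈ Γ, ∀ w ∈ ws, Var.val w ∉ χ.fv) (hφ : ∀ w ∈ ws, Var.val w ∉ φ.fv)
    (h : Deriv L A Γ (box (ode o Q) (imp (SA.eqVec xs ws).toFml φ))) :
    Deriv L A Γ (box (ode o Q) φ) := by
  induction xs generalizing ws φ with
  | nil =>
    refine box_mono (.impR (mp head (real_of_sat fun a ω => by simp [sat_eqVec]))) h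
  | cons x xs ih =>
    cases ws with
    | nil => simp at hl
    | cons w ws =>
      simp only [List.nodup_cons] at hws
      have hw : w ∉ x :: xs := hd w (by simp)
      simp only [List.mem_cons, not_or] at hw
      refine box_fresh_copy_single (Ne.symm hw.1) (ho w (by simp)) (hQ w (by simp))
        (fun χ hχ => hΓ χ hχ w (by simp)) (hφ w (by simp)) (ih (by simpa using hl) hws.2
          (fun w hw h => hd w (by simp [hw]) (by simp [h])) (fun w hw => ho w (by simp [hw]))
          (fun w hw => hQ w (by simp [hw])) (fun χ hχ w hw => hΓ χ hχ w (by simp [hw])) ?_ ?_)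
      · intro u hu
        have h1 : u ≠ x := fun h => hd u (by simp [hu]) (by simp [h])
        have h2 : u ≠ w := fun h => hws.1 (h ▸ hu)
        have h3 := hφ u (by simp [hu])
        simp only [imp, fv, Finset.mem_union, SA.val_mem_fv, h3, or_false]
        simp [SA.fv, Tm.fv, Tm.collect, h1, h2]
      · refine box_mono (taut fun v hv => ?_) h
        rw [SA.eqVec_cons]
        simp only [hv.imp, SA.toFml, hv.and]
        tauto

end Deriv
end Calculus

/-! ## Differential invariants by Lie derivatives -/

section Differential
variable {L : TermLang} {A : Set ExtAx} {Γ Δ : List (Fml L.toSig)}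
  {φ ψ χ θ : Fml L.toSig}

namespace ODE
variable {S : Sig}

theorem lookup_eq_none {l : List (ℕ × Tm S ℕ)} {x : ℕ} :
    l.lookup x = none ↔ x ∉ l.map Prod.fst := by
  induction l with
  | nil => simp
  | cons p l ih =>
    rw [List.lookup_cons]
    by_cases h : x = p.1
    · simp [h]
    · have h' : (x == p.1) = false := by simpa using h
      simp [h', ih, h]

theorem rhs_of_notMem {o : ODE S} {x : ℕ} (h : x ∉ o.vars) : o.rhs x = .const 0 := by
  rw [rhs, lookup_eq_none.2 h]
  rfl

end ODE

/-- The differential `(e)'`, expanded to a term in the differential variables. -/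
def TermLang.total (L : TermLang) : Tm L.toSig ℕ → DTm L.toSig
  | .var x => .var (.var (.der x))
  | .const _ => .const 0
  | .add s t => .add (L.total s) (L.total t)
  | .mul s t => .add (.mul (L.total s) t.lift) (.mul s.lift (L.total t))
  | .app h args =>
      Tm.sum (List.ofFn fun i => .mul ((L.pd h i).bind args).lift (L.total (args i)))

theorem polyEval_sum (ω : ℕ → ℝ) (a : DTm L.toSig → ℝ) (l : List (DTm L.toSig)) :
    DTm.polyEval ω a (Tm.sum l) = (l.map (DTm.polyEval ω a)).sum := by
  induction l with
  | nil => simp [Tm.sum, DTm.polyEval]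
  | cons t l ih => rw [List.map_cons, List.sum_cons, ← ih]; rfl

namespace Deriv

theorem cut_list (h : ∀ χ ∈ Δ, Deriv L A Γ χ) (h' : Deriv L A Δ φ) : Deriv L A Γ φ := by
  induction Δ generalizing φ with
  | nil => exact of_nil h'
  | cons χ Δ ih =>
    exact mp (ih (fun θ hθ => h θ (by simp [hθ])) (.impR h')) (h χ (by simp))

/-- The differential axioms expand the differential of every term. -/
theorem diff_eq_total (e : Tm L.toSig ℕ) : Deriv L A Γ (.cmp .eq e.diff (L.total e)) := by
  induction e generalizing Γ with
  | var x => exact .diffVar x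
  | const c => exact .diffConst c
  | add s t hs ht =>
    refine cut_list (Δ := [.cmp .eq (Tm.add s t).diff (.add s.diff t.diff),
      .cmp .eq s.diff (L.total s), .cmp .eq t.diff (L.total t)]) ?_ (.real ?_ ?_)
    · intro χ hχ
      simp only [List.mem_cons, List.not_mem_nil, or_false] at hχ
      rcases hχ with rfl | rfl | rfl
      exacts [.diffAdd s t, hs, ht]
    · simp [IsArith]
    · simp [ArithHolds, Cmp.Holds, DTm.polyEval, TermLang.total]
      intro a ω h₁ h₂ h₃
      rw [h₁, h₂, h₃]
  | mul s t hs ht =>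
    refine cut_list (Δ := [.cmp .eq (Tm.mul s t).diff (.add (.mul s.diff t.lift) (.mul s.lift t.diff)),
      .cmp .eq s.diff (L.total s), .cmp .eq t.diff (L.total t)]) ?_ (.real ?_ ?_)
    · intro χ hχ
      simp only [List.mem_cons, List.not_mem_nil, or_false] at hχ
      rcases hχ with rfl | rfl | rfl
      exacts [.diffMul s t, hs, ht]
    · simp [IsArith]
    · simp [ArithHolds, Cmp.Holds, DTm.polyEval, TermLang.total]
      intro a ω h₁ h₂ h₃
      rw [h₁, h₂, h₃]
  | app k args ih =>
    refine cut_list (Δ := .cmp .eq (Tm.app k args).diff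
      (Tm.sum (List.ofFn fun i => .mul ((L.pd k i).bind args).lift (args i).diff)) ::
      List.ofFn fun i => .cmp .eq (args i).diff (L.total (args i))) ?_ (.real ?_ ?_)
    · intro χ hχ
      rcases List.mem_cons.1 hχ with rfl | hχ
      · exact .diffApp k args
      · obtain ⟨i, rfl⟩ := (List.mem_ofFn' _ _).1 hχ
        exact ih i
    · intro χ hχ
      simp only [List.mem_cons, List.mem_ofFn] at hχ
      rcases hχ with rfl | rfl | ⟨i, rfl⟩ <;> simp [IsArith]
    · intro a ω h
      have h₁ := h _ List.mem_cons_self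
      have h₂ : ∀ i, a (args i).diff = DTm.polyEval ω a (L.total (args i)) := fun i =>
        h (.cmp .eq (args i).diff (L.total (args i)))
          (List.mem_cons_of_mem _ ((List.mem_ofFn' _ _).2 ⟨i, rfl⟩))
      refine h₁.trans ?_
      rw [TermLang.total, polyEval_sum, polyEval_sum, List.map_ofFn, List.map_ofFn]
      congr 2
      funext i
      simp only [Function.comp, DTm.polyEval]
      exact congrArg _ (h₂ i)

end Deriv

/-! ### Substitution for differential variables -/

namespace DTm

theorem diffFv_subst (v : Var) (e : Tm L.toSig ℕ) (t : DTm L.toSig) :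
    diffFv (t.bind (DVar.subst v e)) = diffFv t := by
  rw [diffFv, diffFv, Tm.collect_bind]
  congr 1
  funext a
  cases a with
  | var w =>
    simp only [DVar.subst]
    split_ifs
    · exact Tm.diffFv_lift e
    · rfl
  | diff d => rfl

/-- Successive substitution for differential variables, the last one first. -/
def substDer (l : List (ℕ × Tm L.toSig ℕ)) (t : DTm L.toSig) : DTm L.toSig :=
  l.foldr (fun p s => s.bind (DVar.subst (.der p.1) p.2)) t

theorem diffFv_substDer (l : List (ℕ × Tm L.toSig ℕ)) (t : DTm L.toSig) :
    diffFv (substDer l t) = diffFv t := by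
  induction l with
  | nil => rfl
  | cons p l ih =>
    change diffFv ((substDer l t).bind _) = _
    rw [diffFv_subst, ih]

theorem diffFv_sum {l : List (DTm L.toSig)} (h : ∀ t ∈ l, diffFv t = ∅) :
    diffFv (Tm.sum l) = ∅ := by
  induction l with
  | nil => rfl
  | cons t l ih =>
    change diffFv t ∪ diffFv (Tm.sum l) = ∅
    rw [h t (by simp), ih fun s hs => h s (by simp [hs])]
    rfl

theorem diffFv_total (e : Tm L.toSig ℕ) : diffFv (L.total e) = ∅ := by
  induction e with
  | var x => rfl
  | const c => rfl
  | add s t hs ht =>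
    change diffFv (L.total s) ∪ diffFv (L.total t) = ∅
    rw [hs, ht]; rfl
  | mul s t hs ht =>
    change (diffFv (L.total s) ∪ diffFv t.lift) ∪ (diffFv s.lift ∪ diffFv (L.total t)) = ∅
    rw [hs, ht, Tm.diffFv_lift, Tm.diffFv_lift]; rfl
  | app k args ih =>
    refine diffFv_sum fun t ht => ?_
    obtain ⟨i, rfl⟩ := (List.mem_ofFn' _ _).1 ht
    change diffFv ((L.pd k i).bind args).lift ∪ diffFv (L.total (args i)) = ∅
    rw [Tm.diffFv_lift, ih i]; rfl

theorem substDer_lift (l : List (ℕ × Tm L.toSig ℕ)) (t : Tm L.toSig ℕ) :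
    substDer l t.lift = t.lift := by
  induction l with
  | nil => rfl
  | cons p l ih =>
    change (substDer l t.lift).bind _ = _
    rw [ih, Tm.lift_subst_der]

theorem substDer_const (l : List (ℕ × Tm L.toSig ℕ)) (c : ℚ) :
    substDer l (.const c) = .const c := substDer_lift l (.const c)

theorem substDer_add (l : List (ℕ × Tm L.toSig ℕ)) (s t : DTm L.toSig) :
    substDer l (.add s t) = .add (substDer l s) (substDer l t) := by
  induction l with
  | nil => rfl
  | cons p l ih =>
    change (substDer l (.add s t)).bind _ = _
    rw [ih]; rfl

theorem substDer_mul (l : List (ℕ × Tm L.toSig ℕ)) (s t : DTm L.toSig) :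
    substDer l (.mul s t) = .mul (substDer l s) (substDer l t) := by
  induction l with
  | nil => rfl
  | cons p l ih =>
    change (substDer l (.mul s t)).bind _ = _
    rw [ih]; rfl

theorem substDer_sum (l : List (ℕ × Tm L.toSig ℕ)) (ts : List (DTm L.toSig)) :
    substDer l (Tm.sum ts) = Tm.sum (ts.map (substDer l)) := by
  induction ts with
  | nil => exact substDer_const l 0
  | cons t ts ih =>
    change substDer l (.add t (Tm.sum ts)) = _
    rw [substDer_add, ih]; rfl

theorem substDer_var_of_notMem {l : List (ℕ × Tm L.toSig ℕ)} {x : ℕ}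
    (h : x ∉ l.map Prod.fst) :
    substDer l (.var (.var (.der x))) = .var (.var (.der x)) := by
  induction l with
  | nil => rfl
  | cons p l ih =>
    simp only [List.map_cons, List.mem_cons, not_or] at h
    change (substDer l _).bind _ = _
    rw [ih h.2]
    simp [Tm.bind, DVar.subst, h.1]

theorem substDer_var_of_mem {l : List (ℕ × Tm L.toSig ℕ)} (hl : (l.map Prod.fst).Nodup)
    {p : ℕ × Tm L.toSig ℕ} (h : p ∈ l) :
    substDer l (.var (.var (.der p.1))) = p.2.lift := by
  induction l with
  | nil => simp at h
  | cons q l ih =>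
    simp only [List.map_cons, List.nodup_cons] at hl
    change (substDer l _).bind _ = _
    rcases List.mem_cons.1 h with rfl | h
    · rw [substDer_var_of_notMem hl.1]
      simp [Tm.bind, DVar.subst]
    · rw [ih hl.2 h, Tm.lift_subst_der]

end DTm

theorem ODE.lookup_of_mem {S : Sig} {l : List (ℕ × Tm S ℕ)} (hl : (l.map Prod.fst).Nodup)
    {p : ℕ × Tm S ℕ} (h : p ∈ l) : l.lookup p.1 = some p.2 := by
  induction l with
  | nil => simp at h
  | cons q l ih =>
    rw [List.map_cons, List.nodup_cons] at hl
    rcases List.mem_cons.1 h with rfl | h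
    · exact List.lookup_cons_self
    · have hne : p.1 ≠ q.1 := fun he => hl.1 (he ▸ List.mem_map_of_mem (f := Prod.fst) h)
      have hb : (p.1 == q.1) = false := by simpa using hne
      rw [List.lookup_cons, hb]
      exact ih hl.2 h

theorem ODE.rhs_of_mem {S : Sig} {o : ODE S} {p : ℕ × Tm S ℕ} (h : p ∈ o.eqs) :
    o.rhs p.1 = p.2 := by
  rw [rhs, lookup_of_mem o.nodup h]
  rfl

/-- The assignments of differential effect replace `x'` only for variables with an equation; the
`x'` of parameters survive in the expanded differential and must be `0`, in agreement with `rhs`. -/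
theorem polyEval_substDer_total (o : ODE L.toSig) (e : Tm L.toSig ℕ) {ω : ℕ → ℝ}
    {a : DTm L.toSig → ℝ} (h : ∀ x ∈ e.fv, x ∉ o.vars → a (.var (.var (.der x))) = 0) :
    DTm.polyEval ω a (DTm.substDer o.eqs (L.total e)) = tval a ω (L.lie o e) := by
  induction e with
  | var x =>
    by_cases hx : x ∈ o.vars
    · obtain ⟨p, hp, rfl⟩ := ODE.mem_vars.1 hx
      rw [TermLang.total, TermLang.lie, DTm.substDer_var_of_mem o.nodup hp, ODE.rhs_of_mem hp]
      rfl
    · rw [TermLang.total, TermLang.lie, DTm.substDer_var_of_notMem hx, ODE.rhs_of_notMem hx]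
      exact (h x (by simp [Tm.fv, Tm.collect]) hx).trans (by simp [tval_const])
  | const c => rw [TermLang.total, DTm.substDer_const]; rfl
  | add s t hs ht =>
    simp only [Tm.fv, Tm.collect, Finset.mem_union] at h hs ht
    rw [TermLang.total, DTm.substDer_add, TermLang.lie, tval_add,
      ← hs fun x hx => h x (.inl hx), ← ht fun x hx => h x (.inr hx)]
    rfl
  | mul s t hs ht =>
    simp only [Tm.fv, Tm.collect, Finset.mem_union] at h hs ht
    rw [TermLang.total, DTm.substDer_add, DTm.substDer_mul, DTm.substDer_mul,
      DTm.substDer_lift, DTm.substDer_lift, TermLang.lie, tval_add, tval_mul, tval_mul,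
      ← hs fun x hx => h x (.inl hx), ← ht fun x hx => h x (.inr hx)]
    rfl
  | app k args ih =>
    simp only [Tm.fv, Tm.collect, Finset.mem_biUnion, Finset.mem_univ, true_and] at h ih
    rw [TermLang.total, DTm.substDer_sum, polyEval_sum, TermLang.lie, tval_sum, List.map_ofFn,
      List.map_ofFn, List.map_ofFn]
    congr 2
    funext i
    simp only [Function.comp, DTm.substDer_mul, DTm.substDer_lift, tval_mul]
    rw [← ih i fun x hx => h x ⟨i, hx⟩]
    rfl

namespace Deriv

theorem box_congr {α : Prog L.toSig} (h : Deriv L A [] (iff φ ψ)) :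
    Deriv L A Γ (iff (box α φ) (box α ψ)) :=
  iffI (.impR (box_mono (andL h) head)) (.impR (box_mono (andR h) head))

theorem iff_trans (h : Deriv L A Γ (iff φ ψ)) (h' : Deriv L A Γ (iff ψ χ)) :
    Deriv L A Γ (iff φ χ) :=
  taut₂ h h' fun v hv a b => by rw [hv.iff] at *; exact a.trans b

/-- The innermost assignment is substituted first, which is the order of `substDer`. Each
substitution is admissible because no unexpanded differential `(d)'` remains. -/
theorem assigns_cmp (l : List (ℕ × Tm L.toSig ℕ)) (c : Cmp) {s t : DTm L.toSig}
    (hs : DTm.diffFv s = ∅) (ht : DTm.diffFv t = ∅) :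
    Deriv L A Γ (iff (assigns (l.map fun p => (Var.der p.1, p.2)) (.cmp c s t))
      (.cmp c (DTm.substDer l s) (DTm.substDer l t))) := by
  induction l generalizing Γ with
  | nil => exact taut fun v hv => by rw [hv.iff]; rfl
  | cons p l ih =>
    refine iff_trans (box_congr ih) (.assignb (.der p.1) p.2 (.inr ?_))
    simp [Adm, DTm.diffFv_substDer, hs, ht]

theorem assigns_of (l : List (Var × Tm L.toSig ℕ)) (h : Deriv L A [] φ) :
    Deriv L A Γ (assigns l φ) := by
  induction l generalizing Γ with
  | nil => exact of_nil h
  | cons p l ih => exact .G _ ih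

theorem assigns_K (l : List (Var × Tm L.toSig ℕ)) :
    Deriv L A Γ (imp (assigns l (imp φ ψ)) (imp (assigns l φ) (assigns l ψ))) := by
  induction l generalizing Γ with
  | nil => exact taut fun v hv => (hv.imp _ _).2 id
  | cons p l ih => exact .impR (.impR (box_mono₂ ih head.wk head))

theorem assigns_mono (l : List (Var × Tm L.toSig ℕ)) (h : Deriv L A [] (imp φ ψ))
    (h' : Deriv L A Γ (assigns l φ)) : Deriv L A Γ (assigns l ψ) :=
  mp (mp (assigns_K l) (assigns_of l h)) h'

/-- The formula `z' = 0` for all parameters `z`. -/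
def constParams (zs : List ℕ) : Fml L.toSig :=
  zs.foldr (fun z φ => .and (.cmp .eq (.var (.var (.der z))) (.const 0)) φ) SA.tt.toFml

theorem assigns_constParams (zs : List ℕ) :
    Deriv L A Γ (assigns (zs.map fun z => (Var.der z, Tm.const 0)) (constParams zs)) := by
  -- The induction runs over the conjuncts `us` only, with the list of assignments kept fixed.
  have key : ∀ us : List ℕ, us ⊆ zs →
      Deriv L A Γ (assigns (zs.map fun z => (Var.der z, Tm.const 0)) (constParams us)) := by
    intro us hus
    induction us with
    | nil => exact assigns_of _ (real_of_sat fun a ω => (sat_tt a ω).2 trivial)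
    | cons u us ih =>
      have hu : u ∈ zs := hus (by simp)
      have h₁ := assigns_cmp (A := A) (Γ := Γ) (zs.map fun z => (z, Tm.const 0)) .eq
        (s := (.var (.var (.der u)) : DTm L.toSig)) (t := .const 0) rfl rfl
      rw [List.map_map] at h₁
      have h₂ : DTm.substDer (zs.map fun z => (z, Tm.const 0))
          (.var (.var (.der u)) : DTm L.toSig) = .const 0 := by
        clear h₁ ih hus
        induction zs with
        | nil => simp at hu
        | cons z zs ih =>
          change (DTm.substDer (zs.map fun z => (z, Tm.const 0)) _).bind _ = _
          by_cases h : u ∈ zs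
          · rw [ih h]; rfl
          · rw [DTm.substDer_var_of_notMem (by simpa using h)]
            obtain rfl : u = z := by simpa [h] using hu
            simp [Tm.bind, DVar.subst, Tm.lift, Tm.map]
      rw [h₂, DTm.substDer_const] at h₁
      have h₃ := mpr_iff h₁ (of_nil (.real (by simp [IsArith]) (by simp [ArithHolds, Cmp.Holds])))
      exact mp (mp (assigns_K _) (assigns_mono _ (taut fun v hv => by
        simp only [hv.imp, constParams, List.foldr, hv.and]; tauto) h₃))
        (ih fun x hx => hus (by simp [hx]))
  exact key zs (List.Subset.refl _)

theorem constParams_arith {zs : List ℕ} {a : DTm L.toSig → ℝ} {ω : ℕ → ℝ} :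
    (constParams zs).ArithHolds a ω ↔ ∀ z ∈ zs, a (.var (.var (.der z))) = 0 := by
  induction zs with
  | nil =>
    have h : ArithHolds a ω SA.tt.toFml := (sat_tt a ω).2 trivial
    simpa [constParams] using h
  | cons z zs ih =>
    simp only [List.forall_mem_cons, ← ih]
    simp [constParams, ArithHolds, Cmp.Holds, DTm.polyEval]

theorem constParams_isArith (zs : List ℕ) : (constParams (L := L) zs).IsArith ∅ := by
  induction zs with
  | nil => exact SA.isArith _
  | cons z zs ih => exact ⟨by simp [IsArith], ih⟩

theorem constParams_fv {zs : List ℕ} {v : Var} (h : v ∈ (constParams (L := L) zs).fv) :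
    ∃ z ∈ zs, v = .der z := by
  induction zs with
  | nil => simp [constParams, SA.fv_toFml, SA.tt, SA.fv, Tm.fv, Tm.collect] at h
  | cons z zs ih =>
    simp only [constParams, List.foldr, Fml.fv, DTm.fv, Tm.collect, DVar.fv, Finset.mem_union,
      Finset.mem_singleton, Finset.notMem_empty, or_false] at h
    rcases h with h | h
    · exact ⟨z, by simp, h⟩
    · obtain ⟨u, hu, hu'⟩ := ih h
      exact ⟨u, by simp [hu], hu'⟩

/-- Differential invariants `r ≥ 0`, with the Lie derivative in place of the differential. -/
theorem box_gez_of_lie {o : ODE L.toSig} {R : SA L.toSig} {r : Tm L.toSig ℕ}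
    (h : Deriv L A [] (imp R.toFml (SA.gez (L.lie o r)).toFml))
    (hr : Deriv L A Γ (SA.gez r).toFml) : Deriv L A Γ (box (ode o R) (SA.gez r).toFml) := by
  -- The parameters of `r`: differential effect says nothing about their differential variables, so
  -- these are set to `0` before the run and stay `0`, not being bound by the system.
  set zs := (r.fv.filter (· ∉ o.vars)).toList with hzs
  have hz : ∀ z, z ∈ zs ↔ z ∈ r.fv ∧ z ∉ o.vars := fun z => by simp [hzs]
  set ze : List (Var × Tm L.toSig ℕ) := zs.map fun z => (Var.der z, Tm.const 0) with hze
  have h₁ : Deriv L A [] (imp (constParams zs) (imp R.toFml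
      (.cmp .ge (DTm.substDer o.eqs (L.total r)) (.const 0)))) := by
    refine .impR (.impR (.cut (mp (of_nil h) head) (.weaken (Γ := [(SA.gez (L.lie o r)).toFml,
      constParams zs]) (by simp) (.real ?_ ?_))))
    · intro χ hχ
      simp only [List.mem_cons, List.not_mem_nil, or_false] at hχ
      rcases hχ with rfl | rfl | rfl
      · simp [IsArith]
      · exact SA.isArith _
      · exact constParams_isArith zs
    · intro a ω hH
      have h₁ : (SA.gez (L.lie o r)).Sat a ω := hH _ (by simp)
      have h₂ := constParams_arith.1 (hH (constParams zs) (by simp))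
      rw [sat_gez] at h₁
      simp only [ArithHolds, Cmp.Holds]
      rw [polyEval_substDer_total o r fun x hx hx' => h₂ x ((hz x).2 ⟨hx, hx'⟩)]
      simpa [DTm.polyEval] using h₁
  have h₂ : Deriv L A [] (imp (constParams zs) (box (ode o R) (.cmp .ge r.diff (.const 0)))) := by
    refine .impR (mpr_iff (.DE o R _) (box_mono₂ (φ := constParams zs) (ψ := R.toFml) ?_ ?_ ?_))
    · refine .impR (.impR ?_)
      have h₃ := mp (mp (of_nil (Γ := [R.toFml, constParams zs]) h₁) head.wk) head
      have h₄ := mpr_iff (assigns_cmp o.eqs .ge (DTm.diffFv_total r) rfl)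
        (by rw [DTm.substDer_const]; exact h₃)
      refine assigns_mono _ ?_ h₄
      refine .impR (.cut (diff_eq_total r) (.real ?_ ?_))
      · simp [IsArith]
      · simp [ArithHolds, Cmp.Holds]
        intro a ω hd ht
        rw [hd]; exact ht
    · refine box_const (fun v hv => ?_) head
      obtain ⟨z, hz', rfl⟩ := constParams_fv hv
      simp [Prog.bv, ((hz z).1 hz').2]
    · exact .DW o R
  have h₃ := mp (.DIge o R r zs fun x hx => or_iff_not_imp_left.2 fun h => (hz x).2 ⟨hx, h⟩)
    (assigns_mono (Γ := Γ) ze h₂ (assigns_constParams zs))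
  exact mpr_iff h₃ (taut₁ hr fun v hv a => by rw [hv.imp]; exact fun _ => a)

end Deriv
end Differential

/-! ## Local progress -/

section Progress
variable {L : TermLang} {A : Set ExtAx} {Γ Δ : List (Fml L.toSig)}
  {φ ψ χ θ : Fml L.toSig}

/-- This makes vector equations chain by transitivity of list equality. The lengths must agree
because `zipWith` truncates. -/
theorem sat_eqVec_iff_map (a : DTm L.toSig → ℝ) (ω : ℕ → ℝ) {xs ys : List ℕ}
    (hl : ys.length = xs.length) :
    (SA.eqVec xs ys : SA L.toSig).Sat a ω ↔ xs.map ω = ys.map ω := by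
  induction xs generalizing ys with
  | nil =>
    obtain rfl : ys = [] := by simpa using hl
    simp [sat_eqVec]
  | cons x xs ih =>
    cases ys with
    | nil => simp at hl
    | cons y ys =>
      rw [SA.eqVec_cons, sat_and, ih (by simpa using hl), List.map_cons, List.map_cons,
        List.cons.injEq]
      rfl

theorem exists_freshVec (n : ℕ) (U : Finset ℕ) :
    ∃ ys : List ℕ, ys.length = n ∧ ys.Nodup ∧ ∀ y ∈ ys, y ∉ U := by
  refine ⟨(List.range n).map (· + (U.sup id + 1)), by simp, ?_, ?_⟩
  · exact List.nodup_range.map (add_left_injective _)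
  · intro y hy hU
    obtain ⟨i, -, rfl⟩ := List.mem_map.1 hy
    have := Finset.le_sup (f := id) hU
    simp only [id] at this
    omega

/-- The index of a variable or differential variable. -/
def Var.idx : Var → ℕ
  | val n => n
  | der n => n

/-- The indices of the free variables of a formula. -/
def Fml.indices {S : Sig} (φ : Fml S) : Finset ℕ := φ.fv.image Var.idx

theorem Fml.val_notMem_of_notMem_indices {S : Sig} {φ : Fml S} {x : ℕ} (h : x ∉ φ.indices) :
    Var.val x ∉ φ.fv := fun hx => h (Finset.mem_image.2 ⟨_, hx, rfl⟩)

theorem SA.notMem_bv {S : Sig} {P : SA S} {o : ODE S} {Q : SA S}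
    (h : ∀ x ∈ P.fv, x ∉ o.vars) : ∀ v ∈ P.toFml.fv, v ∉ (ode o Q).bv := by
  intro v hv
  rw [SA.fv_toFml] at hv
  obtain ⟨x, hx, rfl⟩ := Finset.mem_image.1 hv
  simp [Prog.bv, h x hx]

/-! ### Lie derivatives of polynomial terms -/

/-- Powers of a term. -/
def Tm.pow {S : Sig} {V : Type} (t : Tm S V) : ℕ → Tm S V
  | 0 => .const 1
  | n + 1 => .mul t (t.pow n)

/-- The squared distance of two vectors of variables. -/
def sqDist {S : Sig} : List ℕ → List ℕ → Tm S ℕ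
  | x :: xs, y :: ys =>
    .add (.mul (.add (.var x) (Tm.neg (.var y))) (.add (.var x) (Tm.neg (.var y)))) (sqDist xs ys)
  | _, _ => .const 0

section Lie
variable (a : DTm L.toSig → ℝ) (ω : ℕ → ℝ) (o : ODE L.toSig)

theorem tval_lie_const (c : ℚ) : tval a ω (L.lie o (.const c)) = 0 := by
  simp [TermLang.lie, tval_const]

theorem tval_lie_add (s t : Tm L.toSig ℕ) :
    tval a ω (L.lie o (.add s t)) = tval a ω (L.lie o s) + tval a ω (L.lie o t) := rfl

theorem tval_lie_mul (s t : Tm L.toSig ℕ) :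
    tval a ω (L.lie o (.mul s t)) =
      tval a ω (L.lie o s) * tval a ω t + tval a ω s * tval a ω (L.lie o t) := rfl

theorem tval_lie_neg (t : Tm L.toSig ℕ) :
    tval a ω (L.lie o t.neg) = -tval a ω (L.lie o t) := by
  simp [Tm.neg, tval_lie_mul, tval_lie_const, tval_const]

theorem tval_lie_sum (l : List (Tm L.toSig ℕ)) :
    tval a ω (L.lie o (Tm.sum l)) = (l.map fun t => tval a ω (L.lie o t)).sum := by
  induction l with
  | nil => exact tval_lie_const a ω o 0
  | cons t l ih => rw [List.map_cons, List.sum_cons, ← ih]; rfl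

theorem tval_pow (t : Tm L.toSig ℕ) (n : ℕ) : tval a ω (t.pow n) = tval a ω t ^ n := by
  induction n with
  | zero => simp [Tm.pow, tval_const]
  | succ n ih => rw [Tm.pow, tval_mul, ih, pow_succ']

theorem tval_lie_pow (t : Tm L.toSig ℕ) (n : ℕ) : tval a ω (L.lie o (t.pow (n + 1))) =
    (n + 1) * tval a ω t ^ n * tval a ω (L.lie o t) := by
  induction n with
  | zero => simp [Tm.pow, tval_lie_mul, tval_const, tval_lie_const]
  | succ n ih =>
    rw [Tm.pow, tval_lie_mul, ih, tval_pow]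
    push_cast
    ring

theorem sqDist_nonneg (xs ys : List ℕ) : 0 ≤ tval (L := L) a ω (sqDist xs ys) := by
  induction xs generalizing ys with
  | nil => simp [sqDist, tval_const]
  | cons x xs ih =>
    cases ys with
    | nil => simp [sqDist, tval_const]
    | cons y ys =>
      rw [sqDist, tval_add, tval_mul]
      exact add_nonneg (mul_self_nonneg _) (ih ys)

theorem sat_eqVec_of_sqDist {xs ys : List ℕ} (h : tval (L := L) a ω (sqDist xs ys) = 0) :
    (SA.eqVec xs ys : SA L.toSig).Sat a ω := by
  induction xs generalizing ys with
  | nil => simp [sat_eqVec]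
  | cons x xs ih =>
    cases ys with
    | nil => simp [sat_eqVec]
    | cons y ys =>
      rw [sqDist, tval_add, tval_mul, tval_add, tval_neg, tval_var, tval_var] at h
      have h₁ := mul_self_nonneg (ω x + -ω y)
      have h₂ := sqDist_nonneg (L := L) a ω xs ys
      refine ⟨?_, ih (by linarith)⟩
      have h₃ : (ω x + -ω y) * (ω x + -ω y) = 0 := by linarith
      have h₄ := mul_self_eq_zero.1 h₃
      change ω x = ω y
      linarith

/-- Every summand is a square, so its derivative retains a factor `xᵢ - yᵢ`; the rates of `x` and
`y` are irrelevant. -/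
theorem lie_sqDist {xs ys : List ℕ} (h : (SA.eqVec xs ys : SA L.toSig).Sat a ω) :
    tval a ω (sqDist xs ys : Tm L.toSig ℕ) = 0 ∧ tval a ω (L.lie o (sqDist xs ys)) = 0 := by
  induction xs generalizing ys with
  | nil => exact ⟨by simp [sqDist, tval_const], tval_lie_const a ω o 0⟩
  | cons x xs ih =>
    cases ys with
    | nil => exact ⟨by simp [sqDist, tval_const], tval_lie_const a ω o 0⟩
    | cons y ys =>
      have h₁ : ω x = ω y := h.1
      obtain ⟨h₂, h₃⟩ := ih h.2
      simp [sqDist, tval_add, tval_lie_add, h₂, h₃, tval_mul, tval_lie_mul, tval_neg, tval_var, h₁]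

end Lie

/-- `x ≠ y` is reachable along the system within the domain `R`; from `x = y`, this expresses local
progress. -/
def lp (o : ODE L.toSig) (ys : List ℕ) (R : SA L.toSig) : Fml L.toSig :=
  dia (ode o R) (.not (SA.eqVec o.vars ys).toFml)

/-- A system without fixpoints and with a clock `τ` that starts from `0` when `x = y`. -/
structure Clocked (L : TermLang) (A : Set ExtAx) (o : ODE L.toSig) (ys : List ℕ)
    (τ : Tm L.toSig ℕ) : Prop where
  cont : ExtAx.Cont ∈ A
  uniq : ExtAx.Uniq ∈ A
  fresh : Fresh ys o.vars o.fv
  noFix : Deriv L A [] (.not o.fixpoint.toFml)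
  lie_clock : ∀ a ω, tval a ω (L.lie o τ) = 1
  clock_start : ∀ a ω, (SA.eqVec o.vars ys : SA L.toSig).Sat a ω → tval a ω τ = 0

namespace Clocked
variable {o : ODE L.toSig} {ys : List ℕ} {τ : Tm L.toSig ℕ} {P Q R : SA L.toSig}
  {e : Tm L.toSig ℕ}

theorem _root_.DL.Fresh.notMem_vars {o : ODE L.toSig} {ys : List ℕ} {U : Finset ℕ}
    (h : Fresh ys o.vars U) (hU : o.fv ⊆ U) : ∀ y ∈ ys, y ∉ o.vars := fun y hy hv =>
  h.fresh y hy (hU (ODE.mem_fv_of_mem_vars hv))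

theorem lp_mono (h : ∀ a ω, P.Sat a ω → Q.Sat a ω) (h' : Deriv L A Γ (lp o ys P)) :
    Deriv L A Γ (lp o ys Q) := Deriv.dia_dom_mono h h'

theorem lp_mono_of_imp (h : Deriv L A [] (imp P.toFml Q.toFml)) (h' : Deriv L A Γ (lp o ys P)) :
    Deriv L A Γ (lp o ys Q) := Deriv.dia_dom (.G _ h) h'

/-- By uniqueness of solutions, two runs from one state share an initial segment, on which both
domains hold. -/
theorem lp_and (hu : ExtAx.Uniq ∈ A) (h : Deriv L A Γ (lp o ys P)) (h' : Deriv L A Γ (lp o ys Q)) :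
    Deriv L A Γ (lp o ys (P.and Q)) := Deriv.mpr_iff (.Uniq o P Q _ hu) (.andI h h')

/-- A differential invariant proves `r ≥ 0` throughout the domain, and a differential cut moves it
into the domain. This is the only way in which progress is integrated. -/
theorem lp_gez_of_lie {r : Tm L.toSig ℕ}
    (h : Deriv L A [] (imp P.toFml (SA.gez (L.lie o r)).toFml))
    (hr : Deriv L A Γ (SA.gez r).toFml) (h' : Deriv L A Γ (lp o ys P)) :
    Deriv L A Γ (lp o ys (P.and (SA.gez r))) := by
  set N : Fml L.toSig := .not (SA.eqVec o.vars ys).toFml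
  refine .taut₃ (.mp_iff (.diamond _ N) h') (.diamond (ode o (P.and (SA.gez r))) N)
    (.mp (.DC o P (SA.gez r) (.not N)) (.box_gez_of_lie h hr)) fun v hv a b c => ?_
  rw [hv.not] at a
  rw [hv.iff] at c
  change v (dia (ode o (P.and (SA.gez r))) _)
  rw [hv.iff, hv.not] at b
  exact b.2 fun d => a (c.2 d)

/-- Continuity, without freshness requirements on the term. -/
theorem lp_gtz (h : Clocked L A o ys τ) (hE : Deriv L A Γ (SA.eqVec o.vars ys).toFml)
    (he : Deriv L A Γ (SA.gtz e).toFml) : Deriv L A Γ (lp o ys (SA.gtz e)) := by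
  suffices H : Deriv L A [] (imp (SA.eqVec o.vars ys).toFml
      (imp (SA.gtz e).toFml (lp o ys (SA.gtz e)))) from .mp (.mp (.of_nil H) hE) he
  -- The terms of interest mention `ys`, which Cont forbids. It is applied with a second copy `zs`
  -- of `ys`; the constant equation `ys = zs` then translates the postcondition back.
  obtain ⟨zs, hl, hn, hf⟩ := exists_freshVec o.vars.length (o.fv ∪ e.fv ∪ ys.toFinset ∪
    (imp (SA.eqVec o.vars ys).toFml (imp (SA.gtz e).toFml (lp o ys (SA.gtz e)))).indices)
  simp only [Finset.mem_union, not_or, List.mem_toFinset] at hf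
  have hyl := h.fresh.length_eq
  refine .fresh_copy (xs := ys) (ys := zs) (by rw [hl, h.fresh.length_eq]) hn
    (fun z hz => (hf z hz).1.2) (by simp)
    (fun z hz => val_notMem_of_notMem_indices (hf z hz).2) (.impR (.impR (.impR ?_)))
  have h₁ : Deriv L A [(SA.gtz e).toFml, (SA.eqVec o.vars ys).toFml,
      (SA.eqVec ys zs).toFml] (SA.eqVec o.vars zs).toFml :=
    .real₂ (.hyp (φ := (SA.eqVec o.vars ys).toFml) (by simp))
      (.hyp (φ := (SA.eqVec ys zs).toFml) (by simp)) fun a ω p q => by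
        rw [sat_eqVec_iff_map a ω hyl] at p
        rw [sat_eqVec_iff_map a ω (by omega)] at q
        rw [sat_eqVec_iff_map a ω hl]
        exact p.trans q
  have h₂ := Deriv.mpr_iff (.mp (.Cont o e zs h.cont ⟨hl, hn, fun z hz => by
    simpa using (hf z hz).1.1⟩ h.noFix) h₁) .head
  refine .dia_box (ψ := (SA.eqVec ys zs).toFml) ?_ h₂ (.box_const ?_ (.hyp (by simp)))
  · refine .real_imp₂ (P := .not (SA.eqVec o.vars zs)) (R := .not (SA.eqVec o.vars ys))
      fun a ω p q => ?_
    rw [sat_not, sat_eqVec_iff_map a ω hl] at p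
    rw [sat_not, sat_eqVec_iff_map a ω hyl]
    rw [sat_eqVec_iff_map a ω (by omega)] at q
    exact fun r => p (r.trans q)
  · refine SA.notMem_bv fun x hx => ?_
    rcases SA.mem_fv_eqVec hx with hx | hx
    · exact h.fresh.notMem_vars (Finset.Subset.refl _) x hx
    · exact fun hv => (hf x hx).1.1.1 (ODE.mem_fv_of_mem_vars hv)

variable (h : Clocked L A o ys τ) (hE : Deriv L A Γ (SA.eqVec o.vars ys).toFml)
include h hE

/-- At `x = y` the clock has rate `1` and the squared distance has rate `0`. By continuity their
difference keeps a positive rate for a while, and it starts from `0`. -/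
theorem lp_sqDist :
    Deriv L A Γ (lp o ys (SA.gez (.add τ (Tm.neg (sqDist o.vars ys))))) := by
  have h₁ : Deriv L A Γ (lp o ys (SA.gtz (L.lie o (.add τ (Tm.neg (sqDist o.vars ys)))))) := by
    refine h.lp_gtz hE (.real₁ hE fun a ω p => ?_)
    rw [sat_gtz, tval_lie_add, tval_lie_neg, h.lie_clock, (lie_sqDist a ω o p).2]
    norm_num
  refine lp_mono (fun a ω p => ((sat_and a ω _ _).1 p).2) (lp_gez_of_lie ?_ ?_ h₁)
  · exact .real_imp fun a ω p => (sat_gez a ω _).2 ((sat_gtz a ω _).1 p).le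
  · refine .real₁ hE fun a ω p => ?_
    rw [sat_gez, tval_add, tval_neg, h.clock_start a ω p, (lie_sqDist a ω o p).1]
    norm_num

/-- A Taylor lower bound obtained by integrating one derivative at a time: a bound for the Lie
derivative of `e` becomes one for `e`, because `e` vanishes at the start. The positive exponent
makes the clock term vanish there too. -/
theorem lp_ge_pow (s : ℚ) (k : ℕ) (e : Tm L.toSig ℕ)
    (hz : ∀ j < k, Deriv L A Γ (SA.eqz (L.lieIter o j e)).toFml)
    (hp : Deriv L A Γ (SA.gtz (.mul (.const s) (L.lieIter o k e))).toFml) :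
    ∃ c : ℚ, 0 < c ∧ ∃ m : ℕ, Deriv L A Γ (lp o ys
      (SA.gez (.add (.mul (.const s) e) (.mul (.const (-c)) (τ.pow (m + 1)))))) := by
  induction k generalizing e with
  | zero =>
    refine ⟨1, one_pos, 0, lp_mono (fun a ω p => ?_) (h.lp_gtz
      (e := .add (.mul (.const s) e) (.mul (.const (-1)) (τ.pow (0 + 1)))) hE
      (.real₂ hE hp fun a ω p q => ?_))⟩
    · exact (sat_gez a ω _).2 ((sat_gtz a ω _).1 p).le
    · rw [sat_gtz] at q ⊢
      change 0 < tval a ω (.mul (.const s) e) at q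
      rw [tval_add, tval_mul (t := τ.pow _), tval_pow, h.clock_start a ω p]
      simpa using q
  | succ k ih =>
    obtain ⟨c, hc, m, H⟩ := ih (L.lie o e) (fun j hj => hz (j + 1) (by omega)) hp
    -- The rate of `τ^(m+2)` is `(m+2) τ^(m+1)`, which dictates the new constant.
    refine ⟨c / (m + 2), by positivity, m + 1, lp_mono (fun a ω p => ((sat_and a ω _ _).1 p).2)
      (lp_gez_of_lie ?_ (.real₂ hE (hz 0 (by omega)) fun a ω p q => ?_) H)⟩
    · refine .real_imp fun a ω p => ?_
      rw [sat_gez, tval_add, tval_mul, tval_mul, tval_pow, tval_const, tval_const] at p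
      rw [sat_gez, tval_lie_add, tval_lie_mul, tval_lie_mul, tval_lie_const, tval_lie_const,
        tval_lie_pow, h.lie_clock, tval_const, tval_const]
      have hm : (m : ℝ) + 2 ≠ 0 := by positivity
      refine p.trans (le_of_eq ?_)
      push_cast
      field_simp
      ring
    · rw [sat_eqz] at q
      change tval a ω e = 0 at q
      rw [sat_gez, tval_add, tval_mul, tval_mul, tval_pow, h.clock_start a ω p, q]
      simp

/-- Local progress of `s * e > 0` for a sign `s`, from the first nonzero Lie derivative. -/
theorem lp_of_first_nonzero (s : ℚ) (k : ℕ) (e : Tm L.toSig ℕ)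
    (hz : Deriv L A Γ (L.lieZero o k e).toFml)
    (hp : Deriv L A Γ (SA.gtz (.mul (.const s) (L.lieIter o k e))).toFml) :
    Deriv L A Γ (lp o ys (.or (SA.gtz (.mul (.const s) e)) (SA.eqVec o.vars ys))) := by
  obtain ⟨c, hc, m, H⟩ := h.lp_ge_pow hE s k e (fun j hj => .real₁ hz fun a ω p =>
    (sat_conj a ω _).1 p _ (List.mem_map.2 ⟨j, List.mem_range.2 hj, rfl⟩)) hp
  refine lp_mono (fun a ω p => ?_) (lp_and h.uniq H (h.lp_sqDist hE))
  obtain ⟨p, q⟩ := (sat_and a ω _ _).1 p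
  rw [sat_gez, tval_add, tval_mul (t := τ.pow _), tval_pow, tval_const] at p
  rw [sat_gez, tval_add, tval_neg] at q
  rw [sat_or, sat_gtz]
  have h₁ := sqDist_nonneg (L := L) a ω o.vars ys
  -- Either the state is still `y`, or `τ ≥ |x - y|² > 0`, and then `c τ^(m+1)` is a positive lower
  -- bound.
  rcases h₁.eq_or_lt with h₁ | h₁
  · exact .inr (sat_eqVec_of_sqDist a ω h₁.symm)
  · left
    have hτ : 0 < tval a ω τ := by linarith
    have hc' : (0 : ℝ) < c := by exact_mod_cast hc
    have := mul_pos hc' (pow_pos hτ (m + 1))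
    push_cast at p
    linarith

omit h hE in
theorem _root_.DL.list_sum_range (f : ℕ → ℝ) (n : ℕ) :
    ((List.range n).map f).sum = ∑ i ∈ Finset.range n, f i := by
  induction n with
  | zero => simp
  | succ n ih => rw [List.range_succ, Finset.sum_range_succ, List.map_append, List.sum_append, ih]; simp

omit h hE in
-- By `2ab ≤ a² + b²` the left side is at most the sum of squares plus its shift. The shift trades
-- `D 0` for `D N`, and `D N` is bounded through the rank identity by Cauchy–Schwarz. The constant
-- `3` is not sharp: `2` would do.
theorem _root_.DL.lie_sumSq_le {N : ℕ} (D G : ℕ → ℝ) (hN : D N = ∑ i ∈ Finset.range N, G i * D i) :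
    ∑ i ∈ Finset.range N, (D (i + 1) * D i + D i * D (i + 1)) ≤
      (3 + ∑ i ∈ Finset.range N, G i * G i) * ∑ i ∈ Finset.range N, D i * D i := by
  have h₁ : ∑ i ∈ Finset.range N, (D (i + 1) * D i + D i * D (i + 1)) ≤
      ∑ i ∈ Finset.range N, D i * D i + ∑ i ∈ Finset.range N, D (i + 1) * D (i + 1) := by
    rw [← Finset.sum_add_distrib]
    exact Finset.sum_le_sum fun i _ => by nlinarith [mul_self_nonneg (D i - D (i + 1))]
  have h₂ := Finset.sum_range_succ (fun i => D i * D i) N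
  rw [Finset.sum_range_succ'] at h₂
  have h₃ : D N * D N ≤
      (∑ i ∈ Finset.range N, G i * G i) * ∑ i ∈ Finset.range N, D i * D i := by
    have := Finset.sum_mul_sq_le_sq_mul_sq (Finset.range N) G D
    rw [← hN] at this
    simpa [sq] using this
  have h₄ : 0 ≤ ∑ i ∈ Finset.range N, D i * D i := Finset.sum_nonneg fun i _ => mul_self_nonneg _
  nlinarith [mul_self_nonneg (D 0)]

/-- Local progress of `e = 0`, if all Lie derivatives below the rank vanish. -/
theorem lp_eqz {N : ℕ} {g : ℕ → Tm L.toSig ℕ} (e : Tm L.toSig ℕ) (hN : 1 ≤ N)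
    (hrank : Deriv L A [] (SA.cmp .eq (L.lieIter o N e)
      (Tm.sum ((List.range N).map fun i => .mul (g i) (L.lieIter o i e)))).toFml)
    (hz : Deriv L A Γ (L.lieZero o N e).toFml) : Deriv L A Γ (lp o ys (SA.eqz e)) := by
  set d : ℕ → Tm L.toSig ℕ := fun i => L.lieIter o i e with hd
  have hd' : ∀ i, L.lie o (d i) = d (i + 1) := fun i =>
    (Function.iterate_succ_apply' (L.lie o) i e).symm
  set p : Tm L.toSig ℕ := Tm.sum ((List.range N).map fun i => .mul (d i) (d i)) with hp
  set q : Tm L.toSig ℕ :=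
    .add (.const 3) (Tm.sum ((List.range N).map fun i => .mul (g i) (g i))) with hq
  -- A first-order replacement for the integrating factor of `p' ≤ q p`: at `τ = 0` it has value `1`
  -- and rate `-(q + 1)`, so `q w + w' = -1` there. By continuity `w > 0` and `q w + w' < 0` hold
  -- locally.
  set w : Tm L.toSig ℕ := .add (.const 1) (Tm.neg (.mul τ (.add q (.const 1)))) with hw
  have tp : ∀ a ω, tval a ω p = ∑ i ∈ Finset.range N, tval a ω (d i) * tval a ω (d i) := by
    intro a ω
    rw [hp, tval_sum, List.map_map, ← list_sum_range]
    rfl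
  have tq : ∀ a ω, tval a ω q =
      3 + ∑ i ∈ Finset.range N, tval a ω (g i) * tval a ω (g i) := by
    intro a ω
    rw [hq, tval_add, tval_sum, List.map_map, ← list_sum_range, tval_const]
    norm_num
    rfl
  have tlp : ∀ a ω, tval a ω (L.lie o p) = ∑ i ∈ Finset.range N,
      (tval a ω (d (i + 1)) * tval a ω (d i) + tval a ω (d i) * tval a ω (d (i + 1))) := by
    intro a ω
    rw [hp, tval_lie_sum, List.map_map, ← list_sum_range]
    congr 2
    funext i
    simp only [Function.comp, tval_lie_mul, hd']
  have h₁ : Deriv L A Γ (lp o ys (SA.gtz w)) := by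
    refine h.lp_gtz hE (.real₁ hE fun a ω x => ?_)
    rw [sat_gtz, hw, tval_add, tval_neg, tval_mul, h.clock_start a ω x, tval_const]
    norm_num
  have h₂ : Deriv L A Γ (lp o ys (SA.gtz (Tm.neg (.add (.mul q w) (L.lie o w))))) := by
    refine h.lp_gtz hE (.real₁ hE fun a ω x => ?_)
    have e₁ : tval a ω w = 1 := by
      rw [hw, tval_add, tval_neg, tval_mul, h.clock_start a ω x, tval_const]
      norm_num
    have e₂ : tval a ω (L.lie o w) = -(tval a ω q + 1) := by
      rw [hw, tval_lie_add, tval_lie_neg, tval_lie_mul, tval_lie_const, h.clock_start a ω x,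
        h.lie_clock, tval_add, tval_const]
      push_cast
      ring
    rw [sat_gtz, tval_neg, tval_add, tval_mul, e₁, e₂]
    linarith
  -- On this domain `(p w)' ≤ p (q w + w') ≤ 0`, and `p w = 0` initially. So `p w ≤ 0` persists;
  -- with `w > 0` and `p ≥ 0` this forces `p = 0`.
  have h₃ := lp_gez_of_lie (r := Tm.neg (.mul p w)) (.impR (.real₂ (.of_nil hrank) .head
    fun a ω r x => ?_)) (.real₁ hz fun a ω x => ?_) (lp_and h.uniq h₁ h₂)
  · refine lp_mono (fun a ω x => ?_) h₃
    rw [sat_and, sat_and, sat_gtz] at x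
    obtain ⟨⟨x, -⟩, y⟩ := x
    rw [sat_gez, tval_neg, tval_mul, tp] at y
    rw [sat_eqz]
    have hle : tval a ω (d 0) * tval a ω (d 0) ≤
        ∑ i ∈ Finset.range N, tval a ω (d i) * tval a ω (d i) :=
      Finset.single_le_sum (f := fun i => tval a ω (d i) * tval a ω (d i))
        (fun i _ => mul_self_nonneg _) (Finset.mem_range.2 hN)
    have h0 : tval a ω (d 0) * tval a ω (d 0) ≤ 0 := by
      by_contra hc
      have := mul_pos (lt_of_lt_of_le (not_le.1 hc) hle) x
      linarith
    exact mul_self_eq_zero.1 (le_antisymm h0 (mul_self_nonneg _))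
  · obtain ⟨x, y⟩ := (sat_and a ω _ _).1 x
    rw [sat_gtz] at x
    rw [sat_gtz, tval_neg, tval_add, tval_mul] at y
    rw [sat_cmp, tval_sum, List.map_map] at r
    have r' : tval a ω (d N) = ∑ i ∈ Finset.range N, tval a ω (g i) * tval a ω (d i) := by
      rw [← list_sum_range]
      exact r
    have h₄ := lie_sumSq_le (fun i => tval a ω (d i)) (fun i => tval a ω (g i)) r'
    rw [← tlp, ← tq, ← tp] at h₄
    have h₅ : 0 ≤ tval a ω p := by rw [tp]; exact Finset.sum_nonneg fun i _ => mul_self_nonneg _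
    rw [sat_gez, tval_lie_neg, tval_lie_mul]
    nlinarith [mul_le_mul_of_nonneg_right h₄ x.le]
  · have h₄ : tval a ω p = 0 := by
      rw [tp]
      refine Finset.sum_eq_zero fun i hi => ?_
      have := (sat_conj a ω _).1 x _
        (List.mem_map.2 ⟨i, List.mem_range.2 (Finset.mem_range.1 hi), rfl⟩)
      rw [sat_eqz] at this
      simp only [hd]
      rw [this, mul_zero]
    rw [sat_gez, tval_neg, tval_mul, h₄]
    simp

end Clocked
end Progress

/-! ## Progress formulas decide local progress -/

section Decides
variable {L : TermLang} {A : Set ExtAx} {Γ Δ : List (Fml L.toSig)}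
  {φ ψ χ θ : Fml L.toSig}

/-- `F` decides whether the system makes local progress in `R` or in `¬R`. -/
def Decides (L : TermLang) (A : Set ExtAx) (o : ODE L.toSig) (ys : List ℕ)
    (R F : SA L.toSig) : Prop :=
  Deriv L A [] (imp (SA.eqVec o.vars ys).toFml (imp F.toFml
    (lp o ys (.or R (SA.eqVec o.vars ys))))) ∧
  Deriv L A [] (imp (SA.eqVec o.vars ys).toFml (imp F.not.toFml
    (lp o ys (.or R.not (SA.eqVec o.vars ys)))))

namespace Decides
variable {o : ODE L.toSig} {ys : List ℕ} {τ : Tm L.toSig ℕ} {P Q R F G : SA L.toSig}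
  {e : Tm L.toSig ℕ}

theorem pos (h : Decides L A o ys R F) (hE : Deriv L A Γ (SA.eqVec o.vars ys).toFml)
    (hF : Deriv L A Γ F.toFml) : Deriv L A Γ (lp o ys (.or R (SA.eqVec o.vars ys))) :=
  .mp (.mp (.of_nil h.1) hE) hF

theorem neg (h : Decides L A o ys R F) (hE : Deriv L A Γ (SA.eqVec o.vars ys).toFml)
    (hF : Deriv L A Γ F.not.toFml) : Deriv L A Γ (lp o ys (.or R.not (SA.eqVec o.vars ys))) :=
  .mp (.mp (.of_nil h.2) hE) hF

theorem mk_of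
    (h : Deriv L A [F.toFml, (SA.eqVec o.vars ys).toFml]
      (lp o ys (.or R (SA.eqVec o.vars ys))))
    (h' : Deriv L A [F.not.toFml, (SA.eqVec o.vars ys).toFml]
      (lp o ys (.or R.not (SA.eqVec o.vars ys)))) : Decides L A o ys R F :=
  ⟨.impR (.impR h), .impR (.impR h')⟩

/-- The two halves of `Decides` change places; this symmetry is the reason for the two-sided
definition. -/
theorem not (h : Decides L A o ys R F) : Decides L A o ys R.not F.not := by
  refine mk_of (h.neg (.hyp (by simp)) .head) (Clocked.lp_mono ?_ (h.pos (.hyp (by simp))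
    (.real₁ .head ?_)))
  · simp only [sat_or, sat_not]; tauto
  · simp only [sat_not]; tauto

/-- Only the positive half needs uniqueness. In the negative half, one failing conjunct already
carries the progress. -/
theorem and (hu : ExtAx.Uniq ∈ A) (h : Decides L A o ys R F) (h' : Decides L A o ys P G) :
    Decides L A o ys (R.and P) (F.and G) := by
  refine mk_of (Clocked.lp_mono ?_ (Clocked.lp_and hu
    (h.pos (.hyp (by simp)) (.andL (ψ := G.toFml) .head))
    (h'.pos (.hyp (by simp)) (.andR (φ := F.toFml) .head)))) (.cases F.toFml ?_ ?_)
  · simp only [sat_or, sat_and]; tauto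
  · refine Clocked.lp_mono ?_ (h'.neg (.hyp (by simp))
      (.real₂ .head (.hyp (φ := (F.and G).not.toFml) (by simp)) ?_))
    · simp only [sat_or, sat_and, sat_not]; tauto
    · simp only [sat_and, sat_not]; tauto
  · refine Clocked.lp_mono ?_ (h.neg (.hyp (by simp)) (.hyp (φ := F.not.toFml) List.mem_cons_self))
    simp only [sat_or, sat_and, sat_not]; tauto

theorem congr (h : Decides L A o ys R F)
    (hP : Deriv L A [] (iff R.toFml P.toFml)) (hF : ∀ a ω, F.Sat a ω ↔ G.Sat a ω) :
    Decides L A o ys P G := by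
  refine mk_of (Clocked.lp_mono_of_imp ?_ (h.pos (.hyp (by simp)) (.real₁ .head ?_)))
    (Clocked.lp_mono_of_imp ?_ (h.neg (.hyp (by simp)) (.real₁ .head ?_)))
  · refine .taut₁ hP fun v hv a => ?_
    simp only [hv.imp, hv.iff, SA.toFml, hv.or] at *
    tauto
  · exact fun a ω => (hF a ω).2
  · refine .taut₁ hP fun v hv a => ?_
    simp only [hv.imp, hv.iff, SA.toFml, hv.or, hv.not] at *
    tauto
  · exact fun a ω p q => p ((hF a ω).1 q)

theorem congr_sat (h : Decides L A o ys R F)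
    (hP : ∀ a ω, R.Sat a ω ↔ P.Sat a ω) (hF : ∀ a ω, F.Sat a ω ↔ G.Sat a ω) :
    Decides L A o ys P G :=
  h.congr (.iffI (.real_imp fun a ω => (hP a ω).1) (.real_imp fun a ω => (hP a ω).2)) hF

theorem or (hu : ExtAx.Uniq ∈ A) (h : Decides L A o ys R F) (h' : Decides L A o ys P G) :
    Decides L A o ys (R.or P) (F.or G) := by
  refine ((h.not.and hu h'.not).not).congr_sat ?_ ?_
  · simp only [sat_or, sat_and, sat_not]; tauto
  · simp only [sat_or, sat_and, sat_not]; tauto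

/-- Continuity for `1 > 0`: a clocked system always leaves its initial state. -/
theorem tt (h : Clocked L A o ys τ) : Decides L A o ys .tt .tt := by
  refine mk_of (Clocked.lp_mono ?_ (h.lp_gtz (e := .const 1) (.hyp (by simp))
    (.real_of_sat fun a ω => ?_))) (.absurd (φ := SA.tt.toFml) (.real_of_sat fun a ω => ?_) .head)
  · simp only [sat_or, sat_tt]; tauto
  · rw [sat_gtz, tval_const]; norm_num
  · exact (sat_tt a ω).2 trivial

theorem conj (h : Clocked L A o ys τ) {ι : Type*} {f g : ι → SA L.toSig} {l : List ι}
    (hl : ∀ i ∈ l, Decides L A o ys (f i) (g i)) :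
    Decides L A o ys (SA.conj (l.map f)) (SA.conj (l.map g)) := by
  induction l with
  | nil => exact tt h
  | cons i l ih => exact (hl i (by simp)).and h.uniq (ih fun j hj => hl j (by simp [hj]))

theorem disj (h : Clocked L A o ys τ) {ι : Type*} {f g : ι → SA L.toSig} {l : List ι}
    (hl : ∀ i ∈ l, Decides L A o ys (f i) (g i)) :
    Decides L A o ys (SA.disj (l.map f)) (SA.disj (l.map g)) := by
  induction l with
  | nil => exact (tt h).not
  | cons i l ih => exact (hl i (by simp)).or h.uniq (ih fun j hj => hl j (by simp [hj]))

/-! ### Atomic comparisons and the sign of the first nonzero Lie derivative -/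

theorem sat_lieZero {a : DTm L.toSig → ℝ} {ω : ℕ → ℝ} {k : ℕ} :
    (L.lieZero o k e).Sat a ω ↔ ∀ i < k, tval a ω (L.lieIter o i e) = 0 := by
  simp [TermLang.lieZero, sat_conj, sat_eqz]

theorem sat_progGt {a : DTm L.toSig → ℝ} {ω : ℕ → ℝ} {N : ℕ} :
    (L.progGt o N e).Sat a ω ↔
      (∀ i < N - 1, (∀ j < i, tval a ω (L.lieIter o j e) = 0) → 0 ≤ tval a ω (L.lieIter o i e)) ∧
      ((∀ j < N - 1, tval a ω (L.lieIter o j e) = 0) → 0 < tval a ω (L.lieIter o (N - 1) e)) := by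
  simp [TermLang.progGt, sat_and, sat_conj, sat_imp, sat_gez, sat_gtz, sat_lieZero]

/-- The progress formula for `e > 0` says that the first nonzero Lie derivative is positive. -/
theorem progGt_iff {D : ℕ → ℝ} {N : ℕ} (hN : 1 ≤ N) :
    ((∀ i < N - 1, (∀ j < i, D j = 0) → 0 ≤ D i) ∧
      ((∀ j < N - 1, D j = 0) → 0 < D (N - 1))) ↔ ∃ k < N, (∀ j < k, D j = 0) ∧ 0 < D k := by
  classical
  constructor
  · rintro ⟨h, h'⟩
    by_cases hz : ∀ j < N - 1, D j = 0
    · exact ⟨N - 1, by omega, hz, h' hz⟩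
    · push Not at hz
      have hs := Nat.find_spec hz
      have hm : ∀ j < Nat.find hz, D j = 0 := fun j hj => by
        by_contra hc
        exact Nat.find_min hz hj ⟨by omega, hc⟩
      exact ⟨Nat.find hz, by omega, hm, lt_of_le_of_ne (h _ hs.1 hm) hs.2.symm⟩
  · rintro ⟨k, hk, hz, hp⟩
    refine ⟨fun i hi hzi => ?_, fun hzN => ?_⟩
    · rcases lt_trichotomy i k with h | rfl | h
      · rw [hz i h]
      · exact hp.le
      · exact absurd (hzi k h) hp.ne'
    · rcases Nat.lt_or_ge k (N - 1) with h | h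
      · exact absurd (hzN k h) hp.ne'
      · obtain rfl : k = N - 1 := by omega
        exact hp

theorem exists_first_nonzero (D : ℕ → ℝ) (N : ℕ) :
    (∀ i < N, D i = 0) ∨ ∃ k < N, (∀ j < k, D j = 0) ∧ D k ≠ 0 := by
  classical
  by_cases hz : ∀ j < N, D j = 0
  · exact .inl hz
  · push Not at hz
    have hs := Nat.find_spec hz
    refine .inr ⟨Nat.find hz, hs.1, fun j hj => ?_, hs.2⟩
    by_contra hc
    exact Nat.find_min hz hj ⟨by omega, hc⟩

/-- The first nonzero Lie derivative below `N` exists, and `s` is its sign. -/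
def firstSign (L : TermLang) (o : ODE L.toSig) (s : ℚ) (N : ℕ) (e : Tm L.toSig ℕ) : SA L.toSig :=
  SA.disj ((List.range N).map fun k =>
    .and (L.lieZero o k e) (SA.gtz (.mul (.const s) (L.lieIter o k e))))

theorem sat_firstSign {a : DTm L.toSig → ℝ} {ω : ℕ → ℝ} {s : ℚ} {N : ℕ} :
    (firstSign L o s N e).Sat a ω ↔ ∃ k < N, (∀ j < k, tval a ω (L.lieIter o j e) = 0) ∧
      0 < s * tval a ω (L.lieIter o k e) := by
  simp [firstSign, sat_disj, sat_and, sat_gtz, sat_lieZero, tval_mul, tval_const]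

theorem lp_of_firstSign (h : Clocked L A o ys τ) {s : ℚ} {N : ℕ}
    (hE : Deriv L A Γ (SA.eqVec o.vars ys).toFml)
    (hs : Deriv L A Γ (firstSign L o s N e).toFml) :
    Deriv L A Γ (lp o ys (.or (SA.gtz (.mul (.const s) e)) (SA.eqVec o.vars ys))) := by
  refine .disjE hs fun P hP => ?_
  obtain ⟨k, -, rfl⟩ := List.mem_map.1 hP
  exact h.lp_of_first_nonzero hE.wk s k e (.andL .head) (.andR (φ := (L.lieZero o k e).toFml) .head)

section Rank
variable {N : ℕ} {g : ℕ → Tm L.toSig ℕ} (h : Clocked L A o ys τ) (hN : 1 ≤ N)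
  (hrank : Deriv L A [] (SA.cmp .eq (L.lieIter o N e)
    (Tm.sum ((List.range N).map fun i => .mul (g i) (L.lieIter o i e)))).toFml)
include h hN hrank

/-- A trichotomy: the first nonzero Lie derivative below the rank is positive, or negative, or there
is none. In the last case `e = 0` persists, which counts as progress in the complement. -/
theorem gtz : Decides L A o ys (SA.gtz e) (L.progGt o N e) := by
  refine mk_of ?_ ?_
  · refine Clocked.lp_mono (fun a ω => ?_) (lp_of_firstSign h (s := 1) (N := N) (e := e)
      (.hyp (by simp)) (.real₁ .head fun a ω p => ?_))
    · simp [sat_or, sat_gtz, tval_mul, tval_const]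
    · rw [sat_progGt, progGt_iff (D := fun i => tval a ω (L.lieIter o i e)) hN] at p
      simpa [sat_firstSign] using p
  · refine .orE (φ := (L.lieZero o N e).toFml) (ψ := (firstSign L o (-1) N e).toFml)
      (.real₁ (Q := (L.lieZero o N e).or (firstSign L o (-1) N e)) .head fun a ω p => ?_) ?_ ?_
    · rw [sat_not, sat_progGt, progGt_iff (D := fun i => tval a ω (L.lieIter o i e)) hN] at p
      rw [sat_or, sat_lieZero, sat_firstSign]
      refine (exists_first_nonzero (fun i => tval a ω (L.lieIter o i e)) N).imp_right ?_
      rintro ⟨k, hk, hz, hne⟩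
      refine ⟨k, hk, hz, ?_⟩
      have := not_lt.1 fun hp => p ⟨k, hk, hz, hp⟩
      have := lt_of_le_of_ne this hne
      push_cast
      linarith
    · refine Clocked.lp_mono (fun a ω p => ?_) (h.lp_eqz (.hyp (by simp)) e hN hrank .head)
      rw [sat_eqz] at p
      rw [sat_or, sat_not, sat_gtz, p]
      exact .inl (lt_irrefl 0)
    · refine Clocked.lp_mono (fun a ω p => ?_) (lp_of_firstSign h (s := -1) (N := N) (e := e)
        (.hyp (by simp)) .head)
      rw [sat_or, sat_gtz, tval_mul, tval_const] at p
      rw [sat_or, sat_not, sat_gtz]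
      refine p.imp_left fun p => ?_
      push_cast at p
      linarith

/-- The same trichotomy, with the vanishing case now on the positive side. -/
theorem gez : Decides L A o ys (SA.gez e) (L.progGe o N e) := by
  refine mk_of (.orE (φ := (L.progGt o N e).toFml) (ψ := (L.lieZero o N e).toFml) .head ?_ ?_) ?_
  · refine Clocked.lp_mono (fun a ω p => ?_) ((gtz h hN hrank).pos (.hyp (by simp)) .head)
    rw [sat_or, sat_gtz] at p
    rw [sat_or, sat_gez]
    exact p.imp_left le_of_lt
  · refine Clocked.lp_mono (fun a ω p => ?_) (h.lp_eqz (.hyp (by simp)) e hN hrank .head)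
    rw [sat_eqz] at p
    rw [sat_or, sat_gez, p]
    exact .inl le_rfl
  · refine Clocked.lp_mono (fun a ω p => ?_) (lp_of_firstSign h (s := -1) (N := N) (e := e)
      (.hyp (by simp)) (.real₁ .head fun a ω p => ?_))
    · rw [sat_or, sat_gtz, tval_mul, tval_const] at p
      rw [sat_or, sat_not, sat_gez]
      refine p.imp_left fun p => ?_
      push_cast at p
      linarith
    · rw [sat_not, TermLang.progGe, sat_or, sat_progGt,
        progGt_iff (D := fun i => tval a ω (L.lieIter o i e)) hN, sat_lieZero, not_or] at p
      rw [sat_firstSign]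
      obtain ⟨k, hk, hz, hne⟩ :=
        (exists_first_nonzero (fun i => tval a ω (L.lieIter o i e)) N).resolve_left p.2
      refine ⟨k, hk, hz, ?_⟩
      have := not_lt.1 fun hp => p.1 ⟨k, hk, hz, hp⟩
      have := lt_of_le_of_ne this hne
      push_cast
      linarith

end Rank

end Decides
end Decides

/-! ## Invariants from local progress -/

section Invariants
variable {L : TermLang} {A : Set ExtAx} {Γ Δ : List (Fml L.toSig)}
  {φ ψ χ θ : Fml L.toSig} {o : ODE L.toSig} {xs ys zs : List ℕ} {P Q R F : SA L.toSig}

theorem Fresh.mono {U V : Finset ℕ} (h : Fresh ys xs V) (hUV : U ⊆ V) : Fresh ys xs U :=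
  ⟨h.length_eq, h.nodup, fun y hy hu => h.fresh y hy (hUV hu)⟩

theorem exists_fresh (xs : List ℕ) (U : Finset ℕ) : ∃ ys, Fresh ys xs U := by
  obtain ⟨ys, hl, hn, hf⟩ := exists_freshVec xs.length U
  exact ⟨ys, hl, hn, hf⟩

theorem swapVec_eq_renVec_of_fresh {U : Finset ℕ} (h : Fresh ys o.vars U) (ho : o.fv ⊆ U) {z : ℕ}
    (hz : z ∈ U) : swapVec o.vars ys z = renVec o.vars ys z :=
  swapVec_eq_renVec h.nodup (h.notMem_vars ho) fun hy => h.fresh z hy hz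

theorem SA.map_swapVec {U : Finset ℕ} (h : Fresh ys o.vars U) (ho : o.fv ⊆ U) (hP : P.fv ⊆ U) :
    P.map (swapVec o.vars ys) = P.map (renVec o.vars ys) :=
  SA.map_congr fun _ hx => swapVec_eq_renVec_of_fresh h ho (hP hx)

theorem ODE.nodup_vars (o : ODE L.toSig) : o.vars.Nodup := o.nodup

theorem map_swapVec_vars {U : Finset ℕ} (h : Fresh ys o.vars U) (ho : o.fv ⊆ U) :
    o.vars.map (swapVec o.vars ys) = ys :=
  map_swapVec o.nodup_vars h.length_eq h.nodup (h.notMem_vars ho)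

theorem sat_eqVec_comm (a : DTm L.toSig → ℝ) (ω : ℕ → ℝ) (hl : ys.length = xs.length) :
    (SA.eqVec xs ys : SA L.toSig).Sat a ω ↔ (SA.eqVec ys xs : SA L.toSig).Sat a ω := by
  rw [sat_eqVec_iff_map a ω hl, sat_eqVec_iff_map a ω hl.symm, eq_comm]

theorem notMem_bv_of_allVec (P Q : SA L.toSig) :
    ∀ v ∈ (allVec o.vars P.toFml).fv, v ∉ (ode o Q).bv := by
  intro v hv
  rw [fv_allVec, SA.fv_toFml] at hv
  simp only [Finset.mem_sdiff, Finset.mem_image, List.mem_toFinset, List.mem_map] at hv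
  obtain ⟨⟨x, -, rfl⟩, hx⟩ := hv
  simpa [Prog.bv] using hx

namespace Deriv

theorem notI (h : Deriv L A (φ :: Γ) (.not φ)) : Deriv L A Γ (.not φ) :=
  taut₁ (impR h) fun v hv a => by simp only [hv.imp, hv.not] at *; tauto

/-- Facts about constants that are learned at a reached state hold already at the start. -/
theorem dia_const {α : Prog L.toSig} (hφ : ∀ v ∈ φ.fv, v ∉ α.bv) (h : Deriv L A Γ (dia α φ)) :
    Deriv L A Γ φ :=
  cases φ head (dia_absurd h.wk (box_const (φ := .not φ) hφ head))

/-- Equal vectors may be exchanged in semianalytic formulas. -/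
theorem eqVec_swap {U : Finset ℕ} (h : Fresh ys o.vars U) (ho : o.fv ⊆ U) (hP : P.fv ⊆ U) :
    Deriv L A Γ (imp (SA.eqVec o.vars ys).toFml
      (iff P.toFml (P.map (swapVec o.vars ys)).toFml)) := by
  have hn : P.not.fv ⊆ U := hP
  rw [SA.map_swapVec h ho hP]
  -- Congruence yields only an implication; its instance for the negation supplies the converse.
  refine taut₂ (eqVec_congr (h.notMem_vars ho) P) (eqVec_congr (h.notMem_vars ho) P.not)
    fun v hv a b => ?_
  change v (imp _ (imp (.not P.toFml) (.not (P.map (renVec o.vars ys)).toFml))) at b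
  simp only [hv.imp, hv.iff, hv.not] at *
  tauto

theorem eqVec_swap' {U : Finset ℕ} (h : Fresh ys o.vars U) (ho : o.fv ⊆ U) (hP : P.fv ⊆ U) :
    Deriv L A Γ (imp (SA.eqVec ys o.vars).toFml
      (iff P.toFml (P.map (swapVec o.vars ys)).toFml)) :=
  .impR (mp (eqVec_swap h ho hP)
    (real₁ head fun a ω p => (sat_eqVec_comm a ω h.length_eq).2 p))

/-- The differential adjoint with the backward system as a renaming. -/
theorem dadj (hD : ExtAx.Dadj ∈ A) {U : Finset ℕ} (h : Fresh ys o.vars U) (ho : o.fv ⊆ U)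
    (hQ : Q.fv ⊆ U) :
    Deriv L A Γ (iff (dia (ode o Q) (SA.eqVec o.vars ys).toFml)
      (dia ((ode o.neg Q).rename (swapVec o.vars ys)) (SA.eqVec ys o.vars).toFml)) := by
  have := Deriv.Dadj (A := A) (Γ := Γ) o (o.neg.rename (swapVec o.vars ys)) Q ys hD
    (h.mono (Finset.union_subset ho hQ)) ?_
  · rw [← SA.map_swapVec h ho hQ] at this
    exact this
  · simp only [ODE.rename, ODE.neg, List.map_map]
    refine List.map_congr_left fun p hp => ?_
    simp only [Function.comp, Prod.mk.injEq]
    constructor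
    · exact swapVec_eq_renVec_of_fresh h ho (ho (ODE.mem_fv.2 ⟨p, hp, .inl rfl⟩))
    · change (p.2.map _).neg = _
      rw [Tm.map_congr fun x hx =>
        swapVec_eq_renVec_of_fresh h ho (ho (ODE.mem_fv.2 ⟨p, hp, .inr hx⟩))]

/-- The end state lies in the domain, so a domain that contains only the initial state cannot be
used to leave it. -/
theorem lp_absurd (h : ∀ a ω, R.Sat a ω → (SA.eqVec o.vars ys : SA L.toSig).Sat a ω)
    (h' : Deriv L A Γ (lp o ys R)) : Deriv L A Γ χ :=
  dia_absurd h' (box_mono (φ := R.toFml)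
    (real_imp (Q := .not (.not (SA.eqVec o.vars ys))) fun a ω p => not_not.2 (h a ω p)) (.DW o R))

/-- Local progress into `¬P` within `Q` contradicts the invariance of `P` within `Q`. -/
theorem lp_not_of_box (hu : ExtAx.Uniq ∈ A) {U : Finset ℕ} (hf : Fresh ys o.vars U)
    (ho : o.fv ⊆ U) (hQ : Q.fv ⊆ U) (hE : Deriv L A Γ (SA.eqVec o.vars ys).toFml)
    (hq : Deriv L A Γ Q.toFml) (hb : Deriv L A Γ (box (ode o Q) P.toFml))
    (h : Deriv L A Γ (lp o ys (.or Q (SA.eqVec o.vars ys))))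
    (h' : Deriv L A Γ (lp o ys (.or P.not (SA.eqVec o.vars ys)))) : Deriv L A Γ χ := by
  set T : SA L.toSig := .or (.and Q P.not) (SA.eqVec o.vars ys) with hT
  have h₁ : Deriv L A Γ (lp o ys T) := by
    refine Clocked.lp_mono (fun a ω => ?_) (Clocked.lp_and hu h h')
    simp only [hT, sat_or, sat_and, sat_not]; tauto
  -- `T` does not imply `Q` at `x = y`. But `Q` holds initially, and in terms of the constants `y`
  -- it remains true, which covers this exceptional state.
  have h₂ : Deriv L A Γ (box (ode o T) (Q.map (swapVec o.vars ys)).toFml) := by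
    refine box_const (SA.notMem_bv fun x hx => ?_) (mp_iff (mp (eqVec_swap hf ho hQ) hE) hq)
    rw [SA.map_swapVec hf ho hQ, SA.mem_fv_map] at hx
    obtain ⟨z, hz, rfl⟩ := hx
    rw [← swapVec_eq_renVec_of_fresh hf ho (hQ hz)]
    by_cases hzv : z ∈ o.vars
    · refine hf.notMem_vars ho _ ?_
      have := List.mem_map_of_mem (f := swapVec o.vars ys) hzv
      rwa [map_swapVec_vars hf ho] at this
    · rwa [swapVec_of_notMem hzv fun hy => hf.fresh z hy (hQ hz)]
  have h₃ : Deriv L A Γ (box (ode o T) P.toFml) := by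
    refine box_dom (box_mono ?_ h₂) hb
    refine taut₁ (eqVec_swap (A := A) (Γ := []) hf ho hQ) fun v hv a => ?_
    simp only [hT, SA.toFml, hv.imp, hv.iff, hv.and, hv.or, hv.not] at *
    tauto
  refine dia_absurd h₁ (box_mono₂ ?_ h₃ (.DW o T))
  refine taut fun v hv => ?_
  simp only [hT, SA.toFml, hv.imp, hv.and, hv.or, hv.not]
  tauto

/-- The backward system preserves the complement of a forward invariant. -/
theorem backward_invariant (hD : ExtAx.Dadj ∈ A) :
    Deriv L A [] (imp (allVec o.vars (imp P.toFml (box (ode o Q) P.toFml)))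
      (imp P.not.toFml (box (ode o.neg Q) P.not.toFml))) := by
  set I : Fml L.toSig := allVec o.vars (imp P.toFml (box (ode o Q) P.toFml)) with hI
  set I' : Fml L.toSig := allVec o.neg.vars (imp P.toFml (box (ode o.neg.neg Q) P.toFml)) with hI'
  have hv : o.neg.vars = o.vars := ODE.vars_neg o
  have hfv : o.neg.fv = o.fv := ODE.fv_neg o
  set V : Finset ℕ := o.neg.fv ∪ Q.fv ∪ P.fv with hV
  obtain ⟨ws, hf⟩ := exists_fresh o.neg.vars (V ∪ I.indices)
  have hfV : Fresh ws o.neg.vars V := hf.mono Finset.subset_union_left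
  have hoV : o.neg.fv ⊆ V := fun x hx => by simp [hV, hx]
  have hQV : Q.fv ⊆ V := fun x hx => by simp [hV, hx]
  have hPV : P.fv ⊆ V := fun x hx => by simp [hV, hx]
  set E : SA L.toSig := SA.eqVec o.neg.vars ws with hE
  set π := swapVec o.neg.vars ws with hπ
  have hd := hfV.notMem_vars hoV
  -- The adjoint of the backward system has right-hand sides `-(-f)`, which are provably but not
  -- syntactically equal to `f`.
  have h₁ : Deriv L A [I] I' := by
    refine allVecI ?_ ?_
    · intro χ hχ x hx
      obtain rfl : χ = I := by simpa using hχ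
      exact val_notMem_fv_allVec (hv ▸ hx)
    · refine taut₂ (allVecE (xs := o.vars) (φ := imp P.toFml (box (ode o Q) P.toFml)) head)
        (.odeCongr o o.neg.neg Q P.toFml (by simp [ODE.vars_neg]) fun x hx => ?_) fun v hv a b => ?_
      · obtain ⟨p, hp, rfl⟩ := ODE.mem_vars.1 hx
        have hp' : (p.1, p.2.neg.neg) ∈ o.neg.neg.eqs := by
          simp only [ODE.neg, List.map_map]
          exact List.mem_map.2 ⟨p, hp, rfl⟩
        refine real_of_sat (P := .cmp .eq (o.rhs p.1) (o.neg.neg.rhs p.1)) fun a ω => ?_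
        rw [sat_cmp, ODE.rhs_of_mem hp, ODE.rhs_of_mem hp', tval_neg, tval_neg, neg_neg]
        rfl
      · simp only [hv.imp, hv.iff] at *
        tauto
  have h₂ : Deriv L A [I] ((imp P.toFml (box (ode o.neg.neg Q) P.toFml)).rename π) := by
    refine allVec_rename o.neg.nodup_vars hfV.length_eq hfV.nodup hd ?_ ?_ ?_ h₁
    · intro y hy
      have := hfV.fresh y hy
      simp only [hV, hfv, Finset.mem_union, not_or] at this
      simp [imp, Fml.fv, Prog.fv, SA.val_mem_fv, ODE.fv_neg, this]
    · intro y hy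
      simp [imp, Fml.fv, Prog.fv, SA.der_notMem_fv]
    · intro y hy
      simp [imp, Fml.fv, Prog.fv, SA.der_notMem_fv]
  -- The end state of the backward run is named `ws`, as the adjoint axiom requires. A
  -- counterexample is then a backward run from `x` to `ws` with `P` at `ws`.
  refine .impR (.impR (box_fresh_copy (xs := o.neg.vars) (ws := ws) hf.length_eq hf.nodup hd
    (fun w hw hx => hfV.fresh w hw (hoV hx)) (fun w hw hx => hfV.fresh w hw (hQV hx)) ?_ ?_
    (box_of_not_dia (notI ?_))))
  · intro χ hχ w hw
    simp only [List.mem_cons, List.not_mem_nil, or_false] at hχ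
    rcases hχ with rfl | rfl
    · rw [SA.val_mem_fv]
      exact fun hx => hfV.fresh w hw (hPV hx)
    · exact val_notMem_of_notMem_indices fun hx => hf.fresh w hw (by simp [hx])
  · intro w hw
    rw [SA.val_mem_fv]
    exact fun hx => hfV.fresh w hw (hPV hx)
  · set D : Fml L.toSig := dia (ode o.neg Q) (.not (imp E.toFml P.not.toFml)) with hDd
    have hπv : ∀ x ∈ P.fv, π x ∉ o.neg.vars := fun x hx => by
      by_cases hxv : x ∈ o.neg.vars
      · refine hd _ ?_
        rw [← map_swapVec_vars hfV hoV]
        exact List.mem_map_of_mem hxv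
      · rwa [hπ, swapVec_of_notMem hxv fun hy => hfV.fresh x hy (hPV hx)]
    have h₃ : Deriv L A [D, P.not.toFml, I] (P.map π).toFml := by
      refine dia_const (SA.notMem_bv fun x hx => ?_) (dia_mono ?_ head)
      · obtain ⟨z, hz, rfl⟩ := SA.mem_fv_map.1 hx
        exact hπv z hz
      · refine taut₁ (eqVec_swap (A := A) (Γ := []) hfV hoV hPV) fun v hv a => ?_
        simp only [SA.toFml, hv.imp, hv.iff, hv.not] at *
        tauto
    have h₄ : Deriv L A [D, P.not.toFml, I]
        (dia ((ode o.neg.neg Q).rename π) (SA.eqVec ws o.neg.vars).toFml) := by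
      refine mp_iff (dadj hD hfV hoV hQV) (dia_mono ?_ head)
      refine taut fun v hv => ?_
      simp only [hv.imp, hv.not]
      tauto
    have h₅ : Deriv L A [D, P.not.toFml, I]
        (box ((ode o.neg.neg Q).rename π) (P.toFml.rename π)) :=
      mp (.weaken (by simp) h₂) (by rw [SA.toFml_rename]; exact h₃)
    rw [SA.toFml_rename] at h₅
    -- The reversed run, in the variables `ws`, ends at `x` and preserves `P`, so `P` holds at `x`.
    -- During this run `x` is constant, so the fact transfers to the start, against `¬P`.
    have h₆ : Deriv L A [D, P.not.toFml, I] P.toFml := by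
      refine dia_const ?_ (dia_box (φ := (SA.eqVec ws o.neg.vars).toFml) ?_ h₄ h₅)
      · refine SA.notMem_bv fun x hx => ?_
        rw [ODE.vars_rename, ODE.vars_neg o.neg, map_swapVec_vars hfV hoV]
        exact fun hy => hfV.fresh x hy (hPV hx)
      · refine taut₁ (eqVec_swap' (A := A) (Γ := []) hfV hoV hPV) fun v hv a => ?_
        simp only [hv.imp, hv.iff] at *
        tauto
    exact absurd h₆ (hyp (φ := P.not.toFml) (by simp))

end Deriv
end Invariants

/-! ## Completeness for systems with decided local progress -/

section Completeness
variable {L : TermLang} {A : Set ExtAx} {Γ : List (Fml L.toSig)}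
  {o : ODE L.toSig} {P Q FP FQ BP BQ : SA L.toSig}

/-- The consequence of real induction with domain constraints, for the system `o`. -/
def RealInduction (A : Set ExtAx) (o : ODE L.toSig) (P Q : SA L.toSig) (U : Finset ℕ) : Prop :=
  ∀ ys, Fresh ys o.vars U → Deriv L A [] (imp
    (allVec ys (box (ode o (.and Q (.or P (SA.eqVec o.vars ys))))
      (imp (SA.eqVec o.vars ys).toFml (.and P.toFml
        (imp (lp o ys (.or Q (SA.eqVec o.vars ys))) (lp o ys (.or P (SA.eqVec o.vars ys))))))))
    (box (ode o Q) P.toFml))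

/-- All fresh copies of the variables admit decision of local progress, forwards and backwards. -/
structure ProgressDecided (A : Set ExtAx) (o : ODE L.toSig) (P Q FP FQ BP BQ : SA L.toSig)
    (U : Finset ℕ) : Prop where
  fwd : ∀ ys, Fresh ys o.vars U → Decides L A o ys P FP
  fwd_dom : ∀ ys, Fresh ys o.vars U → Decides L A o ys Q FQ
  bwd : ∀ ys, Fresh ys o.vars U → Decides L A o.neg ys P.not BP
  bwd_dom : ∀ ys, Fresh ys o.vars U → Decides L A o.neg ys Q BQ

namespace ProgressDecided
variable {U : Finset ℕ} (hp : ProgressDecided A o P Q FP FQ BP BQ U)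
  (hu : ExtAx.Uniq ∈ A) (hD : ExtAx.Dadj ∈ A)
include hp hu

/-- If the progress formula of `P` failed, its decision property would give progress into `¬P`, that
of `Q` progress in `Q`, and invariance excludes both together. -/
theorem forward_necessary : Deriv L A [] (imp
    (allVec o.vars (imp P.toFml (box (ode o Q) P.toFml)))
    (SA.imp (P.and (Q.and FQ)) FP).toFml) := by
  set I : Fml L.toSig := allVec o.vars (imp P.toFml (box (ode o Q) P.toFml)) with hI
  set V : Finset ℕ := U ∪ o.fv ∪ Q.fv ∪ (imp I (SA.imp (P.and (Q.and FQ)) FP).toFml).indices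
    with hV
  obtain ⟨ys, hf⟩ := exists_fresh o.vars V
  have hoV : o.fv ⊆ V := fun x hx => by simp [hV, hx]
  have hQV : Q.fv ⊆ V := fun x hx => by simp [hV, hx]
  have hfU : Fresh ys o.vars U := hf.mono fun x hx => by simp [hV, hx]
  refine .fresh_copy (xs := o.vars) (ys := ys) hf.length_eq hf.nodup (hf.notMem_vars hoV)
    (by simp) (fun y hy => val_notMem_of_notMem_indices fun h => hf.fresh y hy
      (Finset.mem_union_right _ h)) (.impR (.impR (.impR (.cases FP.toFml .head ?_))))
  set C : SA L.toSig := P.and (Q.and FQ)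
  have hC : Deriv L A [FP.not.toFml, C.toFml, I, (SA.eqVec o.vars ys).toFml] C.toFml :=
    .hyp (by simp)
  have hE : Deriv L A [FP.not.toFml, C.toFml, I, (SA.eqVec o.vars ys).toFml]
    (SA.eqVec o.vars ys).toFml := .hyp (by simp)
  have hq : Deriv L A [FP.not.toFml, C.toFml, I, (SA.eqVec o.vars ys).toFml] Q.toFml :=
    .real₁ hC fun a ω p => ((sat_and a ω _ _).1 ((sat_and a ω _ _).1 p).2).1
  refine .lp_not_of_box (P := P) hu hf hoV hQV hE hq (.mp (.allVecE (xs := o.vars)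
    (.hyp (φ := I) (by simp))) (.real₁ hC fun a ω p => ((sat_and a ω _ _).1 p).1))
    ((hp.fwd_dom ys hfU).pos hE (.real₁ hC
      fun a ω p => ((sat_and a ω _ _).1 ((sat_and a ω _ _).1 p).2).2))
    ((hp.fwd ys hfU).neg hE .head)

include hD in
-- The forward argument for the backward system and `¬P`, whose invariance is `backward_invariant`.
theorem backward_necessary : Deriv L A [] (imp
    (allVec o.vars (imp P.toFml (box (ode o Q) P.toFml)))
    (SA.imp (P.not.and (Q.and BQ)) BP).toFml) := by
  set I : Fml L.toSig := allVec o.vars (imp P.toFml (box (ode o Q) P.toFml)) with hI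
  set V : Finset ℕ := U ∪ o.fv ∪ Q.fv ∪ (imp I (SA.imp (P.not.and (Q.and BQ)) BP).toFml).indices
    with hV
  obtain ⟨ys, hf⟩ := exists_fresh o.vars V
  have hoV : o.fv ⊆ V := fun x hx => by simp [hV, hx]
  have hQV : Q.fv ⊆ V := fun x hx => by simp [hV, hx]
  have hfU : Fresh ys o.vars U := hf.mono fun x hx => by simp [hV, hx]
  have hv := ODE.vars_neg o
  refine .fresh_copy (xs := o.vars) (ys := ys) hf.length_eq hf.nodup (hf.notMem_vars hoV)
    (by simp) (fun y hy => val_notMem_of_notMem_indices fun h => hf.fresh y hy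
      (Finset.mem_union_right _ h)) (.impR (.impR (.impR (.cases BP.toFml .head ?_))))
  set C : SA L.toSig := P.not.and (Q.and BQ)
  have hC : Deriv L A [BP.not.toFml, C.toFml, I, (SA.eqVec o.vars ys).toFml] C.toFml :=
    .hyp (by simp)
  have hE : Deriv L A [BP.not.toFml, C.toFml, I, (SA.eqVec o.vars ys).toFml]
    (SA.eqVec o.neg.vars ys).toFml := .hyp (by simp [hv])
  have hq : Deriv L A [BP.not.toFml, C.toFml, I, (SA.eqVec o.vars ys).toFml] Q.toFml :=
    .real₁ hC fun a ω p => ((sat_and a ω _ _).1 ((sat_and a ω _ _).1 p).2).1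
  refine .lp_not_of_box (o := o.neg) (P := P.not) (U := V) hu (hv ▸ hf)
    (ODE.fv_neg o ▸ hoV) hQV hE hq
    (.mp (.mp (.of_nil (Deriv.backward_invariant hD)) (.hyp (φ := I) (by simp)))
      (.real₁ hC fun a ω p => ((sat_and a ω _ _).1 p).1))
    ((hp.bwd_dom ys hfU).pos hE (.real₁ hC
      fun a ω p => ((sat_and a ω _ _).1 ((sat_and a ω _ _).1 p).2).2))
    ((hp.bwd ys hfU).neg hE .head)

/-- The backward system is not able to leave a state in `¬P` within `Q ∧ P`. -/
theorem backward_blocked {zs : List ℕ} (hz : Fresh zs o.vars U) : Deriv L A [] (imp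
    (SA.eqVec o.vars zs).toFml (imp (P.not.and (Q.and (SA.imp (P.not.and (Q.and BQ)) BP))).toFml
      (.not (dia (ode o.neg (.and Q (.or P (SA.eqVec o.vars zs))))
        (.not (SA.eqVec o.vars zs).toFml))))) := by
  have hv := ODE.vars_neg o
  refine .impR (.impR (.notI ?_))
  set T : SA L.toSig := P.not.and (Q.and (SA.imp (P.not.and (Q.and BQ)) BP)) with hT
  set R : SA L.toSig := .and Q (.or P (SA.eqVec o.vars zs)) with hR
  set D : Fml L.toSig := dia (ode o.neg R) (.not (SA.eqVec o.vars zs).toFml) with hD'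
  have hE : Deriv L A [D, T.toFml, (SA.eqVec o.vars zs).toFml] (SA.eqVec o.neg.vars zs).toFml :=
    .hyp (by simp [hv])
  have hl : Deriv L A [D, T.toFml, (SA.eqVec o.vars zs).toFml] (lp o.neg zs R) := by
    rw [lp, hv]; exact .head
  -- If `BQ` holds, the backward condition gives progress into `¬P`; otherwise there is progress
  -- into `¬Q`. Either one meets the domain `Q ∧ (P ∨ x = z)` only at `x = z`.
  refine .cases BQ.toFml ?_ ?_
  · refine Deriv.lp_absurd ?_ (Clocked.lp_and hu ((hp.bwd zs hz).pos hE.wk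
      (.real₂ .head (.hyp (φ := T.toFml) (by simp)) fun a ω p q => ?_)) hl.wk)
    · intro a ω
      simp only [hv, hR, sat_or, sat_and, sat_not]; tauto
    · simp only [hT, sat_and, sat_imp, sat_not] at q
      tauto
  · refine Deriv.lp_absurd ?_ (Clocked.lp_and hu ((hp.bwd_dom zs hz).neg hE.wk .head) hl.wk)
    intro a ω
    simp only [hv, hR, sat_or, sat_and, sat_not]; tauto

/-- If `FQ` holds, the forward condition applies at `x = y`. If it fails, progress into `¬Q`
contradicts the assumed progress in `Q`. The condition is available at `x = y` because it is
quantified over `x`. -/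
theorem forward_progress {ys : List ℕ} (hf : Fresh ys o.vars U) : Deriv L A [] (imp
    (allVec o.vars (SA.imp (P.and (Q.and FQ)) FP).toFml)
    (box (ode o (.and Q (.or P (SA.eqVec o.vars ys)))) (imp (SA.eqVec o.vars ys).toFml
      (imp P.toFml (imp (lp o ys (.or Q (SA.eqVec o.vars ys)))
        (lp o ys (.or P (SA.eqVec o.vars ys)))))))) := by
  set I : Fml L.toSig := allVec o.vars (SA.imp (P.and (Q.and FQ)) FP).toFml with hI
  set E : SA L.toSig := SA.eqVec o.vars ys with hE
  set R : SA L.toSig := .and Q (.or P E) with hR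
  refine .impR ?_
  refine .box_mono₂ (.impR (.impR (.impR (.impR (.impR ?_))))) (.box_const (notMem_bv_of_allVec _ _) .head)
    (.DW o R)
  set Θ : List (Fml L.toSig) := [lp o ys (.or Q E), P.toFml, E.toFml, R.toFml, I]
  have hEΘ : Deriv L A Θ E.toFml := .hyp (by simp [Θ])
  refine .cases FQ.toFml ?_ ?_
  · refine (hp.fwd ys hf).pos hEΘ.wk (.real₃ (P := .and Q P)
      (.andI (.real₁ (.hyp (φ := R.toFml) (by simp [Θ])) fun a ω p => ((sat_and a ω _ _).1 p).1)
        (.hyp (by simp [Θ]))) .head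
      (.allVecE (xs := o.vars) (.hyp (φ := I) (by simp [Θ]))) fun a ω p q r => ?_)
    simp only [sat_and, sat_imp] at *
    tauto
  · refine .lp_absurd ?_ (Clocked.lp_and hu ((hp.fwd_dom ys hf).neg hEΘ.wk .head)
      (.hyp (φ := lp o ys (.or Q E)) (by simp [Θ])))
    intro a ω
    simp only [sat_or, sat_and, sat_not]; tauto

include hD in
-- Suppose that a run from `P` first violates `P` at `y`. Reversed, it starts in `¬P ∧ Q`, ends at a
-- state of `P`, hence elsewhere, and meanwhile stays in `Q` and, away from `y`, in `P`. This is
-- what `backward_blocked` excludes.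
theorem no_exit {V : Finset ℕ} (hUV : U ⊆ V) (hoV : o.fv ⊆ V)
    (hTV : (P.not.and (Q.and (SA.imp (P.not.and (Q.and BQ)) BP))).fv ⊆ V)
    {ys : List ℕ} (hf : Fresh ys o.vars V) : Deriv L A [] (imp
      (allVec o.vars (SA.imp (P.not.and (Q.and BQ)) BP).toFml) (imp P.toFml
        (box (ode o (.and Q (.or P (SA.eqVec o.vars ys))))
          (imp (SA.eqVec o.vars ys).toFml P.toFml)))) := by
  set J : Fml L.toSig := allVec o.vars (SA.imp (P.not.and (Q.and BQ)) BP).toFml with hJ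
  set T : SA L.toSig := P.not.and (Q.and (SA.imp (P.not.and (Q.and BQ)) BP)) with hT
  set E : SA L.toSig := SA.eqVec o.vars ys with hE
  set R : SA L.toSig := .and Q (.or P E) with hR
  have hPV : P.fv ⊆ V := fun x hx => hTV (by simp [hT, SA.fv, hx])
  have hQV : Q.fv ⊆ V := fun x hx => hTV (by simp [hT, SA.fv, hx])
  have hJ' : Deriv L A [] (imp J (SA.imp (P.not.and (Q.and BQ)) BP).toFml) :=
    .impR (.allVecE (xs := o.vars) .head)
  set D : Fml L.toSig := dia (ode o R) (.not (imp E.toFml P.toFml)) with hDd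
  suffices H : Deriv L A [] (imp J (imp P.toFml (.not D))) from
    .impR (.impR (.box_of_not_dia (.mp (.mp (.of_nil H) (.hyp (by simp))) .head)))
  set W : Finset ℕ := V ∪ ys.toFinset ∪ (imp J (imp P.toFml (.not D))).indices with hW
  obtain ⟨zs, hz⟩ := exists_fresh o.vars W
  have hVW : V ⊆ W := fun x hx => by simp [hW, hx]
  have hzU : Fresh zs o.vars U := hz.mono fun x hx => by simp [hW, hUV hx]
  have hzy : ∀ z ∈ zs, z ∉ ys := fun z hz' hy => hz.fresh z hz' (by simp [hW, hy])
  have hyl := hf.length_eq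
  have hzl := hz.length_eq
  set Z : SA L.toSig := SA.eqVec o.vars zs with hZ
  set Y : SA L.toSig := SA.eqVec ys zs with hY
  set R' : SA L.toSig := .and Q (.or P Z) with hR'
  set π := swapVec o.vars ys with hπ
  -- The reversed system evolves `ys`, so the exceptional state `y` needs a second name `zs` that
  -- stays constant.
  refine .fresh_copy (xs := ys) (ys := zs) (by omega) hz.nodup hzy (by simp)
    (fun z hz' => val_notMem_of_notMem_indices fun h => hz.fresh z hz'
      (Finset.mem_union_right _ h)) (.impR (.impR (.impR (.notI ?_))))
  set Θ : List (Fml L.toSig) := [D, P.toFml, J, Y.toFml]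
  have hyv := hf.notMem_vars hoV
  have hzv := hz.notMem_vars (hoV.trans hVW)
  have hπm : ∀ x ∈ V, π x ∉ o.vars := fun x hx => by
    by_cases hxv : x ∈ o.vars
    · refine hyv _ ?_
      have := List.mem_map_of_mem (f := π) hxv
      rwa [map_swapVec_vars hf hoV] at this
    · rwa [hπ, swapVec_of_notMem hxv fun hy => hf.fresh x hy hx]
  have hYc : ∀ x ∈ Y.fv, x ∉ o.vars := fun x hx => by
    rcases SA.mem_fv_eqVec hx with hx | hx
    · exact hyv x hx
    · exact hzv x hx
  have hπZ : Z.map π = Y := by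
    rw [hZ, SA.map_eqVec, map_swapVec_vars hf hoV]
    congr 1
    conv_rhs => rw [← List.map_id zs]
    exact List.map_congr_left fun z hz' => swapVec_of_notMem (hzv z hz') (hzy z hz')
  have hyW : ∀ y ∈ ys, y ∉ V ∪ zs.toFinset := fun y hy h => by
    rcases Finset.mem_union.1 h with h | h
    · exact hf.fresh y hy h
    · exact hzy y (List.mem_toFinset.1 h) hy
  have hZV : Z.fv ⊆ V ∪ zs.toFinset := fun x hx => by
    rcases SA.mem_fv_eqVec (show x ∈ (SA.eqVec o.vars zs).fv from hx) with hx | hx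
    · exact Finset.mem_union_left _ (hoV (ODE.mem_fv_of_mem_vars hx))
    · simp [hx]
  have hR'V : R'.fv ⊆ V ∪ zs.toFinset := Finset.union_subset
    (hQV.trans Finset.subset_union_left)
    (Finset.union_subset (hPV.trans Finset.subset_union_left) hZV)
  have hD₁ : Deriv L A Θ (dia (ode o R) (.and E.toFml T.toFml)) := by
    refine .dia_box (ψ := .and R.toFml J) ?_ (.hyp (φ := D) (by simp [Θ]))
      (.box_mono₂ (φ := R.toFml) (ψ := J) ?_ (.DW o R)
        (.box_const (notMem_bv_of_allVec _ _) (.hyp (by simp [Θ]))))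
    · refine .taut₁ hJ' fun v hv a => ?_
      simp only [hT, hR, SA.imp, SA.toFml, hv.imp, hv.and, hv.or, hv.not] at *
      tauto
    · exact .taut fun v hv => by simp only [hv.imp, hv.and]; tauto
  -- What is known at the end state `x = y` is expressed in the constants `ys`, and so is known
  -- before the run.
  have hT' : Deriv L A Θ (T.map π).toFml := by
    refine .dia_const (SA.notMem_bv fun x hx => ?_) (.dia_mono ?_ hD₁)
    · obtain ⟨z, hz', rfl⟩ := SA.mem_fv_map.1 hx
      exact hπm z (hTV hz')
    · refine .taut₁ (Deriv.eqVec_swap (A := A) (Γ := []) hf hoV hTV) fun v hv a => ?_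
      simp only [hv.imp, hv.iff, hv.and] at *
      tauto
  have hD₂ : Deriv L A Θ (dia (ode o R') E.toFml) := by
    refine .dia_dom (.box_mono (φ := Y.toFml) ?_ (.box_const (SA.notMem_bv hYc)
      (.hyp (by simp [Θ])))) (.dia_mono ?_ hD₁)
    · refine .real_imp₂ fun a ω p q => ?_
      rw [hR, sat_and, sat_or] at q
      rw [hR', sat_and, sat_or]
      refine ⟨q.1, q.2.imp_right fun q => ?_⟩
      rw [hY, sat_eqVec_iff_map a ω (by omega)] at p
      rw [hE, sat_eqVec_iff_map a ω hyl] at q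
      rw [hZ, sat_eqVec_iff_map a ω hzl]
      exact q.trans p
    · exact .taut fun v hv => by simp only [hv.imp, hv.and]; tauto
  have hD₃ : Deriv L A Θ (dia ((ode o.neg R').rename π) (SA.eqVec ys o.vars).toFml) :=
    .mp_iff (.dadj (U := V ∪ zs.toFinset) hD ⟨hyl, hf.nodup, hyW⟩
      (hoV.trans Finset.subset_union_left) hR'V) hD₂
  -- The initial state differs from `y`: it satisfies `P`, while `T` at `y` contains `¬P`.
  have hZn : Deriv L A Θ Z.not.toFml := by
    have h := Deriv.eqVec_swap (A := A) (Γ := Θ) hf hoV hPV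
    have hn : Deriv L A Θ E.not.toFml := by
      refine .taut₃ h hT' (.hyp (φ := P.toFml) (by simp [Θ])) fun v hv a b c => ?_
      have b' : v (.and (.not (P.map π).toFml) _) := b
      simp only [SA.toFml, hv.imp, hv.iff, hv.and, hv.not] at *
      tauto
    refine .real₂ hn (.hyp (φ := Y.toFml) (by simp [Θ])) fun a ω p q => ?_
    rw [sat_not, hE, sat_eqVec_iff_map a ω hyl] at p
    rw [hY, sat_eqVec_iff_map a ω (by omega)] at q
    rw [sat_not, hZ, sat_eqVec_iff_map a ω hzl]
    exact fun r => p (r.trans q.symm)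
  have hD₄ : Deriv L A Θ (dia ((ode o.neg R').rename π) Y.not.toFml) := by
    refine .dia_box (ψ := Z.not.toFml) (.real_imp₂ fun a ω p q => ?_) hD₃
      (.box_const (SA.notMem_bv fun x hx => ?_) hZn)
    · rw [sat_eqVec_iff_map a ω (by omega)] at p
      rw [sat_not, hZ, sat_eqVec_iff_map a ω hzl] at q
      rw [sat_not, hY, sat_eqVec_iff_map a ω (by omega)]
      exact fun r => q (p.symm.trans r)
    · rw [ODE.vars_rename, ODE.vars_neg, map_swapVec_vars hf hoV]
      rcases SA.mem_fv_eqVec (show x ∈ (SA.eqVec o.vars zs).fv from hx) with hx | hx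
      · exact fun hy => hyv x hy hx
      · exact hzy x hx
  -- The obstruction is proved for the variables `x`; generalizing and renaming applies it to the
  -- reversed system in `ys`.
  have hB := Deriv.allVec_rename (A := A) (Γ := []) (xs := o.vars) (ys := ys) o.nodup_vars hyl hf.nodup hyv
    ?_ ?_ ?_ (.allVecI (by simp) (hp.backward_blocked hu hzU))
  · simp only [imp, rename, SA.toFml_rename] at hB
    rw [← hZ, ← hπ, hπZ] at hB
    refine .absurd hD₄ (.mp (.mp (.of_nil hB) (.hyp (φ := Y.toFml) (by simp [Θ]))) hT')
  · intro y hy h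
    simp only [imp, fv, Prog.fv, Prog.bv, Finset.mem_union, Finset.mem_sdiff, SA.val_mem_fv,
      Finset.mem_image, Var.val.injEq, exists_eq_right, ODE.fv_neg] at h
    have h₃ := fun hz' => hyW y hy (hZV hz')
    have h₄ := fun hz' => hyW y hy (hR'V hz')
    have h₅ := fun ht => hf.fresh y hy (hTV ht)
    have h₆ := fun ht => hf.fresh y hy (hoV ht)
    tauto
  · intro y hy
    simp [imp, fv, Prog.fv, SA.der_notMem_fv]
  · intro y hy
    simp [imp, fv, Prog.fv, SA.der_notMem_fv]

include hD in
-- Real induction asks for `P` at `y`, which is `no_exit`, and for progress from `y`, which is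
-- `forward_progress` once `P` is known there.
theorem sufficient (hU : o.fv ⊆ U) (hRI : RealInduction A o P Q U) : Deriv L A [] (imp
    (allVec o.vars (SA.imp (P.and (Q.and FQ)) FP).toFml)
    (imp (allVec o.vars (SA.imp (P.not.and (Q.and BQ)) BP).toFml)
      (imp P.toFml (box (ode o Q) P.toFml)))) := by
  set I : Fml L.toSig := allVec o.vars (SA.imp (P.and (Q.and FQ)) FP).toFml with hI
  set J : Fml L.toSig := allVec o.vars (SA.imp (P.not.and (Q.and BQ)) BP).toFml with hJ
  set T : SA L.toSig := P.not.and (Q.and (SA.imp (P.not.and (Q.and BQ)) BP)) with hT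
  set V : Finset ℕ := U ∪ T.fv ∪ (imp I (imp J P.toFml)).indices with hV
  obtain ⟨ys, hf⟩ := exists_fresh o.vars V
  have hUV : U ⊆ V := fun x hx => by simp [hV, hx]
  refine .impR (.impR (.impR (.mp (.of_nil (hRI ys (hf.mono hUV))) (.allVecI ?_ ?_))))
  · intro χ hχ y hy h
    refine hf.fresh y hy (Finset.mem_union_right _ (Finset.mem_image.2 ⟨Var.val y, ?_, rfl⟩))
    simp only [imp, fv, Finset.mem_union]
    simp only [List.mem_cons, List.not_mem_nil, or_false] at hχ
    rcases hχ with rfl | rfl | rfl <;> simp [h]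
  · exact .box_mono₂ (.taut fun v hv => by simp only [hv.imp, hv.and]; tauto)
      (.mp (.mp (.of_nil (hp.no_exit hu hD hUV (hU.trans hUV)
        (show T.fv ⊆ V from fun x hx => by simp [hV, hx]) hf)) (.hyp (φ := J) (by simp))) .head)
      (.mp (.of_nil (hp.forward_progress hu (hf.mono hUV))) (.hyp (φ := I) (by simp)))

end ProgressDecided
end Completeness

/-! ## Clocks, normal forms, and the semianalytic invariant axioms -/

section Clock
variable {L : TermLang} {A : Set ExtAx} {Γ : List (Fml L.toSig)}
  {o o' : ODE L.toSig} {P Q F FP FQ B BP BQ : SA L.toSig} {t : ℕ} {g : Tm L.toSig ℕ}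

theorem Tm.mem_fv_sum {S : Sig} {l : List (Tm S ℕ)} {y : ℕ} :
    y ∈ (Tm.sum l).fv ↔ ∃ s ∈ l, y ∈ s.fv := by
  induction l with
  | nil => simp [Tm.sum, Tm.fv, Tm.collect]
  | cons s l ih =>
    rw [List.exists_mem_cons_iff, ← ih]
    exact Finset.mem_union

/-- Lie derivatives of terms without `t` do not depend on a differential equation for `t`. -/
theorem lie_extend (hr : ∀ x, x ≠ t → o'.rhs x = o.rhs x ∧ t ∉ (o.rhs x).fv) {e : Tm L.toSig ℕ}
    (he : t ∉ e.fv) : L.lie o' e = L.lie o e ∧ t ∉ (L.lie o e).fv := by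
  induction e with
  | var x => exact hr x fun h => he (by simp [Tm.fv, Tm.collect, h])
  | const c => simp [TermLang.lie, Tm.fv, Tm.collect]
  | add s u hs hu =>
    simp only [Tm.fv, Tm.collect, Finset.mem_union, not_or, TermLang.lie] at *
    rw [(hs he.1).1, (hu he.2).1]
    exact ⟨rfl, (hs he.1).2, (hu he.2).2⟩
  | mul s u hs hu =>
    simp only [Tm.fv, Tm.collect, Finset.mem_union, not_or, TermLang.lie] at *
    rw [(hs he.1).1, (hu he.2).1]
    exact ⟨rfl, ⟨(hs he.1).2, he.2⟩, he.1, (hu he.2).2⟩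
  | app k args ih =>
    have he' : ∀ i, t ∉ (args i).fv := fun i h => he (by
      simp only [Tm.fv, Tm.collect, Finset.mem_biUnion, Finset.mem_univ, true_and]
      exact ⟨i, h⟩)
    simp only [TermLang.lie]
    refine ⟨?_, ?_⟩
    · congr 2
      funext i
      rw [(ih i (he' i)).1]
    · rw [Tm.mem_fv_sum]
      rintro ⟨s, hs, hts⟩
      obtain ⟨i, rfl⟩ := (List.mem_ofFn' _ _).1 hs
      have hts' : t ∈ ((L.pd k i).bind args).fv ∪ (L.lie o (args i)).fv := hts
      rcases Finset.mem_union.1 hts' with h | h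
      -- The variables of `L.pd k i` are argument positions, so each variable of its instance occurs
      -- in some argument.
      · rw [Tm.fv, Tm.collect_bind] at h
        obtain ⟨j, hj⟩ := Tm.exists_mem_of_mem_collect h
        exact he' j hj
      · exact (ih i (he' i)).2 h

theorem lieIter_extend (hr : ∀ x, x ≠ t → o'.rhs x = o.rhs x ∧ t ∉ (o.rhs x).fv)
    {e : Tm L.toSig ℕ} (he : t ∉ e.fv) (k : ℕ) : L.lieIter o' k e = L.lieIter o k e := by
  induction k generalizing e with
  | zero => rfl
  | succ k ih =>
    obtain ⟨h, h'⟩ := lie_extend hr he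
    change L.lieIter o' k (L.lie o' e) = L.lieIter o k (L.lie o e)
    rw [h, ih h']

theorem ODE.rhs_extend (h : o'.eqs = (t, g) :: o.eqs) (ht : t ∉ o.fv) (x : ℕ) (hx : x ≠ t) :
    o'.rhs x = o.rhs x ∧ t ∉ (o.rhs x).fv := by
  have hb : (x == t) = false := by simpa using hx
  constructor
  · rw [rhs, h, List.lookup_cons, hb]
    rfl
  · by_cases hxv : x ∈ o.vars
    · obtain ⟨p, hp, rfl⟩ := mem_vars.1 hxv
      rw [rhs_of_mem hp]
      exact fun h => ht (mem_fv.2 ⟨p, hp, .inr h⟩)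
    · rw [rhs_of_notMem hxv]
      simp [Tm.fv, Tm.collect]

/-- A system with an equation `t' = ±1` has a clock. -/
theorem clocked_of_rate (hc : ExtAx.Cont ∈ A) (hu : ExtAx.Uniq ∈ A) (h : o'.eqs = (t, g) :: o.eqs)
    {σ : ℚ} (hσ : σ * σ = 1) (hg : ∀ a ω, tval a ω g = σ) {ys : List ℕ}
    (hy : Fresh ys o'.vars o'.fv) : ∃ τ, Clocked L A o' ys τ := by
  have hv : o'.vars = t :: o.vars := by rw [ODE.vars, h]; rfl
  have hl := hy.length_eq
  rw [hv] at hl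
  obtain ⟨t₀, ys, rfl⟩ : ∃ t₀ ys', ys = t₀ :: ys' := by
    cases ys with
    | nil => simp at hl
    | cons t₀ ys => exact ⟨t₀, ys, rfl⟩
  have hσ' : (σ : ℝ) * σ = 1 := by exact_mod_cast hσ
  -- The elapsed time `σ (t - t₀)`, where `t₀` is the fresh copy of `t`. As `σ² = 1`, its rate is
  -- `1` in both time directions.
  refine ⟨.mul (.const σ) (.add (.var t) (Tm.neg (.var t₀))), hc, hu, hy, ?_, ?_, ?_⟩
  · refine .real_of_sat (P := .not o'.fixpoint) fun a ω => ?_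
    rw [sat_not, ODE.fixpoint, sat_conj, h]
    intro hz
    have := hz (SA.eqz g) (by simp)
    rw [sat_eqz, hg] at this
    rw [this] at hσ'
    norm_num at hσ'
  · intro a ω
    have h₁ : o'.rhs t = g :=
      ODE.rhs_of_mem (p := (t, g)) (by rw [h]; exact List.mem_cons_self)
    have h₂ : o'.rhs t₀ = .const 0 :=
      ODE.rhs_of_notMem (hy.notMem_vars (Finset.Subset.refl _) t₀ (by simp))
    rw [tval_lie_mul, tval_lie_const, tval_lie_add, tval_lie_neg, TermLang.lie, TermLang.lie,
      h₁, h₂, hg, tval_const, tval_const]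
    push_cast
    linarith
  · intro a ω hE
    rw [hv, SA.eqVec_cons, sat_and, sat_cmp] at hE
    have h₁ : ω t = ω t₀ := hE.1
    rw [tval_mul, tval_add, tval_neg, tval_var, tval_var, h₁]
    ring

/-! ### Normal forms -/

theorem SA.fv_subset_conj {l : List (SA L.toSig)} (h : P ∈ l) : P.fv ⊆ (SA.conj l).fv := by
  induction l with
  | nil => simp at h
  | cons R l ih =>
    rcases List.mem_cons.1 h with rfl | h
    · exact Finset.subset_union_left
    · exact (ih h).trans Finset.subset_union_right

theorem SA.fv_subset_disj {l : List (SA L.toSig)} (h : P ∈ l) : P.fv ⊆ (SA.disj l).fv := by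
  induction l with
  | nil => simp at h
  | cons R l ih =>
    rcases List.mem_cons.1 h with rfl | h
    · exact Finset.subset_union_left
    · exact (ih h).trans Finset.subset_union_right

theorem NormalForm.fv_subset {D : NormalForm L.toSig}
    {c : List (Tm L.toSig ℕ) × List (Tm L.toSig ℕ)} (hc : c ∈ D) {e : Tm L.toSig ℕ}
    (he : e ∈ c.1 ∨ e ∈ c.2) : e.fv ⊆ D.toSA.fv := by
  refine Finset.Subset.trans ?_ (SA.fv_subset_disj (List.mem_map.2 ⟨c, hc, rfl⟩))
  rcases he with he | he
  · refine Finset.Subset.trans ?_ Finset.subset_union_left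
    exact Finset.Subset.trans Finset.subset_union_left
      (SA.fv_subset_conj (List.mem_map_of_mem (f := SA.gez) he))
  · refine Finset.Subset.trans ?_ Finset.subset_union_right
    exact Finset.Subset.trans Finset.subset_union_left
      (SA.fv_subset_conj (List.mem_map_of_mem (f := SA.gtz) he))

/-- The progress formula is formed along `o`, but the decision is about the clocked system `o'`. As
`t` occurs in no term of `D`, the Lie derivatives coincide, and the rank identity of `o` serves for
`o'`. -/
theorem Decides.normalForm {rk : ODE L.toSig → Tm L.toSig ℕ → ℕ}
    (hrk : ∀ (o : ODE L.toSig) (e : Tm L.toSig ℕ), L.IsRank o e (rk o e)) {ys : List ℕ}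
    {τ : Tm L.toSig ℕ} (h : Clocked L A o' ys τ) (he : o'.eqs = (t, g) :: o.eqs)
    (ht : t ∉ o.fv) {D : NormalForm L.toSig} (hD : t ∉ D.toSA.fv) :
    Decides L A o' ys D.toSA (D.progress L rk o) := by
  have hr := ODE.rhs_extend he ht
  have key : ∀ c ∈ D, ∀ e, e ∈ c.1 ∨ e ∈ c.2 → Decides L A o' ys (SA.gez e)
      (L.progGe o (rk o e) e) ∧ Decides L A o' ys (SA.gtz e) (L.progGt o (rk o e) e) := by
    intro c hc e hce
    have hi := lieIter_extend hr (e := e) fun h => hD (NormalForm.fv_subset hc hce h)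
    obtain ⟨hN, g, hg⟩ := hrk o e
    simp only [← hi] at hg
    have hZ : ∀ k, L.lieZero o k e = L.lieZero o' k e := fun k => by
      simp only [TermLang.lieZero, hi]
    have hG : L.progGt o (rk o e) e = L.progGt o' (rk o e) e := by
      simp only [TermLang.progGt, hZ, hi]
    have hG' : L.progGe o (rk o e) e = L.progGe o' (rk o e) e := by
      simp only [TermLang.progGe, hZ, hG]
    rw [hG, hG']
    have hg' := hg.mono_ax (Set.empty_subset A)
    exact ⟨Decides.gez h hN hg', Decides.gtz h hN hg'⟩
  refine Decides.disj h fun c hc => ?_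
  exact (Decides.conj h fun e hce => (key c hc e (.inl hce)).1).and h.uniq
    (Decides.conj h fun e hce => (key c hc e (.inr hce)).2)

theorem NormalForm.sat_toSA {D : NormalForm L.toSig} {a : DTm L.toSig → ℝ} {ω : ℕ → ℝ} :
    D.toSA.Sat a ω ↔
      ∃ c ∈ D, (∀ e ∈ c.1, 0 ≤ tval a ω e) ∧ ∀ e ∈ c.2, 0 < tval a ω e := by
  simp [NormalForm.toSA, sat_disj, sat_and, sat_conj, sat_gez, sat_gtz]

/-- The conjunction of two normal forms. -/
def NormalForm.meet (D D' : NormalForm L.toSig) : NormalForm L.toSig :=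
  D.flatMap fun c => D'.map fun c' => (c.1 ++ c'.1, c.2 ++ c'.2)

theorem NormalForm.sat_meet {D D' : NormalForm L.toSig} {a : DTm L.toSig → ℝ} {ω : ℕ → ℝ} :
    (D.meet D').toSA.Sat a ω ↔ D.toSA.Sat a ω ∧ D'.toSA.Sat a ω := by
  simp only [NormalForm.sat_toSA, NormalForm.meet, List.mem_flatMap, List.mem_map]
  constructor
  · rintro ⟨_, ⟨c, hc, c', hc', rfl⟩, h, h'⟩
    simp only [List.mem_append] at h h'
    exact ⟨⟨c, hc, fun e he => h e (.inl he), fun e he => h' e (.inl he)⟩,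
      ⟨c', hc', fun e he => h e (.inr he), fun e he => h' e (.inr he)⟩⟩
  · rintro ⟨⟨c, hc, h₁, h₂⟩, ⟨c', hc', h₃, h₄⟩⟩
    refine ⟨_, ⟨c, hc, c', hc', rfl⟩, fun e he => ?_, fun e he => ?_⟩
    · exact (List.mem_append.1 he).elim (h₁ e) (h₃ e)
    · exact (List.mem_append.1 he).elim (h₂ e) (h₄ e)

theorem NormalForm.sat_append {D D' : NormalForm L.toSig} {a : DTm L.toSig → ℝ} {ω : ℕ → ℝ} :
    (toSA (D ++ D')).Sat a ω ↔ D.toSA.Sat a ω ∨ D'.toSA.Sat a ω := by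
  simp only [NormalForm.sat_toSA, List.mem_append]
  grind

/-- Carrying a normal form of the negation along makes negation an exchange; conjunction and
disjunction are then dual. -/
theorem exists_normalForms (P : SA L.toSig) : ∃ D D' : NormalForm L.toSig,
    ∀ a ω, (P.Sat a ω ↔ D.toSA.Sat a ω) ∧ (¬ P.Sat a ω ↔ D'.toSA.Sat a ω) := by
  induction P with
  | cmp c s u =>
    set d₁ : Tm L.toSig ℕ := .add s u.neg
    set d₂ : Tm L.toSig ℕ := .add u s.neg
    have h₁ : ∀ a ω, tval a ω d₁ = tval a ω s - tval a ω u := fun a ω => by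
      rw [tval_add, tval_neg]; ring
    have h₂ : ∀ a ω, tval a ω d₂ = tval a ω u - tval a ω s := fun a ω => by
      rw [tval_add, tval_neg]; ring
    cases c with
    | eq =>
      refine ⟨[([d₁, d₂], [])], [([], [d₁]), ([], [d₂])], fun a ω => ?_⟩
      simp only [NormalForm.sat_toSA, sat_cmp, Cmp.Holds]
      simp [h₁, h₂]
      constructor
      · rw [le_antisymm_iff, and_comm]
      · rw [eq_comm]
    | ge =>
      refine ⟨[([d₁], [])], [([], [d₂])], fun a ω => ?_⟩
      simp only [NormalForm.sat_toSA, sat_cmp, Cmp.Holds]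
      simp [h₁, h₂]
    | gt =>
      refine ⟨[([], [d₁])], [([d₂], [])], fun a ω => ?_⟩
      simp only [NormalForm.sat_toSA, sat_cmp, Cmp.Holds]
      simp [h₁, h₂]
  | and P Q hP hQ =>
    obtain ⟨D₁, D₁', h₁⟩ := hP
    obtain ⟨D₂, D₂', h₂⟩ := hQ
    refine ⟨D₁.meet D₂, D₁' ++ D₂', fun a ω => ?_⟩
    rw [NormalForm.sat_meet, NormalForm.sat_append, sat_and, ← (h₁ a ω).1, ← (h₁ a ω).2,
      ← (h₂ a ω).1, ← (h₂ a ω).2]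
    tauto
  | or P Q hP hQ =>
    obtain ⟨D₁, D₁', h₁⟩ := hP
    obtain ⟨D₂, D₂', h₂⟩ := hQ
    refine ⟨D₁ ++ D₂, D₁'.meet D₂', fun a ω => ?_⟩
    rw [NormalForm.sat_meet, NormalForm.sat_append, sat_or, ← (h₁ a ω).1, ← (h₁ a ω).2,
      ← (h₂ a ω).1, ← (h₂ a ω).2]
    tauto
  | not P hP =>
    obtain ⟨D₁, D₁', h₁⟩ := hP
    refine ⟨D₁', D₁, fun a ω => ?_⟩
    rw [sat_not, ← (h₁ a ω).1, ← (h₁ a ω).2]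
    tauto

theorem exists_progress (rk : ODE L.toSig → Tm L.toSig ℕ → ℕ) (o : ODE L.toSig)
    (P : SA L.toSig) : ∃ F, IsProgress L rk o P F := by
  obtain ⟨D, _, h⟩ := exists_normalForms P
  exact ⟨_, D, .iffI (.real_imp fun a ω => ((h a ω).1).1) (.real_imp fun a ω => ((h a ω).1).2), rfl⟩

theorem Decides.of_progress {rk : ODE L.toSig → Tm L.toSig ℕ → ℕ}
    (hrk : ∀ (o : ODE L.toSig) (e : Tm L.toSig ℕ), L.IsRank o e (rk o e)) {ys : List ℕ}
    {τ : Tm L.toSig ℕ} (h : Clocked L A o' ys τ) (he : o'.eqs = (t, g) :: o.eqs)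
    (ht : t ∉ o.fv) {D : NormalForm L.toSig} (hD : t ∉ D.toSA.fv)
    (hP : Deriv L ∅ [] (iff P.toFml D.toSA.toFml)) :
    Decides L A o' ys P (D.progress L rk o) := by
  refine (Decides.normalForm hrk h he ht hD).congr ?_ fun a ω => Iff.rfl
  exact .taut₁ (hP.mono_ax (Set.empty_subset A)) fun v hv a => by
    rw [hv.iff] at *; exact a.symm

/-! ### Real induction -/

theorem realInduction_of_RIdom (hA : ExtAx.RIdom ∈ A) {U : Finset ℕ}
    (hU : o.fv ∪ P.fv ∪ Q.fv ⊆ U) (hf : Deriv L A [] (.not o.fixpoint.toFml)) :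
    RealInduction A o P Q U := fun ys hy =>
  .impR (.mpr_iff (.RIdom o P Q ys hA (hy.mono hU) hf) .head)

/-- For the domain `true`, the premise of progress in the domain is always met by a clocked system,
so the version with domain yields the conclusion that RI asks for. -/
theorem realInduction_of_RI (hA : ExtAx.RI ∈ A) {U : Finset ℕ} (hU : o.fv ∪ P.fv ⊆ U)
    (hc : ∀ ys, Fresh ys o.vars U → ∃ τ, Clocked L A o ys τ) :
    RealInduction A o P .tt U := by
  intro ys hy
  obtain ⟨τ, h⟩ := hc ys hy
  refine .impR (.mpr_iff (.RI o P ys hA (hy.mono hU) h.noFix) (.allVecI ?_ ?_))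
  · intro χ hχ y hy
    obtain rfl := List.mem_singleton.1 hχ
    exact val_notMem_fv_allVec hy
  · refine .box_dom_mono (R := .and .tt (.or P (SA.eqVec o.vars ys))) ?_
      (.box_mono ?_ (.allVecE .head))
    · simp only [sat_and, sat_tt]; tauto
    · have := (Decides.tt h).1
      refine .taut₂ this (.real_of_sat (P := .tt) fun a ω => (sat_tt a ω).2 trivial)
        fun v hv a b => ?_
      simp only [lp, hv.imp, hv.and] at *
      tauto

/-! ### Elimination of the clock -/

/-- The right-hand side of the clock equation `t' = 1`, in the form of a ghost equation. -/
def clockRate (L : TermLang) (t : ℕ) : Tm L.toSig ℕ :=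
  .add (.mul (.const 0) (.var t)) (.const 1)

theorem box_ghost (ht : t ∉ o.vars) (hto : t ∉ o.fv) (htQ : t ∉ Q.fv)
    (htP : t ∉ P.fv) : Deriv L A Γ (iff (box (ode o Q) P.toFml)
      (.all t (box (ode (o.ghost t (clockRate L t) ht) Q) P.toFml))) :=
  .DGall o Q t (.const 0) (.const 1) P.toFml ht hto htQ (by simp [Tm.fv, Tm.collect])
    (by simp [Tm.fv, Tm.collect]) (by rwa [SA.val_mem_fv]) (SA.der_notMem_fv P t)

end Clock

/-! ## Derivation of the semianalytic invariant axioms -/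

section Main
variable {L : TermLang} {A : Set ExtAx} {Γ : List (Fml L.toSig)}
  {o : ODE L.toSig} {P Q FP FQ BP BQ : SA L.toSig} {t : ℕ}
  {φ ψ : Fml L.toSig}

namespace Deriv

theorem allVec_mono (xs : List ℕ) (h : Deriv L A [] (imp φ ψ)) :
    Deriv L A Γ (imp (allVec xs φ) (allVec xs ψ)) := by
  refine .of_nil (.impR (.allVecI ?_ (.mp (.of_nil h) (.allVecE .head))))
  intro χ hχ y hy
  obtain rfl := List.mem_singleton.1 hχ
  exact val_notMem_fv_allVec hy

/-- Quantification of a formula over the clock as well. -/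
theorem allVec_cons_of_notMem (xs : List ℕ) (h : Var.val t ∉ φ.fv) :
    Deriv L A Γ (imp (allVec xs φ) (allVec (t :: xs) φ)) := by
  refine .of_nil (.impR (.allR ?_ .head))
  intro χ hχ
  obtain rfl := List.mem_singleton.1 hχ
  exact fun h' => h (fv_allVec_subset xs φ h')

/-- The axiom with domain constraint for `o` follows from the corresponding facts about `o` extended
by a clock. -/
theorem SAIdom_of_clock (ht : t ∉ o.vars) (hto : t ∉ o.fv) (htP : t ∉ P.fv) (htQ : t ∉ Q.fv)
    (htF : t ∉ (SA.imp (P.and (Q.and FQ)) FP).fv)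
    (htB : t ∉ (SA.imp (P.not.and (Q.and BQ)) BP).fv)
    {U : Finset ℕ} (hU : (o.ghost t (clockRate L t) ht).fv ⊆ U)
    (hu : ExtAx.Uniq ∈ A) (hD : ExtAx.Dadj ∈ A)
    (hp : ProgressDecided A (o.ghost t (clockRate L t) ht) P Q FP FQ BP BQ U)
    (hRI : RealInduction A (o.ghost t (clockRate L t) ht) P Q U) :
    Deriv L A [] (SAIdom o P Q FP FQ BP BQ) := by
  set o' := o.ghost t (clockRate L t) ht
  have hv : o'.vars = t :: o.vars := rfl
  set I : Fml L.toSig := imp P.toFml (box (ode o Q) P.toFml)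
  have hIfv : Var.val t ∉ I.fv := by
    have h₁ := SA.val_mem_fv P t
    simp only [I, imp, Fml.fv, Prog.fv, Finset.mem_union, Finset.mem_sdiff, Finset.mem_image,
      Var.val.injEq, exists_eq_right, h₁]
    tauto
  -- Invariance transfers to the clocked system: `DGall` permits every initial value of the clock,
  -- and `P` does not depend on it.
  have hI : Deriv L A [] (imp (allVec o.vars I)
      (allVec o'.vars (imp P.toFml (box (ode o' Q) P.toFml)))) := by
    rw [hv]
    refine .impR (.mp (.allVec_mono _ ?_) (.mp (.allVec_cons_of_notMem _ hIfv) .head))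
    exact .impR (.impR (.allE (.mp_iff (box_ghost ht hto htQ htP) (.mp (.wk .head) .head))))
  have hnec : ∀ {ψ : Fml L.toSig}, Deriv L A [] (imp
      (allVec o'.vars (imp P.toFml (box (ode o' Q) P.toFml))) ψ) →
      Deriv L A [allVec o.vars I] (allVec o.vars ψ) := fun hψ => by
    refine .allVecI ?_ (.mp (.of_nil hψ) (.mp (.of_nil hI) .head))
    intro χ hχ y hy
    obtain rfl := List.mem_singleton.1 hχ
    exact val_notMem_fv_allVec hy
  refine .iffI (.impR (.andI (hnec (hp.forward_necessary hu))
    (hnec (hp.backward_necessary hu hD)))) (.impR ?_)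
  set J₁ : Fml L.toSig := (SA.imp (P.and (Q.and FQ)) FP).toFml with hJ₁
  set J₂ : Fml L.toSig := (SA.imp (P.not.and (Q.and BQ)) BP).toFml with hJ₂
  have h₁ : Var.val t ∉ J₁.fv := by rwa [hJ₁, SA.val_mem_fv]
  have h₂ : Var.val t ∉ J₂.fv := by rwa [hJ₂, SA.val_mem_fv]
  have hJ : Var.val t ∉ (and (allVec o.vars J₁) (allVec o.vars J₂)).fv := fun h =>
    (Finset.mem_union.1 h).elim (fun h => h₁ (fv_allVec_subset _ _ h))
      fun h => h₂ (fv_allVec_subset _ _ h)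
  change Deriv L A [and (allVec o.vars J₁) (allVec o.vars J₂)] (allVec o.vars I)
  refine .allVecI ?_ (.impR (.mpr_iff (box_ghost ht hto htQ htP) (.allR ?_ ?_)))
  · intro χ hχ y hy h
    obtain rfl := List.mem_singleton.1 hχ
    exact (Finset.mem_union.1 h).elim (val_notMem_fv_allVec hy) (val_notMem_fv_allVec hy)
  · intro χ hχ
    rcases List.mem_cons.1 hχ with rfl | hχ
    · rwa [SA.val_mem_fv]
    · obtain rfl := List.mem_singleton.1 hχ
      exact hJ
  · refine .mp (.mp (.mp (.of_nil (hp.sufficient hu hD hU hRI)) ?_) ?_) .head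
    · exact .mp (.allVec_cons_of_notMem _ h₁) (.andL (.wk .head))
    · exact .mp (.allVec_cons_of_notMem _ h₂) (.andR (.wk .head))

end Deriv

theorem tval_clockRate (a : DTm L.toSig → ℝ) (ω : ℕ → ℝ) :
    tval a ω (clockRate L t) = (1 : ℚ) := by
  rw [clockRate, tval_add, tval_mul, tval_const, tval_const]
  push_cast
  ring

theorem clocked_ghost (hc : ExtAx.Cont ∈ A) (hu : ExtAx.Uniq ∈ A) (ht : t ∉ o.vars) {ys : List ℕ}
    (hy : Fresh ys (o.ghost t (clockRate L t) ht).vars (o.ghost t (clockRate L t) ht).fv) :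
    ∃ τ, Clocked L A (o.ghost t (clockRate L t) ht) ys τ :=
  clocked_of_rate hc hu rfl (mul_one 1) tval_clockRate hy

theorem clocked_ghost_neg (hc : ExtAx.Cont ∈ A) (hu : ExtAx.Uniq ∈ A) (ht : t ∉ o.vars)
    {ys : List ℕ}
    (hy : Fresh ys (o.ghost t (clockRate L t) ht).vars (o.ghost t (clockRate L t) ht).fv) :
    ∃ τ, Clocked L A (o.ghost t (clockRate L t) ht).neg ys τ := by
  refine clocked_of_rate (o := o.neg) (t := t) (g := (clockRate L t).neg) (σ := -1) hc hu rfl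
    (by norm_num) (fun a ω => ?_) (by rwa [ODE.vars_neg, ODE.fv_neg])
  rw [tval_neg, tval_clockRate]
  push_cast
  rfl

theorem SAIdom_derivable {rk : ODE L.toSig → Tm L.toSig ℕ → ℕ}
    (hrk : ∀ (o : ODE L.toSig) (e : Tm L.toSig ℕ), L.IsRank o e (rk o e))
    (hc : ExtAx.Cont ∈ A) (hu : ExtAx.Uniq ∈ A) (hD : ExtAx.Dadj ∈ A) (hR : ExtAx.RIdom ∈ A)
    (hFP : IsProgress L rk o P FP) (hFQ : IsProgress L rk o Q FQ)
    (hBP : IsProgress L rk o.neg P.not BP) (hBQ : IsProgress L rk o.neg Q BQ) :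
    Deriv L A [] (SAIdom o P Q FP FQ BP BQ) := by
  obtain ⟨D₁, e₁, rfl⟩ := hFP
  obtain ⟨D₂, e₂, rfl⟩ := hFQ
  obtain ⟨D₃, e₃, rfl⟩ := hBP
  obtain ⟨D₄, e₄, rfl⟩ := hBQ
  set FP := D₁.progress L rk o
  set FQ := D₂.progress L rk o
  set BP := D₃.progress L rk o.neg
  set BQ := D₄.progress L rk o.neg
  -- The normal forms may contain variables that `P` and `Q` lack, and the clock has to avoid these
  -- as well.
  obtain ⟨t, ht⟩ := Infinite.exists_notMem_finset (o.fv ∪ P.fv ∪ Q.fv ∪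
    (SA.imp (P.and (Q.and FQ)) FP).fv ∪ (SA.imp (P.not.and (Q.and BQ)) BP).fv ∪
    (D₁.toSA.fv ∪ D₂.toSA.fv ∪ D₃.toSA.fv ∪ D₄.toSA.fv))
  simp only [Finset.mem_union, not_or] at ht
  obtain ⟨⟨⟨⟨⟨hto, htP⟩, htQ⟩, htF⟩, htB⟩, ⟨⟨ht₁, ht₂⟩, ht₃⟩, ht₄⟩ := ht
  have hto' : t ∉ o.neg.fv := by rwa [ODE.fv_neg]
  have htv : t ∉ o.vars := fun h => hto (ODE.mem_fv_of_mem_vars h)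
  set o' := o.ghost t (clockRate L t) htv
  have hU : o'.fv ⊆ o'.fv ∪ P.fv ∪ Q.fv := fun x hx => by simp [hx]
  have hf : Deriv L A [] (.not o'.fixpoint.toFml) := by
    obtain ⟨ys, hy⟩ := exists_fresh o'.vars o'.fv
    obtain ⟨τ, h⟩ := clocked_ghost hc hu htv hy
    exact h.noFix
  refine .SAIdom_of_clock htv hto htP htQ htF htB hU hu hD ⟨?_, ?_, ?_, ?_⟩
    (realInduction_of_RIdom hR subset_rfl hf)
  all_goals
    intro ys hy
    obtain ⟨τ, h⟩ := clocked_ghost hc hu htv (hy.mono hU)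
    obtain ⟨τ', h'⟩ := clocked_ghost_neg hc hu htv (hy.mono hU)
  · exact .of_progress hrk h rfl hto ht₁ e₁
  · exact .of_progress hrk h rfl hto ht₂ e₂
  · exact .of_progress hrk h' rfl hto' ht₃ e₃
  · exact .of_progress hrk h' rfl hto' ht₄ e₄

theorem SAI_of_SAIdom (h : Deriv L A [] (SAIdom o P .tt FP .tt BP .tt)) :
    Deriv L A [] (SAI o P FP BP) := by
  have ht : Deriv L A [] (SA.tt : SA L.toSig).toFml :=
    .real_of_sat fun a ω => (sat_tt a ω).2 trivial
  have key : ∀ R F : SA L.toSig, Deriv L A [] (iff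
      (allVec o.vars (imp (R.and (SA.tt.and .tt)).toFml F.toFml))
      (allVec o.vars (imp R.toFml F.toFml))) := fun R F => by
    refine .iffI (.allVec_mono _ (.taut₁ ht fun v hv a => ?_))
      (.allVec_mono _ (.taut fun v hv => ?_))
    all_goals
      simp only [SA.toFml, hv.imp, hv.and]
      tauto
  refine .taut₃ h (key P FP) (key P.not BP) fun v hv a b c => ?_
  simp only [SAI, SAIdom, hv.iff, hv.and] at *
  rw [a, b, c]

/-- The trivial domain is its own progress formula as far as `Decides` is concerned, in both
directions; no normal form of it is needed. -/
theorem SAI_derivable {rk : ODE L.toSig → Tm L.toSig ℕ → ℕ}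
    (hrk : ∀ (o : ODE L.toSig) (e : Tm L.toSig ℕ), L.IsRank o e (rk o e))
    (hc : ExtAx.Cont ∈ A) (hu : ExtAx.Uniq ∈ A) (hD : ExtAx.Dadj ∈ A) (hR : ExtAx.RI ∈ A)
    (hFP : IsProgress L rk o P FP) (hBP : IsProgress L rk o.neg P.not BP) :
    Deriv L A [] (SAI o P FP BP) := by
  obtain ⟨D₁, e₁, rfl⟩ := hFP
  obtain ⟨D₃, e₃, rfl⟩ := hBP
  set FP := D₁.progress L rk o
  set BP := D₃.progress L rk o.neg
  have htt : (SA.tt : SA L.toSig).fv = ∅ := rfl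
  obtain ⟨t, ht⟩ := Infinite.exists_notMem_finset (o.fv ∪ P.fv ∪
    (SA.imp (P.and (SA.tt.and .tt)) FP).fv ∪ (SA.imp (P.not.and (SA.tt.and .tt)) BP).fv ∪
    (D₁.toSA.fv ∪ D₃.toSA.fv))
  simp only [Finset.mem_union, not_or] at ht
  obtain ⟨⟨⟨⟨hto, htP⟩, htF⟩, htB⟩, ht₁, ht₃⟩ := ht
  have hto' : t ∉ o.neg.fv := by rwa [ODE.fv_neg]
  have htv : t ∉ o.vars := fun h => hto (ODE.mem_fv_of_mem_vars h)
  set o' := o.ghost t (clockRate L t) htv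
  have hU : o'.fv ⊆ o'.fv ∪ P.fv := Finset.subset_union_left
  refine SAI_of_SAIdom (.SAIdom_of_clock htv hto htP (by simp [htt]) htF htB hU hu hD
    ⟨?_, ?_, ?_, ?_⟩
    (realInduction_of_RI hR subset_rfl fun ys hy => clocked_ghost hc hu htv (hy.mono hU)))
  all_goals
    intro ys hy
    obtain ⟨τ, h⟩ := clocked_ghost hc hu htv (hy.mono hU)
    obtain ⟨τ', h'⟩ := clocked_ghost_neg hc hu htv (hy.mono hU)
  · exact .of_progress hrk h rfl hto ht₁ e₁
  · exact .tt h
  · exact .of_progress hrk h' rfl hto' ht₃ e₃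
  · exact .tt h'

end Main
end DL

theorem mainTheorem2 (L : DL.TermLang)
    (rk : DL.ODE L.toSig → DL.Tm L.toSig ℕ → ℕ)
    (hrk : ∀ (o : DL.ODE L.toSig) (e : DL.Tm L.toSig ℕ), L.IsRank o e (rk o e))
    (o : DL.ODE L.toSig) (P : DL.SA L.toSig) :
    -- progress formulas exist, forwards and backwards
    ((∃ F, DL.IsProgress L rk o P F) ∧ (∃ B, DL.IsProgress L rk o.neg P.not B)) ∧
    -- without domain constraint
    (∀ F B : DL.SA L.toSig,
      DL.IsProgress L rk o P F → DL.IsProgress L rk o.neg P.not B →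
      DL.Deriv L {.RI, .Dadj, .Cont, .Uniq} [] (DL.SAI o P F B)) ∧
    -- with a semianalytic domain constraint `Q`
    (∀ Q FP FQ BP BQ : DL.SA L.toSig,
      DL.IsProgress L rk o P FP → DL.IsProgress L rk o Q FQ →
      DL.IsProgress L rk o.neg P.not BP → DL.IsProgress L rk o.neg Q BQ →
      DL.Deriv L {.RIdom, .Dadj, .Cont, .Uniq} [] (DL.SAIdom o P Q FP FQ BP BQ)) :=
  ⟨⟨DL.exists_progress rk o P, DL.exists_progress rk o.neg P.not⟩,
    fun _ _ hF hB => DL.SAI_derivable hrk (by simp) (by simp) (by simp) (by simp) hF hB,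
    fun _ _ _ _ _ hFP hFQ hBP hBQ =>
      DL.SAIdom_derivable hrk (by simp) (by simp) (by simp) (by simp) hFP hFQ hBP hBQ⟩
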